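/- **Setting.** For $j=1,2$ let $Y_{jt}=\mu_j+u_{jt}$, $t=1,\dots,T_j$, where $(u_{jt})_{t\in\mathbb Z}$ are mean zero processes and $(u_{1t})$ is independent of $(u_{2t})$. Let $\Omega_j=\lim_{T\to\infty}\mathrm{Var}\big(T^{-1/2}\sum_{t=1}^{T}u_{jt}\big)$ be the long-run variance, with $\Omega_j>0$. Assume: (a) (functional CLT) $T^{-1/2}\sum_{t=1}^{\lfloor rT\rfloor}(u_{1t},u_{2t})'$, $r\in[0,1]$, converges weakly to $\mathrm{diag}(\sqrt{\Omega_1},\sqrt{\Omega_2})\,W_2(r)$, where $W_2$ is a two-dimensional standard Brownian motion; (b) each $(u_{jt})$ is fourth order stationary with $\sum_{h\in\mathbb Z}|h|^3|\gamma_j(h)|<\infty$ and $\sum_{h_1,h_2,h_3\in\mathbb Z}|\kappa_j(0,h_1,h_2,h_3)|<\infty$, where $\gamma_j(h)=E(u_{jt}u_{j,t+h})$ and $\kappa_j$ is the fourth order cumulant. **Statistic.** Let $(\phi_\ell)_{\ell\ge1}$ be the trigonometric basis $\phi_\ell(x)=\sqrt2\cos(2\pi\ell x)$ for odd $\ell$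 and $\sqrt2\sin(2\pi\ell x)$ for even $\ell$ (or, alternatively, $\phi_{2m-1}(x)=\sqrt2\cos(2\pi mx)$, $\phi_{2m}(x)=\sqrt2\sin(2\pi mx)$). With $\bar Y_j=T_j^{-1}\sum_{t\le T_j} Y_{jt}$ and $\hat u_{jt}=Y_{jt}-\bar Y_j$ put $$\hat\Omega_j=\frac1{K_j}\sum_{\ell=1}^{K_j}\Big(\frac1{\sqrt{T_j}}\sum_{t=1}^{T_j}\phi_\ell\big(\tfrac t{T_j}\big)\hat u_{jt}\Big)^2,\qquad t_{1,\mathrm{HAR}}=\frac{\bar Y_1-\bar Y_2}{\sqrt{\hat\Omega_1/T_1+\hat\Omega_2/T_2}} .$$ **Bootstrap.** Let $v_{j,r\ell}$ ($j,r\in\{1,2\}$, $\ell\ge1$) be external random variables, independent of the data and of each other, with mean $0$, variance $1$ and $E^*v_{j,r\ell}^4<C$ for a constant $C<\infty$ (for instance i.i.d.; their laws may depend on the sample sizes, but $C$ may not). Put $$\eta_{jt}=\frac1{\sqrt{K_j^*}}\sum_{\ell=1}^{K_j^*}\big[\cos(2\pi\ell t/T_j)\,v_{j,1\ell}+\sin(2\pi\ell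 t/T_j)\,v_{j,2\ell}\big],\qquad Y^*_{jt}=\frac{T_1\bar Y_1+T_2\bar Y_2}{T_1+T_2}+\hat u_{jt}\,\eta_{jt},$$ and let $t^*_{1,\mathrm{HAR}}$ be the statistic $t_{1,\mathrm{HAR}}$ computed from $(Y^*_{jt})$ in place of $(Y_{jt})$, with the same $\phi_\ell$, $K_1$, $K_2$. Let $P^*$ be the probability given the data. **Theorem.** Let $T_j\to\infty$, $K_j\to\infty$ and $K_j^*\to\infty$ with $K_j/T_j\to0$ and $K_j^*/T_j\to0$ for $j=1,2$. If $\mu_1=\mu_2$, then $$\sup_{x\in\mathbb R}\big|P^*(t^*_{1,\mathrm{HAR}}<x)-P(t_{1,\mathrm{HAR}}<x)\big|=o_P(1).$$ For arbitrary $\mu_1,\mu_2$ the same holds with $P(t_{1,\mathrm{HAR}}<x)$ replaced by the null distribution of the statistic, that is, the distribution of $t_{1,\mathrm{HAR}}$ computed from the series $m+u_{jt}$, $j=1,2$, with a common mean $m$ (any $m\in\mathbb R$). -/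

import Mathlib

open MeasureTheory ProbabilityTheory Filter Topology
open scoped NNReal ENNReal

namespace SHARWB

noncomputable section

/-! ### Samples and the series-HAR studentized statistic

A sample path is a function `y : ℕ → ℝ` of which the entries `y 1, …, y T` are observed. The two
samples are indexed by `Fin 2`. -/

/-- The sample mean `(1/T) ∑_{t=1}^T y_t`. -/
def sampleMean (T : ℕ) (y : ℕ → ℝ) : ℝ :=
  (∑ t ∈ Finset.Icc 1 T, y t) / T

/-- The residual `y_t - ȳ`. -/
def resid (T : ℕ) (y : ℕ → ℝ) (t : ℕ) : ℝ :=
  y t - sampleMean T y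

/-- The projection coefficient `T^{-1/2} ∑_{t=1}^T φ_ℓ(t/T) (y_t - ȳ)`. -/
def projCoeff (φ : ℕ → ℝ → ℝ) (T : ℕ) (y : ℕ → ℝ) (l : ℕ) : ℝ :=
  (1 / √(T : ℝ)) * ∑ t ∈ Finset.Icc 1 T, φ l ((t : ℝ) / T) * resid T y t

/-- The series-HAR estimator of the long-run variance: the average over `ℓ = 1, …, K` of the
squared projection coefficients. -/
def seriesLRV (φ : ℕ → ℝ → ℝ) (T K : ℕ) (y : ℕ → ℝ) : ℝ :=
  (1 / (K : ℝ)) * ∑ l ∈ Finset.Icc 1 K, projCoeff φ T y l ^ 2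

/-- The studentized two-sample statistic
`(ȳ₁ - ȳ₂) / √(LRV₁ / T₁ + LRV₂ / T₂)`. -/
def tHAR (φ : ℕ → ℝ → ℝ) (T K : Fin 2 → ℕ) (y : Fin 2 → ℕ → ℝ) : ℝ :=
  (sampleMean (T 0) (y 0) - sampleMean (T 1) (y 1)) /
    √(seriesLRV φ (T 0) (K 0) (y 0) / T 0 + seriesLRV φ (T 1) (K 1) (y 1) / T 1)

/-- The basis `φ_ℓ(x) = √2 cos(2πℓx)` for odd `ℓ`, `√2 sin(2πℓx)` for even `ℓ`. -/
def alternatingBasis (l : ℕ) (x : ℝ) : ℝ :=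
  if Odd l then √2 * Real.cos (2 * Real.pi * l * x) else √2 * Real.sin (2 * Real.pi * l * x)

/-- The basis `φ_{2m-1}(x) = √2 cos(2πmx)`, `φ_{2m}(x) = √2 sin(2πmx)`, `m ≥ 1`. -/
def pairedBasis (l : ℕ) (x : ℝ) : ℝ :=
  if Odd l then √2 * Real.cos (2 * Real.pi * ((l + 1) / 2 : ℕ) * x)
  else √2 * Real.sin (2 * Real.pi * (l / 2 : ℕ) * x)

/-! ### The wild bootstrap -/

/-- The external variable `η_t` built from the draws `v 0 ℓ` (cosine part) and `v 1 ℓ` (sine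
part), `ℓ = 1, …, Ks`. -/
def eta (T Ks : ℕ) (v : Fin 2 → ℕ → ℝ) (t : ℕ) : ℝ :=
  (1 / √(Ks : ℝ)) * ∑ l ∈ Finset.Icc 1 Ks,
    (Real.cos (2 * Real.pi * l * ((t : ℝ) / T)) * v 0 l +
      Real.sin (2 * Real.pi * l * ((t : ℝ) / T)) * v 1 l)

/-- The pooled mean `(T₁ ȳ₁ + T₂ ȳ₂) / (T₁ + T₂)`. -/
def pooledMean (T : Fin 2 → ℕ) (y : Fin 2 → ℕ → ℝ) : ℝ :=
  (T 0 * sampleMean (T 0) (y 0) + T 1 * sampleMean (T 1) (y 1)) / (T 0 + T 1)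

/-- The bootstrap sample `y*_{jt} = pooled mean + (y_{jt} - ȳ_j) η_{jt}`. -/
def bootSample (T Ks : Fin 2 → ℕ) (y : Fin 2 → ℕ → ℝ) (v : Fin 2 → Fin 2 → ℕ → ℝ)
    (j : Fin 2) (t : ℕ) : ℝ :=
  pooledMean T y + resid (T j) (y j) t * eta (T j) (Ks j) (v j) t

/-- The bootstrap statistic: the same studentized statistic, computed from the bootstrap
sample. -/
def tHARStar (φ : ℕ → ℝ → ℝ) (T K Ks : Fin 2 → ℕ) (y : Fin 2 → ℕ → ℝ)
    (v : Fin 2 → Fin 2 → ℕ → ℝ) : ℝ :=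
  tHAR φ T K (bootSample T Ks y v)

/-! ### The data generating process -/

section Data

variable {Ω : Type*} [MeasurableSpace Ω]

/-- The observations `Y_{jt} = μ_j + u_{jt}`, `t = 1, 2, …`. -/
def obs (μ : Fin 2 → ℝ) (u : Fin 2 → ℤ → Ω → ℝ) (ω : Ω) (j : Fin 2) (t : ℕ) : ℝ :=
  μ j + u j (t : ℤ) ω

/-- The partial sum path `r ↦ T^{-1/2} ∑_{t=1}^{⌊rT⌋} u_t` on `[0,1]`, with values in `ℝ²`. -/
def partialSumPath (u : Fin 2 → ℤ → Ω → ℝ) (T : ℕ) (ω : Ω) (r : unitInterval) (j : Fin 2) : ℝ :=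
  (1 / √(T : ℝ)) * ∑ t ∈ Finset.Icc 1 ⌊(r : ℝ) * T⌋₊, u j (t : ℤ) ω

/-- The functional central limit theorem: the partial sum path converges in distribution to
`diag(√L₁, √L₂) W`, where `W` is a two-dimensional standard Brownian motion. Convergence is
weak convergence for the topology of uniform convergence on `[0,1]`; since the limit has
continuous paths, this is the same as weak convergence in the Skorokhod space. -/
def FunctionalCLT (P : Measure Ω) (u : Fin 2 → ℤ → Ω → ℝ) (L : Fin 2 → ℝ) : Prop :=
  ∃ (S : Type) (_ : MeasurableSpace S) (Q : Measure S) (W : Fin 2 → ℝ≥0 → S → ℝ),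
    IsProbabilityMeasure Q ∧
    (∀ j, IsBrownianReal (W j) Q) ∧
    IndepFun (fun s r => W 0 r s) (fun s r => W 1 r s) Q ∧
    ∀ F : BoundedContinuousFunction (UniformFun unitInterval (Fin 2 → ℝ)) ℝ,
      Tendsto (fun T : ℕ => ∫ ω, F (UniformFun.ofFun (partialSumPath u T ω)) ∂P) atTop
        (𝓝 (∫ s, F (UniformFun.ofFun fun (r : unitInterval) (j : Fin 2) =>
          √(L j) * W j (Real.toNNReal r) s) ∂Q))

/-- `L` is the long-run variance of the process: the limit of the variance of
`T^{-1/2} ∑_{t=1}^T u_t`. -/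
def IsLongRunVariance (P : Measure Ω) (u : ℤ → Ω → ℝ) (L : ℝ) : Prop :=
  Tendsto (fun T : ℕ =>
    Var[fun ω => (1 / √(T : ℝ)) * ∑ t ∈ Finset.Icc 1 T, u (t : ℤ) ω; P]) atTop (𝓝 L)

/-- Fourth order stationarity: finite fourth moments, and all mixed moments of order at most four
are invariant under time shifts. -/
structure FourthOrderStationary (P : Measure Ω) (u : ℤ → Ω → ℝ) : Prop where
  memLp : ∀ t, MemLp (u t) 4 P
  shift : ∀ k ≤ 4, ∀ (s : Fin k → ℤ) (h : ℤ),
    ∫ ω, ∏ i, u (s i + h) ω ∂P = ∫ ω, ∏ i, u (s i) ω ∂P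

/-- The autocovariance `γ(h) = E(u_0 u_h)` of a mean zero stationary process. -/
def autocov (P : Measure Ω) (u : ℤ → Ω → ℝ) (h : ℤ) : ℝ :=
  ∫ ω, u 0 ω * u h ω ∂P

/-- The fourth order cumulant `κ(0,a,b,c)` of `(u_0, u_a, u_b, u_c)`: the central fourth moment
minus the value that it has for a Gaussian vector with the same mean and covariance. -/
def cumulant4 (P : Measure Ω) (u : ℤ → Ω → ℝ) (a b c : ℤ) : ℝ :=
  (∫ ω, (u 0 ω - ∫ ω', u 0 ω' ∂P) * (u a ω - ∫ ω', u a ω' ∂P) *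
      (u b ω - ∫ ω', u b ω' ∂P) * (u c ω - ∫ ω', u c ω' ∂P) ∂P)
    - (cov[u 0, u a; P] * cov[u b, u c; P] + cov[u 0, u b; P] * cov[u a, u c; P] +
        cov[u 0, u c; P] * cov[u a, u b; P])

/-- The conditions on one error process: mean zero, fourth order stationary, with
`∑ |h|³ |γ(h)| < ∞` and absolutely summable fourth order cumulants. -/
structure WeaklyDependent (P : Measure Ω) (u : ℤ → Ω → ℝ) : Prop where
  mean_zero : ∀ t, ∫ ω, u t ω ∂P = 0
  stationary : FourthOrderStationary P u
  autocov_summable : Summable fun h : ℤ => |(h : ℝ)| ^ 3 * |autocov P u h|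
  cumulant_summable : Summable fun p : ℤ × ℤ × ℤ => |cumulant4 P u p.1 p.2.1 p.2.2|

end Data

/-- The external draws of one bootstrap round, `v j r ℓ` with `j` the sample, `r` the cosine or
sine part and `ℓ` the frequency: independent, with mean `0`, variance `1` and fourth moment
below `C`. -/
structure ExternalDraws {S : Type*} [MeasurableSpace S] (Q : Measure S)
    (v : Fin 2 → Fin 2 → ℕ → S → ℝ) (C : ℝ) : Prop where
  measurable : ∀ j r l, Measurable (v j r l)
  indep : iIndepFun (fun i : Fin 2 × Fin 2 × ℕ => v i.1 i.2.1 i.2.2) Q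
  mean_zero : ∀ j r l, ∫ s, v j r l s ∂Q = 0
  var_one : ∀ j r l, Var[v j r l; Q] = 1
  memLp : ∀ j r l, MemLp (v j r l) 4 Q
  fourth_lt : ∀ j r l, ∫ s, v j r l s ^ 4 ∂Q < C

/-- The Kolmogorov distance `sup_x |P*(t* < x) - P(t⁰ < x)|`, given the observed samples `y`. Here
`Q` is the law of the external draws, so that `Q {s | …}` is the bootstrap probability with the
data held fixed, and `P(t⁰ < x)` is the sampling distribution of the studentized statistic
when the two samples have means `μ₀`. -/
def bootDist {Ω S : Type*} [MeasurableSpace Ω] [MeasurableSpace S] (P : Measure Ω) (Q : Measure S)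
    (φ : ℕ → ℝ → ℝ) (T K Ks : Fin 2 → ℕ) (u : Fin 2 → ℤ → Ω → ℝ)
    (v : Fin 2 → Fin 2 → ℕ → S → ℝ) (μ₀ : Fin 2 → ℝ) (y : Fin 2 → ℕ → ℝ) : ℝ :=
  ⨆ x : ℝ, |Q.real {s | tHARStar φ T K Ks y (fun j r l => v j r l s) < x} -
    P.real {ω | tHAR φ T K (obs μ₀ u ω) < x}|

end

end SHARWB

/-! Both distribution functions are compared with the standard normal one. Each statistic is a
difference of normalized means over an estimated standard deviation, so a central limit theorem for
the numerator, consistency of the two variance estimators, Slutsky's theorem and Pólya's theorem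
give uniform normality (`eventually_forall_abs_twoSample_sub_le`). The ratio of the sample sizes
need not converge. The numerators are therefore scaled by the weights `stdWeight`, which are bounded
and satisfy $L_0w_0^2+L_1w_1^2=1$ for every pair of sample sizes.

For the null statistic, the numerator is handled by evaluating the functional limit theorem at $r=1$
and using independence of the two series (`tendsto_charFun_difference`). Consistency of the variance
estimators is `tendsto_projMean`.

For the bootstrap the data are held fixed. The basis functions and the trigonometric regressors sum
to zero over the grid, so centering either drops out or moves onto the weights. The normalized
bootstrap mean is then a linear form in the external draws, with coefficients given by the
projections of the errors on cosines and sines (`sampleMean_resid_mul_eta`). It obeys Lyapunov's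
theorem once the sum of squared coefficients `trigMean` is close to $L_j$ and the sum of fourth
powers `trigFourth` is small. The bootstrap long-run variance is a quadratic form in the draws
(`seriesLRV_resid_mul_eta`). Its conditional mean is the trace of a Gram matrix, and its conditional
variance is at most a constant times the squared Hilbert–Schmidt norm of that matrix
(`integral_quadForm_sub_sq_le`). Consistency thus needs trace near $L_j$ and small norm.

These four data-dependent quantities are controlled by moments of weighted sums $T^{-1/2}\sum_t
f_tu_t$ with smooth weights. Their covariances are $(\sum_h\gamma(h))\cdot T^{-1}\sum_t f_tg_t$ up
to an error of order $(K+K^*)/T$ (`abs_covForm_sub_le`), and their fourth moments are Gaussian up to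
$O(1/T)$ (`abs_integral_linStat_mul_four_sub_le`). What remains is the size of sums of squared inner
products of the weights. Bessel's inequality bounds these, applied to the regressors or to the basis
functions (`sum_gridInner_prodWeight_sq_le_trig`, `sum_gridInner_prodWeight_sq_le_basis`).

Finally, normality along every deterministic sequence of data points with converging bootstrap
moments is turned, by contradiction, into normality uniform over a set of regular data
(`exists_forall_bootRegular`), whose complement has vanishing probability by Markov's inequality. -/

namespace SHARWB

/-! ### Uniform convergence to the normal law: Pólya and Slutsky -/

/-- The distribution function of the standard normal law. -/
noncomputable def stdNormalCDF (x : ℝ) : ℝ := (gaussianReal 0 1).real (Set.Iio x)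

lemma stdNormalCDF_eq_cdf : stdNormalCDF = cdf (gaussianReal 0 1) := by
  have := nullSingletonClass_gaussianReal (μ := 0) (v := 1) one_ne_zero
  ext x
  rw [cdf_eq_real, stdNormalCDF]
  exact measureReal_congr Iio_ae_eq_Iic

lemma monotone_stdNormalCDF : Monotone stdNormalCDF :=
  stdNormalCDF_eq_cdf ▸ monotone_cdf _

/-- The jump of a distribution function at a point is the mass of that point, and a nondegenerate
Gaussian law has no atoms. -/
lemma continuous_stdNormalCDF : Continuous stdNormalCDF := by
  have := nullSingletonClass_gaussianReal (μ := 0) (v := 1) one_ne_zero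
  rw [stdNormalCDF_eq_cdf, continuous_iff_continuousAt]
  intro x
  set f := cdf (gaussianReal 0 1)
  have hm : Monotone f := monotone_cdf _
  rw [hm.continuousAt_iff_leftLim_eq_rightLim]
  have h1 : f.measure {x} = 0 := by
    rw [measure_cdf]; exact measure_singleton x
  rw [StieltjesFunction.measure_singleton, ENNReal.ofReal_eq_zero] at h1
  have h2 : Function.leftLim f x ≤ f x := hm.leftLim_le le_rfl
  rw [StieltjesFunction.rightLim_eq]
  linarith

/-- **Pólya's theorem**: pointwise convergence of distribution functions to a continuous one is
uniform. -/
lemma eventually_forall_abs_sub_le_of_monotone {F : ℕ → ℝ → ℝ} {G : ℝ → ℝ}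
    (hF : ∀ n, Monotone (F n)) (hF0 : ∀ n x, 0 ≤ F n x) (hF1 : ∀ n x, F n x ≤ 1)
    (hG : Monotone G) (hGc : Continuous G) (hG0 : Tendsto G atBot (𝓝 0))
    (hG1 : Tendsto G atTop (𝓝 1)) (h : ∀ x, Tendsto (fun n => F n x) atTop (𝓝 (G x)))
    {ε : ℝ} (hε : 0 < ε) : ∀ᶠ n in atTop, ∀ x, |F n x - G x| ≤ ε := by
  have hG0' : ∀ x, 0 ≤ G x := fun x => hG.le_of_tendsto hG0 x
  have hG1' : ∀ x, G x ≤ 1 := fun x => hG.ge_of_tendsto hG1 x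
  obtain ⟨a, ha⟩ := (hG0.eventually (gt_mem_nhds (half_pos hε))).exists
  obtain ⟨b, hb⟩ := (hG1.eventually (lt_mem_nhds (show 1 - ε / 2 < 1 by linarith))).exists
  have hlow : ∀ᶠ n in atTop, ∀ x ∈ Set.Iic a, |F n x - G x| ≤ ε := by
    filter_upwards [(h a).eventually (gt_mem_nhds (show G a < ε by linarith))] with n hn x hx
    have h1 := hF n hx
    have h2 := hG hx
    rw [abs_le]
    constructor <;> linarith [hF0 n x, hG0' x]
  have hhigh : ∀ᶠ n in atTop, ∀ x ∈ Set.Ici b, |F n x - G x| ≤ ε := by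
    filter_upwards [(h b).eventually (lt_mem_nhds (show 1 - ε < G b by linarith))] with n hn x hx
    have h1 := hF n hx
    have h2 := hG hx
    rw [abs_le]
    constructor <;> linarith [hF1 n x, hG1' x]
  have hmid : ∀ᶠ n in atTop, ∀ x ∈ Set.Icc a b, |F n x - G x| ≤ ε := by
    -- Compactness replaces the usual finite grid of quantiles. Near a point, monotonicity squeezes
    -- both functions between their values at the two ends of a short interval on which `G` hardly
    -- varies.
    refine (isCompact_Icc (a := a) (b := b)).induction_on
      (p := fun s => ∀ᶠ n in atTop, ∀ x ∈ s, |F n x - G x| ≤ ε) (by simp) ?_ ?_ ?_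
    · intro s t hst ht
      filter_upwards [ht] with n hn x hx using hn x (hst hx)
    · intro s t hs ht
      filter_upwards [hs, ht] with n h1 h2 x hx using hx.elim (h1 x) (h2 x)
    · intro x _
      obtain ⟨δ, hδ, hd⟩ := Metric.continuousAt_iff.1 (hGc.continuousAt (x := x)) (ε / 4)
        (by positivity)
      have hl := hd (x := x - δ / 2) (by rw [Real.dist_eq, abs_lt]; constructor <;> linarith)
      have hr := hd (x := x + δ / 2) (by rw [Real.dist_eq, abs_lt]; constructor <;> linarith)
      rw [Real.dist_eq, abs_lt] at hl hr
      refine ⟨Set.Icc (x - δ / 2) (x + δ / 2), mem_nhdsWithin_of_mem_nhds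
        (Icc_mem_nhds (by linarith) (by linarith)), ?_⟩
      filter_upwards [(h (x - δ / 2)).eventually (lt_mem_nhds (show G (x - δ / 2) - ε / 4 < _ by
          linarith)), (h (x + δ / 2)).eventually (gt_mem_nhds (show _ < G (x + δ / 2) + ε / 4 by
          linarith))] with n hn1 hn2 y hy
      have := hF n hy.1
      have := hF n hy.2
      have := hG hy.1
      have := hG hy.2
      rw [abs_le]
      constructor <;> linarith [hl.1, hl.2, hr.1, hr.2]
  filter_upwards [hlow, hmid, hhigh] with n h1 h2 h3 x
  rcases le_total x a with hx | hx
  · exact h1 x hx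
  · rcases le_total x b with hx' | hx'
    · exact h2 x ⟨hx, hx'⟩
    · exact h3 x hx'

variable {S : Type*} [MeasurableSpace S] {Q : Measure S} [IsProbabilityMeasure Q]

/-- Lévy's continuity theorem followed by the portmanteau theorem for a half-line, whose frontier is
a null set of the Gaussian limit. -/
lemma tendsto_measureReal_lt_of_tendsto_charFun {U : ℕ → S → ℝ} (hU : ∀ n, Measurable (U n))
    (h : ∀ s, Tendsto (fun n => charFun (Q.map (U n)) s) atTop
      (𝓝 (charFun (gaussianReal 0 1) s))) (x : ℝ) :
    Tendsto (fun n => Q.real {s | U n s < x}) atTop (𝓝 (stdNormalCDF x)) := by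
  have := nullSingletonClass_gaussianReal (μ := 0) (v := 1) one_ne_zero
  let μs : ℕ → ProbabilityMeasure ℝ := fun n =>
    ⟨Q.map (U n), Measure.isProbabilityMeasure_map (hU n).aemeasurable⟩
  let ν : ProbabilityMeasure ℝ := ⟨gaussianReal 0 1, inferInstance⟩
  have hw : Tendsto μs atTop (𝓝 ν) := ProbabilityMeasure.tendsto_iff_tendsto_charFun.2 h
  have hfr : (ν : Measure ℝ) (frontier (Set.Iio x)) = 0 := by
    rw [frontier_Iio]
    exact measure_singleton (μ := gaussianReal 0 1) x
  have := ProbabilityMeasure.tendsto_measure_of_null_frontier_of_tendsto' hw hfr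
  have h2 := (ENNReal.tendsto_toReal (measure_ne_top _ _)).comp this
  refine h2.congr fun n => ?_
  change ((Q.map (U n)) (Set.Iio x)).toReal = _
  rw [Measure.map_apply (hU n) measurableSet_Iio]
  rfl

lemma abs_sqrt_sub_one_le (r : ℝ) (hr : 0 ≤ r) : |√r - 1| ≤ |r - 1| := by
  have h1 : r - 1 = (√r - 1) * (√r + 1) := by ring_nf; rw [Real.sq_sqrt hr]
  rw [h1, abs_mul]
  have := Real.sqrt_nonneg r
  refine le_mul_of_one_le_right (abs_nonneg _) ?_
  rw [abs_of_nonneg (by linarith)]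
  linarith

/-- Slutsky's theorem for a studentized statistic, uniformly over the real line. -/
lemma eventually_forall_abs_studentized_sub_le {U R t : ℕ → S → ℝ} (hU : ∀ n, Measurable (U n))
    (h : ∀ s, Tendsto (fun n => charFun (Q.map (U n)) s) atTop
      (𝓝 (charFun (gaussianReal 0 1) s)))
    (hR : ∀ δ > 0, Tendsto (fun n => Q.real {s | δ < |R n s - 1|}) atTop (𝓝 0))
    (ht : ∀ᶠ n in atTop, ∀ s, t n s = U n s / √(R n s)) {ε : ℝ} (hε : 0 < ε) :
    ∀ᶠ n in atTop, ∀ x, |Q.real {s | t n s < x} - stdNormalCDF x| ≤ ε := by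
  refine eventually_forall_abs_sub_le_of_monotone (F := fun n x => Q.real {s | t n s < x})
    (fun n x y hxy => measureReal_mono fun s (hs : _ < _) => lt_of_lt_of_le hs hxy)
    (fun _ _ => measureReal_nonneg) (fun _ _ => measureReal_le_one) monotone_stdNormalCDF
    continuous_stdNormalCDF (stdNormalCDF_eq_cdf ▸ tendsto_cdf_atBot _)
    (stdNormalCDF_eq_cdf ▸ tendsto_cdf_atTop _) (fun x => ?_) hε
  rw [Metric.tendsto_nhds]
  intro η hη
  -- Off the event `δ < |R - 1|`, the threshold `x * √R` lies within `|x| * δ` of `x`. The event `t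
  -- < x` is therefore sandwiched between two events for `U`, and continuity of the limit absorbs
  -- the shift.
  have hcont : Continuous fun δ : ℝ => (stdNormalCDF (x + |x| * δ), stdNormalCDF (x - |x| * δ)) := by
    have := continuous_stdNormalCDF
    fun_prop
  obtain ⟨d, hd, hdx⟩ := Metric.continuousAt_iff.1 (hcont.continuousAt (x := 0)) (η / 4)
    (by positivity)
  -- The condition `δ < 1` forces `R > 0` on the good event, so that the inequality can be
  -- multiplied through by `√R`.
  obtain ⟨δ, hδ0, hδ1, hδd⟩ : ∃ δ : ℝ, 0 < δ ∧ δ < 1 ∧ δ < d :=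
    ⟨min (1 / 2) (d / 2), by positivity, by linarith [min_le_left (1 / 2 : ℝ) (d / 2)],
      by linarith [min_le_right (1 / 2 : ℝ) (d / 2)]⟩
  have hxd := hdx (x := δ) (by rw [Real.dist_eq, sub_zero, abs_of_pos hδ0]; exact hδd)
  simp only [mul_zero, add_zero, sub_zero, Prod.dist_eq, max_lt_iff, Real.dist_eq, abs_lt] at hxd
  filter_upwards [ht,
    (hR δ hδ0).eventually (gt_mem_nhds (show 0 < η / 4 by positivity)),
    (tendsto_measureReal_lt_of_tendsto_charFun hU h (x + |x| * δ)).eventually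
      (gt_mem_nhds (show _ < stdNormalCDF (x + |x| * δ) + η / 4 by linarith)),
    (tendsto_measureReal_lt_of_tendsto_charFun hU h (x - |x| * δ)).eventually
      (lt_mem_nhds (show stdNormalCDF (x - |x| * δ) - η / 4 < _ by linarith))] with n hn hr hu hl
  have key : ∀ s, ¬ δ < |R n s - 1| → (t n s < x ↔ U n s < x * √(R n s)) ∧
      x - |x| * δ ≤ x * √(R n s) ∧ x * √(R n s) ≤ x + |x| * δ := by
    intro s hs
    rw [not_lt, abs_le] at hs
    have hRp : 0 < R n s := by linarith
    refine ⟨by rw [hn s, div_lt_iff₀ (Real.sqrt_pos.2 hRp)], ?_⟩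
    have h1 : |x * √(R n s) - x| ≤ |x| * δ := by
      rw [show x * √(R n s) - x = x * (√(R n s) - 1) by ring, abs_mul]
      gcongr
      exact (abs_sqrt_sub_one_le _ hRp.le).trans (abs_le.2 hs)
    rw [abs_le] at h1
    constructor <;> linarith
  have hup : Q.real {s | t n s < x} ≤
      Q.real {s | U n s < x + |x| * δ} + Q.real {s | δ < |R n s - 1|} := by
    refine le_trans (measureReal_mono (fun s hs => ?_)) (measureReal_union_le _ _)
    by_cases h1 : δ < |R n s - 1|
    · exact Or.inr h1
    · exact Or.inl (((key s h1).1.1 hs).trans_le (key s h1).2.2)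
  have hlo : Q.real {s | U n s < x - |x| * δ} ≤
      Q.real {s | t n s < x} + Q.real {s | δ < |R n s - 1|} := by
    refine le_trans (measureReal_mono (fun s hs => ?_)) (measureReal_union_le _ _)
    by_cases h1 : δ < |R n s - 1|
    · exact Or.inr h1
    · exact Or.inl ((key s h1).1.2 (lt_of_lt_of_le hs (key s h1).2.1))
  rw [Real.dist_eq, abs_lt]
  constructor <;> linarith [hxd.1.1, hxd.1.2, hxd.2.1, hxd.2.2]

end SHARWB

/-! ### Lyapunov's central limit theorem through characteristic functions -/

namespace SHARWB

/-- Taylor's bound covers `|x| ≤ 1`. For `|x| ≥ 1` each term is bounded separately, and `2 + |x| +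
x² / 2` is at most `4 * |x| ^ 3`; the constant is not optimized. -/
lemma norm_exp_mul_I_sub_quadratic_le (x : ℝ) :
    ‖Complex.exp (x * Complex.I) - (1 + x * Complex.I - x ^ 2 / 2)‖ ≤ 4 * |x| ^ 3 := by
  have hsum : ∑ m ∈ Finset.range 3, ((x : ℂ) * Complex.I) ^ m / (m.factorial : ℂ) =
      1 + x * Complex.I - x ^ 2 / 2 := by
    simp [Finset.sum_range_succ, Nat.factorial, mul_pow]
    ring
  have hn : ‖(x : ℂ) * Complex.I‖ = |x| := by simp
  rcases le_total |x| 1 with h | h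
  · have := Complex.exp_bound (x := (x : ℂ) * Complex.I) (by rw [hn]; exact h) (n := 3) (by norm_num)
    rw [hsum, hn] at this
    refine this.trans ?_
    rw [mul_comm]
    gcongr
    norm_num [Nat.factorial]
  · have h1 : ‖Complex.exp (x * Complex.I)‖ = 1 := Complex.norm_exp_ofReal_mul_I x
    calc _ ≤ ‖Complex.exp (x * Complex.I)‖ + ‖(1 + x * Complex.I - x ^ 2 / 2 : ℂ)‖ := norm_sub_le _ _
      _ ≤ 1 + (1 + |x| + |x| ^ 2 / 2) := by
          rw [h1]
          gcongr
          refine (norm_sub_le _ _).trans (add_le_add ((norm_add_le _ _).trans ?_) ?_)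
          · simp
          · simp
      _ ≤ 4 * |x| ^ 3 := by
          have h2 : |x| ≤ |x| ^ 2 := by nlinarith
          have h3 : |x| ^ 2 ≤ |x| ^ 3 := by nlinarith [sq_nonneg |x|]
          linarith

lemma abs_exp_neg_sub_one_sub_le {y : ℝ} (hy : 0 ≤ y) : |Real.exp (-y) - (1 - y)| ≤ y ^ 2 := by
  have h0 := Real.add_one_le_exp (-y)
  rw [abs_of_nonneg (by linarith)]
  rcases le_total y 1 with h | h
  · have := Real.abs_exp_sub_one_sub_id_le (x := -y) (by rwa [abs_neg, abs_of_nonneg hy])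
    have := (abs_le.1 this).2
    nlinarith
  · have : Real.exp (-y) ≤ 1 := Real.exp_le_one_iff.2 (by linarith)
    nlinarith

/-- Lindeberg's replacement: the factors are exchanged one at a time while all the others have norm
at most one. -/
lemma norm_prod_sub_prod_le_sum {ι : Type*} (I : Finset ι) (a b : ι → ℂ)
    (ha : ∀ i ∈ I, ‖a i‖ ≤ 1) (hb : ∀ i ∈ I, ‖b i‖ ≤ 1) :
    ‖∏ i ∈ I, a i - ∏ i ∈ I, b i‖ ≤ ∑ i ∈ I, ‖a i - b i‖ := by
  classical
  induction I using Finset.induction_on with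
  | empty => simp
  | insert i I hi ih =>
    rw [Finset.prod_insert hi, Finset.prod_insert hi, Finset.sum_insert hi]
    have h1 : ‖∏ i ∈ I, b i‖ ≤ 1 := by
      rw [norm_prod]
      exact Finset.prod_le_one (fun _ _ => norm_nonneg _)
        fun j hj => hb j (Finset.mem_insert_of_mem hj)
    have h2 := ih (fun j hj => ha j (Finset.mem_insert_of_mem hj))
      (fun j hj => hb j (Finset.mem_insert_of_mem hj))
    have h3 := ha i (Finset.mem_insert_self _ _)
    calc _ = ‖(a i - b i) * ∏ i ∈ I, b i + a i * (∏ i ∈ I, a i - ∏ i ∈ I, b i)‖ := by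
          congr 1; ring
      _ ≤ ‖a i - b i‖ * ‖∏ i ∈ I, b i‖ + ‖a i‖ * ‖∏ i ∈ I, a i - ∏ i ∈ I, b i‖ := by
          refine (norm_add_le _ _).trans ?_
          rw [norm_mul, norm_mul]
      _ ≤ ‖a i - b i‖ * 1 + 1 * ‖∏ i ∈ I, a i - ∏ i ∈ I, b i‖ := by gcongr
      _ ≤ _ := by linarith

variable {S : Type*} [MeasurableSpace S] {Q : Measure S} [IsProbabilityMeasure Q]

/-- Comparison of the characteristic function of a centered variable with the Gaussian one. -/
lemma norm_charFun_sub_exp_le {X : S → ℝ} (hX : MemLp X 4 Q) (hXm : Measurable X)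
    (h0 : ∫ s, X s ∂Q = 0) {δ : ℝ} (hδ : 0 < δ) (t : ℝ) :
    ‖charFun (Q.map X) t - Complex.exp (-(t ^ 2 * ∫ s, X s ^ 2 ∂Q) / 2)‖ ≤
      4 * δ * (t ^ 2 * ∫ s, X s ^ 2 ∂Q) + (4 / δ + 1) * (t ^ 4 * ∫ s, X s ^ 4 ∂Q) := by
  have hX2 : MemLp X 2 Q := hX.mono_exponent (by norm_num)
  have hX1 : Integrable X Q := (hX.mono_exponent (by norm_num)).integrable (le_refl _) 
  have i2 : Integrable (fun s => X s ^ 2) Q := hX2.integrable_sq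
  have i4 : Integrable (fun s => X s ^ 4) Q := by
    have := hX.integrable_norm_pow (by norm_num)
    simpa [Even.pow_abs (show Even 4 by decide)] using this
  set V := ∫ s, X s ^ 2 ∂Q
  set M := ∫ s, X s ^ 4 ∂Q
  have hV : 0 ≤ V := integral_nonneg fun s => sq_nonneg _
  -- Nonnegativity of the variance of `X ^ 2`. This lets the second-order error of the Gaussian
  -- exponential be charged to the fourth moment.
  have hVM : V ^ 2 ≤ M := by
    have h1 : 0 ≤ ∫ s, (X s ^ 2 - V) ^ 2 ∂Q := integral_nonneg fun s => sq_nonneg _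
    have h2 : ∫ s, (X s ^ 2 - V) ^ 2 ∂Q = M - V ^ 2 := by
      have : ∀ s, (X s ^ 2 - V) ^ 2 = X s ^ 4 - 2 * V * X s ^ 2 + V ^ 2 := fun s => by ring
      simp_rw [this]
      have ia : Integrable (fun s => X s ^ 4 - 2 * V * X s ^ 2) Q := i4.sub (i2.const_mul _)
      rw [integral_add ia (integrable_const _), integral_sub i4 (i2.const_mul _),
        integral_const_mul]
      simp
      ring
    linarith
  have iexp : Integrable (fun s => Complex.exp ((t * X s : ℝ) * Complex.I)) Q := by
    refine Integrable.of_bound (by fun_prop) 1 (ae_of_all _ fun s => ?_)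
    rw [Complex.norm_exp_ofReal_mul_I]
  have hcf : charFun (Q.map X) t = ∫ s, Complex.exp ((t * X s : ℝ) * Complex.I) ∂Q := by
    rw [charFun_apply_real, integral_map hXm.aemeasurable (by fun_prop)]
    simp
  have i1c : Integrable (fun s => ((t * X s : ℝ) : ℂ) * Complex.I) Q :=
    ((hX1.const_mul t).ofReal).mul_const _
  have i2c : Integrable (fun s => ((t * X s : ℝ) : ℂ) ^ 2 / 2) Q := by
    have := ((i2.const_mul (t ^ 2 / 2)).ofReal (𝕜 := ℂ))
    refine this.congr (ae_of_all _ fun s => ?_)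
    simp; ring
  have ilin : Integrable (fun s => 1 + ((t * X s : ℝ) : ℂ) * Complex.I) Q :=
    (integrable_const _).add i1c
  have iquad : Integrable (fun s => 1 + ((t * X s : ℝ) : ℂ) * Complex.I -
      ((t * X s : ℝ) : ℂ) ^ 2 / 2) Q := ilin.sub i2c
  have hquad : ∫ s, (1 + ((t * X s : ℝ) : ℂ) * Complex.I - ((t * X s : ℝ) : ℂ) ^ 2 / 2) ∂Q =
      ((1 - t ^ 2 * V / 2 : ℝ) : ℂ) := by
    rw [integral_sub ilin i2c, integral_add (integrable_const _) i1c]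
    have e1 : ∫ s, ((t * X s : ℝ) : ℂ) * Complex.I ∂Q = 0 := by
      rw [integral_mul_const, integral_complex_ofReal, integral_const_mul, h0]; simp
    have e2 : ∫ s, ((t * X s : ℝ) : ℂ) ^ 2 / 2 ∂Q = ((t ^ 2 * V / 2 : ℝ) : ℂ) := by
      have : ∀ s, ((t * X s : ℝ) : ℂ) ^ 2 / 2 = ((t ^ 2 / 2 * X s ^ 2 : ℝ) : ℂ) := fun s => by
        push_cast; ring
      simp_rw [this]
      rw [integral_complex_ofReal, integral_const_mul]
      congr 1; ring
    rw [e1, e2]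
    simp
  have b1 : ‖charFun (Q.map X) t - ((1 - t ^ 2 * V / 2 : ℝ) : ℂ)‖ ≤
      4 * δ * (t ^ 2 * V) + 4 / δ * (t ^ 4 * M) := by
    rw [hcf, ← hquad, ← integral_sub iexp iquad]
    have ib : Integrable (fun s => 4 * δ * (t ^ 2 * X s ^ 2) + 4 / δ * (t ^ 4 * X s ^ 4)) Q :=
      ((i2.const_mul _).const_mul _).add ((i4.const_mul _).const_mul _)
    refine (norm_integral_le_of_norm_le ib (ae_of_all _ fun s => ?_)).trans_eq ?_
    · refine (norm_exp_mul_I_sub_quadratic_le _).trans ?_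
      set y := |t * X s| with hy
      have hy0 : 0 ≤ y := abs_nonneg _
      have e2 : t ^ 2 * X s ^ 2 = y ^ 2 := by rw [hy, sq_abs]; ring
      have e4 : t ^ 4 * X s ^ 4 = y ^ 4 := by
        rw [hy, Even.pow_abs (by decide)]; ring
      rw [e2, e4]
      -- The cubic Taylor error is split so that only second and fourth moments occur. The parameter
      -- `δ` stays free and is sent to zero only after the fourth powers of the coefficients have
      -- vanished.
      have : y ^ 3 ≤ δ * y ^ 2 + y ^ 4 / δ := by
        have h1 : y ≤ δ + y ^ 2 / δ := by
          rw [← sub_le_iff_le_add', le_div_iff₀ hδ]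
          nlinarith [sq_nonneg (y - δ), sq_nonneg y]
        calc y ^ 3 = y ^ 2 * y := by ring
          _ ≤ y ^ 2 * (δ + y ^ 2 / δ) := by gcongr
          _ = _ := by ring
      calc 4 * y ^ 3 ≤ 4 * (δ * y ^ 2 + y ^ 4 / δ) := by gcongr
        _ = _ := by ring
    · rw [integral_add ((i2.const_mul _).const_mul _) ((i4.const_mul _).const_mul _)]
      simp only [integral_const_mul, V, M]
  have b2 : ‖((1 - t ^ 2 * V / 2 : ℝ) : ℂ) - Complex.exp (-(t ^ 2 * V) / 2)‖ ≤ t ^ 4 * M := by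
    have : Complex.exp (-(t ^ 2 * V) / 2) = ((Real.exp (-(t ^ 2 * V / 2)) : ℝ) : ℂ) := by
      push_cast; congr 1; ring
    rw [this, ← Complex.ofReal_sub, Complex.norm_real, Real.norm_eq_abs, abs_sub_comm]
    refine (abs_exp_neg_sub_one_sub_le (by positivity)).trans ?_
    calc (t ^ 2 * V / 2) ^ 2 = t ^ 4 * V ^ 2 / 4 := by ring
      _ ≤ t ^ 4 * M / 4 := by gcongr
      _ ≤ t ^ 4 * M := by
        have : 0 ≤ t ^ 4 * M := mul_nonneg (by positivity) ((sq_nonneg V).trans hVM)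
        linarith
  calc _ ≤ _ := norm_sub_le_norm_sub_add_norm_sub _ ((1 - t ^ 2 * V / 2 : ℝ) : ℂ) _
    _ ≤ _ := add_le_add b1 b2
    _ = _ := by ring

/-- **Lyapunov's central limit theorem** for weighted sums of independent variables with unit
variance and bounded fourth moment, in terms of characteristic functions. -/
lemma tendsto_charFun_weighted_sum {ι : Type*} {v : ℕ → ι → S → ℝ} {C : ℝ}
    (hm : ∀ n i, Measurable (v n i)) (hind : ∀ n, iIndepFun (v n) Q)
    (h0 : ∀ n i, ∫ s, v n i s ∂Q = 0) (h2 : ∀ n i, ∫ s, v n i s ^ 2 ∂Q = 1)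
    (hL : ∀ n i, MemLp (v n i) 4 Q) (h4 : ∀ n i, ∫ s, v n i s ^ 4 ∂Q ≤ C)
    (I : ℕ → Finset ι) (c : ℕ → ι → ℝ)
    (hc2 : Tendsto (fun n => ∑ i ∈ I n, c n i ^ 2) atTop (𝓝 1))
    (hc4 : Tendsto (fun n => ∑ i ∈ I n, c n i ^ 4) atTop (𝓝 0)) (t : ℝ) :
    Tendsto (fun n => charFun (Q.map fun s => ∑ i ∈ I n, c n i * v n i s) t) atTop
      (𝓝 (charFun (gaussianReal 0 1) t)) := by
  have hprod : ∀ n, charFun (Q.map fun s => ∑ i ∈ I n, c n i * v n i s) t =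
      ∏ i ∈ I n, charFun (Q.map (v n i)) (c n i * t) := by
    intro n
    have hi : iIndepFun (fun i s => c n i * v n i s) Q :=
      (hind n).comp (fun i x => c n i * x) fun i => by fun_prop
    rw [iIndepFun.charFun_map_fun_finsetSum_eq_prod (s := I n) (X := fun i s => c n i * v n i s)
      (fun i _ => by have := hm n i; fun_prop) (hi.restrict _), Finset.prod_apply]
    refine Finset.prod_congr rfl fun i _ => ?_
    rw [charFun_map_mul_comp (hm n i).aemeasurable]
  have hbound : ∀ δ > 0, ∀ n, ‖charFun (Q.map fun s => ∑ i ∈ I n, c n i * v n i s) t -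
      Complex.exp (-(t ^ 2 * ((∑ i ∈ I n, c n i ^ 2 : ℝ) : ℂ)) / 2)‖ ≤
      4 * δ * (t ^ 2 * ∑ i ∈ I n, c n i ^ 2) +
        (4 / δ + 1) * (t ^ 4 * C * ∑ i ∈ I n, c n i ^ 4) := by
    intro δ hδ n
    have hexp : Complex.exp (-(t ^ 2 * ((∑ i ∈ I n, c n i ^ 2 : ℝ) : ℂ)) / 2) =
        ∏ i ∈ I n, Complex.exp (-(((c n i * t : ℝ) : ℂ) ^ 2 * (1 : ℝ)) / 2) := by
      rw [← Complex.exp_sum]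
      congr 1
      push_cast
      rw [Finset.mul_sum, ← Finset.sum_neg_distrib, Finset.sum_div]
      exact Finset.sum_congr rfl fun i _ => by ring
    rw [hprod, hexp]
    refine (norm_prod_sub_prod_le_sum _ _ _ (fun i _ => ?_) (fun i _ => ?_)).trans ?_
    · have := Measure.isProbabilityMeasure_map (μ := Q) (hm n i).aemeasurable
      exact norm_charFun_le_one _
    · rw [show -(((c n i * t : ℝ) : ℂ) ^ 2 * (1 : ℝ)) / 2 = ((-((c n i * t) ^ 2) / 2 : ℝ) : ℂ) by
        push_cast; ring, Complex.norm_exp_ofReal, Real.exp_le_one_iff]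
      have := sq_nonneg (c n i * t)
      linarith
    · rw [Finset.mul_sum, Finset.mul_sum, Finset.mul_sum, Finset.mul_sum, ← Finset.sum_add_distrib]
      refine Finset.sum_le_sum fun i _ => ?_
      have := norm_charFun_sub_exp_le (hL n i) (hm n i) (h0 n i) hδ (c n i * t)
      rw [h2 n i] at this
      refine this.trans ?_
      have h5 : (c n i * t) ^ 4 * ∫ s, v n i s ^ 4 ∂Q ≤ (c n i * t) ^ 4 * C := by
        have := h4 n i
        have h6 : 0 ≤ (c n i * t) ^ 4 := by positivity
        gcongr
      calc _ ≤ 4 * δ * ((c n i * t) ^ 2 * 1) + (4 / δ + 1) * ((c n i * t) ^ 4 * C) := by gcongr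
        _ = _ := by ring
  have hlim : Tendsto (fun n => charFun (Q.map fun s => ∑ i ∈ I n, c n i * v n i s) t -
      Complex.exp (-(t ^ 2 * ((∑ i ∈ I n, c n i ^ 2 : ℝ) : ℂ)) / 2)) atTop (𝓝 0) := by
    rw [tendsto_zero_iff_norm_tendsto_zero, Metric.tendsto_nhds]
    intro ε hε
    obtain ⟨δ, hδ, hδε⟩ : ∃ δ > 0, 4 * δ * (t ^ 2 * 1) < ε := by
      refine ⟨ε / (4 * (t ^ 2 + 1)), by positivity, ?_⟩
      rw [show 4 * (ε / (4 * (t ^ 2 + 1))) * (t ^ 2 * 1) = ε * (t ^ 2 / (t ^ 2 + 1)) by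
        field_simp]
      have : t ^ 2 / (t ^ 2 + 1) < 1 := by rw [div_lt_one (by positivity)]; linarith
      nlinarith
    have hl : Tendsto (fun n => 4 * δ * (t ^ 2 * ∑ i ∈ I n, c n i ^ 2) +
        (4 / δ + 1) * (t ^ 4 * C * ∑ i ∈ I n, c n i ^ 4)) atTop
        (𝓝 (4 * δ * (t ^ 2 * 1) + (4 / δ + 1) * (t ^ 4 * C * 0))) :=
      ((hc2.const_mul _).const_mul _).add ((hc4.const_mul _).const_mul _)
    filter_upwards [hl.eventually (gt_mem_nhds (show _ < ε by simpa using hδε))] with n hn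
    rw [Real.dist_eq, sub_zero, abs_of_nonneg (norm_nonneg _)]
    exact (hbound δ hδ n).trans_lt hn
  have hexp : Tendsto (fun n => Complex.exp (-(t ^ 2 * ((∑ i ∈ I n, c n i ^ 2 : ℝ) : ℂ)) / 2))
      atTop (𝓝 (charFun (gaussianReal 0 1) t)) := by
    have h1 : charFun (gaussianReal 0 1) t = Complex.exp (-(t ^ 2 * ((1 : ℝ) : ℂ)) / 2) := by
      rw [charFun_gaussianReal]
      congr 1
      simp
      ring
    rw [h1]
    have hcont : Continuous fun y : ℝ => Complex.exp (-(t ^ 2 * (y : ℂ)) / 2) := by fun_prop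
    exact (hcont.tendsto 1).comp hc2
  simpa using hlim.add hexp

end SHARWB

/-! ### Trigonometric regressors on the grid and Bessel's inequality -/

namespace SHARWB

/-- The average of `f t * g t` over the sample `t = 1, …, T`. -/
noncomputable def gridInner (T : ℕ) (f g : ℕ → ℝ) : ℝ :=
  (∑ t ∈ Finset.Icc 1 T, f t * g t) / T

/-- The trigonometric regressors: `cos (2πkt/T)` for `r = 0` and `sin (2πkt/T)` for `r = 1`. -/
noncomputable def trig (T : ℕ) (r : Fin 2) (k t : ℕ) : ℝ :=
  if r = 0 then Real.cos (2 * Real.pi * k * ((t : ℝ) / T))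
  else Real.sin (2 * Real.pi * k * ((t : ℝ) / T))

lemma gridInner_comm (T : ℕ) (f g : ℕ → ℝ) : gridInner T f g = gridInner T g f := by
  simp only [gridInner, mul_comm]

lemma gridInner_self_nonneg (T : ℕ) (f : ℕ → ℝ) : 0 ≤ gridInner T f f :=
  div_nonneg (Finset.sum_nonneg fun _ _ => mul_self_nonneg _) (Nat.cast_nonneg _)

lemma abs_gridInner_le {T : ℕ} {f g : ℕ → ℝ} {A B : ℝ} (hA : 0 ≤ A) (hB : 0 ≤ B)
    (hf : ∀ t, |f t| ≤ A) (hg : ∀ t, |g t| ≤ B) : |gridInner T f g| ≤ A * B := by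
  rcases Nat.eq_zero_or_pos T with rfl | hT
  · simpa [gridInner] using mul_nonneg hA hB
  have hT' : (0 : ℝ) < T := Nat.cast_pos.2 hT
  rw [gridInner, abs_div, abs_of_pos hT', div_le_iff₀ hT']
  refine (Finset.abs_sum_le_sum_abs _ _).trans ((Finset.sum_le_sum
    (g := fun _ => A * B) fun t _ => ?_).trans_eq ?_)
  · rw [abs_mul]
    exact mul_le_mul (hf t) (hg t) (abs_nonneg _) hA
  · simp [mul_comm]

/-- A geometric sum with ratio a nontrivial `T`-th root of unity. -/
lemma sum_cexp_grid {T m : ℕ} (hm : 0 < m) (hmT : m < T) :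
    ∑ t ∈ Finset.Icc 1 T, Complex.exp ((2 * Real.pi * m * ((t : ℝ) / T) : ℝ) * Complex.I) = 0 := by
  have hT : T ≠ 0 := by omega
  have hprim := Complex.isPrimitiveRoot_exp T hT
  set ζ := Complex.exp (2 * Real.pi * Complex.I / T) with hζ
  have h1 : ζ ^ m ≠ 1 := hprim.pow_ne_one_of_pos_of_lt hm.ne' hmT
  have h2 : ∀ t : ℕ, Complex.exp ((2 * Real.pi * m * ((t : ℝ) / T) : ℝ) * Complex.I) =
      (ζ ^ m) ^ t := by
    intro t
    rw [← pow_mul, hζ, ← Complex.exp_nat_mul]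
    congr 1
    push_cast
    ring
  simp_rw [h2]
  rw [← Finset.Ico_succ_right_eq_Icc, Finset.sum_Ico_eq_sum_range]
  simp only [Order.succ_eq_add_one, Nat.add_sub_cancel, pow_add, pow_one, ← Finset.mul_sum]
  have h3 : (ζ ^ m - 1) * ∑ t ∈ Finset.range T, (ζ ^ m) ^ t = 0 := by
    rw [mul_geom_sum, ← pow_mul, mul_comm m T, pow_mul, hprim.pow_eq_one, one_pow, sub_self]
  rw [(mul_eq_zero.1 h3).resolve_left (sub_ne_zero.2 h1), mul_zero]

lemma sum_cos_grid_nat {T m : ℕ} (hm : 0 < m) (hmT : m < T) :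
    ∑ t ∈ Finset.Icc 1 T, Real.cos (2 * Real.pi * m * ((t : ℝ) / T)) = 0 := by
  have h := congrArg Complex.re (sum_cexp_grid hm hmT)
  simpa only [Complex.re_sum, Complex.exp_ofReal_mul_I_re, Complex.zero_re] using h

lemma sum_sin_grid_nat {T m : ℕ} (hm : 0 < m) (hmT : m < T) :
    ∑ t ∈ Finset.Icc 1 T, Real.sin (2 * Real.pi * m * ((t : ℝ) / T)) = 0 := by
  have h := congrArg Complex.im (sum_cexp_grid hm hmT)
  simpa only [Complex.im_sum, Complex.exp_ofReal_mul_I_im, Complex.zero_im] using h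

lemma sum_trig {T m : ℕ} (r : Fin 2) (hm : 0 < m) (hmT : m < T) :
    ∑ t ∈ Finset.Icc 1 T, trig T r m t = 0 := by
  unfold trig
  split_ifs
  · exact sum_cos_grid_nat hm hmT
  · exact sum_sin_grid_nat hm hmT

/-- Integer frequencies are needed because the product formulas produce the difference of two
frequencies, which may be negative. -/
lemma sum_cos_grid {T : ℕ} {m : ℤ} (hm : m ≠ 0) (hmT : |m| < T) :
    ∑ t ∈ Finset.Icc 1 T, Real.cos (2 * Real.pi * m * ((t : ℝ) / T)) = 0 := by
  rcases lt_or_gt_of_ne hm with h | h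
  · lift -m to ℕ using by omega with k hk
    have : m = -(k : ℤ) := by omega
    subst this
    rw [← sum_cos_grid_nat (T := T) (m := k) (by omega) (by rw [abs_neg, abs_of_nonneg] at hmT <;> omega)]
    refine Finset.sum_congr rfl fun t _ => ?_
    rw [← Real.cos_neg]
    congr 1
    push_cast
    ring
  · lift m to ℕ using h.le
    exact sum_cos_grid_nat (by omega) (by rw [abs_of_nonneg] at hmT <;> omega)

lemma sum_sin_grid {T : ℕ} {m : ℤ} (hmT : |m| < T) :
    ∑ t ∈ Finset.Icc 1 T, Real.sin (2 * Real.pi * m * ((t : ℝ) / T)) = 0 := by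
  rcases lt_trichotomy m 0 with h | rfl | h
  · lift -m to ℕ using by omega with k hk
    have : m = -(k : ℤ) := by omega
    subst this
    rw [← neg_eq_zero, ← Finset.sum_neg_distrib,
      ← sum_sin_grid_nat (T := T) (m := k) (by omega) (by rw [abs_neg, abs_of_nonneg] at hmT <;> omega)]
    refine Finset.sum_congr rfl fun t _ => ?_
    rw [← Real.sin_neg]
    congr 1
    push_cast
    ring
  · simp
  · lift m to ℕ using h.le
    exact sum_sin_grid_nat (by omega) (by rw [abs_of_nonneg] at hmT <;> omega)

/-- Orthogonality of the trigonometric regressors on the grid. -/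
lemma gridInner_trig {T k k' : ℕ} (r r' : Fin 2) (hk : 0 < k) (hk' : 0 < k') (h : k + k' < T) :
    gridInner T (trig T r k) (trig T r' k') = if r = r' ∧ k = k' then 1 / 2 else 0 := by
  have hT : (T : ℝ) ≠ 0 := by
    rw [Nat.cast_ne_zero]; omega
  -- There is no aliasing: as `k + k' < T`, the sum and the difference of the frequencies are
  -- multiples of `T` only when they are zero, which happens only for the difference at `k = k'`.
  have hplus : |((k + k' : ℕ) : ℤ)| < T := by rw [abs_of_nonneg] <;> omega
  have hminus : |(k : ℤ) - k'| < T := by rw [abs_lt]; omega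
  have hcp := sum_cos_grid (T := T) (m := ((k + k' : ℕ) : ℤ)) (by omega) hplus
  have hsp := sum_sin_grid (T := T) hplus
  have hsm := sum_sin_grid (T := T) hminus
  have hcm : ∑ t ∈ Finset.Icc 1 T, Real.cos (2 * Real.pi * ((k : ℤ) - k' : ℤ) * ((t : ℝ) / T)) =
      if k = k' then (T : ℝ) else 0 := by
    split_ifs with hkk
    · subst hkk; simp
    · exact sum_cos_grid (by omega) hminus
  push_cast at hcp hsp hsm hcm
  have e : ∀ (t : ℕ) (x y : ℝ), x = 2 * Real.pi * k * ((t : ℝ) / T) →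
      y = 2 * Real.pi * k' * ((t : ℝ) / T) →
      2 * Real.pi * ((k : ℝ) + k') * ((t : ℝ) / T) = x + y ∧
      2 * Real.pi * ((k : ℝ) - k') * ((t : ℝ) / T) = x - y := by
    rintro t x y rfl rfl; constructor <;> ring
  have key : ∑ t ∈ Finset.Icc 1 T, trig T r k t * trig T r' k' t =
      if r = r' ∧ k = k' then (T : ℝ) / 2 else 0 := by
    have cc : ∑ t ∈ Finset.Icc 1 T, Real.cos (2 * Real.pi * k * ((t : ℝ) / T)) *
        Real.cos (2 * Real.pi * k' * ((t : ℝ) / T)) = if k = k' then (T : ℝ) / 2 else 0 := by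
      rw [show (if k = k' then (T : ℝ) / 2 else 0) = ((if k = k' then (T : ℝ) else 0) + 0) / 2 by
        split_ifs <;> simp, ← hcm, ← hcp, ← Finset.sum_add_distrib, Finset.sum_div]
      refine Finset.sum_congr rfl fun t _ => ?_
      rw [(e t _ _ rfl rfl).1, (e t _ _ rfl rfl).2, Real.cos_add, Real.cos_sub]
      ring
    have ss : ∑ t ∈ Finset.Icc 1 T, Real.sin (2 * Real.pi * k * ((t : ℝ) / T)) *
        Real.sin (2 * Real.pi * k' * ((t : ℝ) / T)) = if k = k' then (T : ℝ) / 2 else 0 := by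
      rw [show (if k = k' then (T : ℝ) / 2 else 0) = ((if k = k' then (T : ℝ) else 0) - 0) / 2 by
        split_ifs <;> simp, ← hcm, ← hcp, ← Finset.sum_sub_distrib, Finset.sum_div]
      refine Finset.sum_congr rfl fun t _ => ?_
      rw [(e t _ _ rfl rfl).1, (e t _ _ rfl rfl).2, Real.cos_add, Real.cos_sub]
      ring
    have cs : ∑ t ∈ Finset.Icc 1 T, Real.cos (2 * Real.pi * k * ((t : ℝ) / T)) *
        Real.sin (2 * Real.pi * k' * ((t : ℝ) / T)) = 0 := by
      rw [show (0 : ℝ) = (0 - 0) / 2 by simp]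
      nth_rewrite 2 [← hsm]
      rw [← hsp, ← Finset.sum_sub_distrib, Finset.sum_div]
      refine Finset.sum_congr rfl fun t _ => ?_
      rw [(e t _ _ rfl rfl).1, (e t _ _ rfl rfl).2, Real.sin_add, Real.sin_sub]
      ring
    have sc : ∑ t ∈ Finset.Icc 1 T, Real.sin (2 * Real.pi * k * ((t : ℝ) / T)) *
        Real.cos (2 * Real.pi * k' * ((t : ℝ) / T)) = 0 := by
      rw [show (0 : ℝ) = (0 + 0) / 2 by simp]
      nth_rewrite 2 [← hsp]
      rw [← hsm, ← Finset.sum_add_distrib, Finset.sum_div]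
      refine Finset.sum_congr rfl fun t _ => ?_
      rw [(e t _ _ rfl rfl).1, (e t _ _ rfl rfl).2, Real.sin_add, Real.sin_sub]
      ring
    unfold trig
    fin_cases r <;> fin_cases r' <;> simp [cc, ss, cs, sc]
  rw [gridInner, key]
  split_ifs
  · field_simp
  · simp

/-- Bessel's inequality for a family that is orthogonal on the grid with squared norms `1/2`. -/
lemma sum_gridInner_sq_le {ι : Type*} [DecidableEq ι] {T : ℕ} (I : Finset ι) (e : ι → ℕ → ℝ)
    (he : ∀ i ∈ I, ∀ j ∈ I, gridInner T (e i) (e j) = if i = j then 1 / 2 else 0) (g : ℕ → ℝ) :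
    ∑ i ∈ I, gridInner T g (e i) ^ 2 ≤ gridInner T g g / 2 := by
  set b : ι → ℝ := fun i => gridInner T g (e i) with hb
  have hlin : ∀ f : ℕ → ℝ, gridInner T f (fun t => ∑ i ∈ I, 2 * b i * e i t) =
      ∑ i ∈ I, 2 * b i * gridInner T f (e i) := by
    intro f
    simp only [gridInner, Finset.mul_sum, Finset.sum_div, mul_div_assoc']
    rw [Finset.sum_comm]
    refine Finset.sum_congr rfl fun i _ => Finset.sum_congr rfl fun t _ => by ring
  have h1 : gridInner T g (fun t => ∑ i ∈ I, 2 * b i * e i t) = 2 * ∑ i ∈ I, b i ^ 2 := by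
    rw [hlin, Finset.mul_sum]
    exact Finset.sum_congr rfl fun i _ => by rw [← show b i = gridInner T g (e i) from rfl]; ring
  have h2 : gridInner T (fun t => ∑ i ∈ I, 2 * b i * e i t)
      (fun t => ∑ i ∈ I, 2 * b i * e i t) = 2 * ∑ i ∈ I, b i ^ 2 := by
    rw [hlin, Finset.mul_sum]
    refine Finset.sum_congr rfl fun i hi => ?_
    rw [gridInner_comm, hlin, Finset.sum_congr rfl fun j hj => by rw [he i hi j hj]]
    simp [hi]
    ring
  -- The squared distance from `g` to its projection. The coefficients are `2 * b i` because the
  -- family has squared norms `1 / 2`.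
  have h3 := gridInner_self_nonneg T fun t => g t - ∑ i ∈ I, 2 * b i * e i t
  have h4 : gridInner T (fun t => g t - ∑ i ∈ I, 2 * b i * e i t)
      (fun t => g t - ∑ i ∈ I, 2 * b i * e i t) = gridInner T g g -
      2 * gridInner T g (fun t => ∑ i ∈ I, 2 * b i * e i t) +
      gridInner T (fun t => ∑ i ∈ I, 2 * b i * e i t) (fun t => ∑ i ∈ I, 2 * b i * e i t) := by
    simp only [gridInner, mul_div_assoc', ← sub_div, ← add_div]
    congr 1
    rw [Finset.mul_sum, ← Finset.sum_sub_distrib, ← Finset.sum_add_distrib]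
    exact Finset.sum_congr rfl fun t _ => by ring
  rw [h4, h1, h2] at h3
  linarith

lemma trig_sq_add_sq (T k t : ℕ) : trig T 0 k t ^ 2 + trig T 1 k t ^ 2 = 1 := by
  simp [trig]

lemma abs_trig_le (T : ℕ) (r : Fin 2) (k t : ℕ) : |trig T r k t| ≤ 1 := by
  unfold trig
  split_ifs
  · exact Real.abs_cos_le_one _
  · exact Real.abs_sin_le_one _

/-- Cosine and sine are 1-Lipschitz, and `7` rounds up `2π`. -/
lemma abs_trig_sub_le (T : ℕ) (r : Fin 2) (k s t : ℕ) :
    |trig T r k s - trig T r k t| ≤ 7 * k / T * |(s : ℝ) - t| := by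
  have h1 : |2 * Real.pi * k * ((s : ℝ) / T) - 2 * Real.pi * k * ((t : ℝ) / T)| ≤
      7 * k / T * |(s : ℝ) - t| := by
    rw [show 2 * Real.pi * k * ((s : ℝ) / T) - 2 * Real.pi * k * ((t : ℝ) / T) =
      (2 * Real.pi) * k / T * (s - t) by ring, abs_mul, abs_of_nonneg (by positivity)]
    have := Real.pi_lt_d2
    gcongr
    linarith
  refine le_trans ?_ h1
  unfold trig
  split_ifs
  · exact Real.abs_cos_sub_cos_le _ _
  · exact Real.abs_sin_sub_sin_le _ _

end SHARWB

/-! ### Fourth moments and quadratic forms in independent draws -/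

namespace SHARWB

section FourthMoments

variable {Ω : Type*} [MeasurableSpace Ω] {P : Measure Ω}

lemma integrable_mul_of_memLp_four [IsFiniteMeasure P] {a b : Ω → ℝ} (ha : MemLp a 4 P)
    (hb : MemLp b 4 P) : Integrable (fun ω => a ω * b ω) P :=
  (ha.mono_exponent (by norm_num : (2 : ℝ≥0∞) ≤ 4)).integrable_mul
    (hb.mono_exponent (by norm_num : (2 : ℝ≥0∞) ≤ 4))

lemma memLp_two_mul {a b : Ω → ℝ} (ha : MemLp a 4 P) (hb : MemLp b 4 P) :
    MemLp (fun ω => a ω * b ω) 2 P := by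
  have : ENNReal.HolderTriple 4 4 2 := ⟨by
    rw [← two_mul, show (4 : ℝ≥0∞) = 2 * 2 by norm_num, ENNReal.mul_inv (by simp) (by simp),
      ← mul_assoc, ENNReal.mul_inv_cancel (by simp) (by simp), one_mul]⟩
  exact hb.mul ha

lemma integrable_mul_four {a b c d : Ω → ℝ} (ha : MemLp a 4 P) (hb : MemLp b 4 P)
    (hc : MemLp c 4 P) (hd : MemLp d 4 P) :
    Integrable (fun ω => a ω * b ω * c ω * d ω) P := by
  have := (memLp_two_mul ha hb).integrable_mul (memLp_two_mul hc hd)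
  refine this.congr (ae_of_all _ fun ω => ?_)
  simp only [Pi.mul_apply]
  ring

/-- Mean squared error of a quadratic form with Gaussian-like fourth moments. -/
lemma integral_sum_sq_sub_sq_le [IsProbabilityMeasure P] {ι : Type*} {A : Finset ι}
    {Z : ι → Ω → ℝ} {c : ι → ι → ℝ} {ρ : ℝ} (hZ : ∀ a ∈ A, MemLp (Z a) 4 P)
    (h2 : ∀ a ∈ A, ∀ b ∈ A, ∫ ω, Z a ω * Z b ω ∂P = c a b)
    (h4 : ∀ a ∈ A, ∀ b ∈ A, ∫ ω, Z a ω * Z a ω * Z b ω * Z b ω ∂P ≤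
      c a a * c b b + 2 * c a b ^ 2 + ρ) (w L : ℝ) :
    ∫ ω, (w * ∑ a ∈ A, Z a ω ^ 2 - L) ^ 2 ∂P ≤
      (w * ∑ a ∈ A, c a a - L) ^ 2 + w ^ 2 * ∑ a ∈ A, ∑ b ∈ A, (2 * c a b ^ 2 + ρ) := by
  have i2 : ∀ a ∈ A, Integrable (fun ω => Z a ω * Z a ω) P := fun a ha =>
    integrable_mul_of_memLp_four (hZ a ha) (hZ a ha)
  have i4 : ∀ a ∈ A, ∀ b ∈ A, Integrable (fun ω => Z a ω * Z a ω * Z b ω * Z b ω) P :=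
    fun a ha b hb => integrable_mul_four (hZ a ha) (hZ a ha) (hZ b hb) (hZ b hb)
  have I4 : Integrable (fun ω => ∑ a ∈ A, ∑ b ∈ A, Z a ω * Z a ω * Z b ω * Z b ω) P :=
    integrable_finsetSum _ fun a ha => integrable_finsetSum _ fun b hb => i4 a ha b hb
  have I2 : Integrable (fun ω => ∑ a ∈ A, Z a ω * Z a ω) P := integrable_finsetSum _ i2
  have e : ∀ ω, (w * ∑ a ∈ A, Z a ω ^ 2 - L) ^ 2 =
      (w ^ 2 * ∑ a ∈ A, ∑ b ∈ A, Z a ω * Z a ω * Z b ω * Z b ω +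
        (-2 * L * w) * ∑ a ∈ A, Z a ω * Z a ω) + L ^ 2 := by
    intro ω
    have h1 : ∑ a ∈ A, ∑ b ∈ A, Z a ω * Z a ω * Z b ω * Z b ω = (∑ a ∈ A, Z a ω ^ 2) ^ 2 := by
      rw [sq (∑ a ∈ A, Z a ω ^ 2), Finset.sum_mul_sum]
      exact Finset.sum_congr rfl fun _ _ => Finset.sum_congr rfl fun _ _ => by ring
    have h3 : ∑ a ∈ A, Z a ω * Z a ω = ∑ a ∈ A, Z a ω ^ 2 :=
      Finset.sum_congr rfl fun _ _ => by ring
    rw [h1, h3]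
    ring
  have I42 : Integrable (fun ω => w ^ 2 * ∑ a ∈ A, ∑ b ∈ A, Z a ω * Z a ω * Z b ω * Z b ω +
        (-2 * L * w) * ∑ a ∈ A, Z a ω * Z a ω) P := (I4.const_mul _).add (I2.const_mul _)
  simp_rw [e]
  rw [integral_add I42 (integrable_const _), integral_add (I4.const_mul _) (I2.const_mul _),
    integral_const_mul, integral_const_mul, integral_finsetSum _ i2,
    integral_finsetSum _ fun a ha => integrable_finsetSum _ fun b hb => i4 a ha b hb]
  -- The products `c a a * c b b` sum to the square of the mean. Together with the cross term and `L
  -- ^ 2` they form the squared bias, and the rest bounds the variance.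
  have e4 : ∑ a ∈ A, ∫ ω, ∑ b ∈ A, Z a ω * Z a ω * Z b ω * Z b ω ∂P ≤
      (∑ a ∈ A, c a a) ^ 2 + ∑ a ∈ A, ∑ b ∈ A, (2 * c a b ^ 2 + ρ) := by
    rw [sq, Finset.sum_mul_sum, ← Finset.sum_add_distrib]
    refine Finset.sum_le_sum fun a ha => ?_
    rw [integral_finsetSum _ fun b hb => i4 a ha b hb, ← Finset.sum_add_distrib]
    refine Finset.sum_le_sum fun b hb => ?_
    linarith [h4 a ha b hb]
  rw [Finset.sum_congr rfl fun a ha => h2 a ha a ha]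
  have := mul_le_mul_of_nonneg_left e4 (sq_nonneg w)
  simp only [integral_const, probReal_univ, smul_eq_mul, one_mul]
  nlinarith

/-- Second moment of an entry of a Gram matrix, in terms of fourth moments. -/
lemma integral_sum_mul_sq_le [IsProbabilityMeasure P] {ι : Type*} {B : Finset ι}
    {X Y : ι → Ω → ℝ} {q : ι → ι → ℝ} (hX : ∀ a ∈ B, MemLp (X a) 4 P)
    (hY : ∀ a ∈ B, MemLp (Y a) 4 P)
    (h4 : ∀ a ∈ B, ∀ b ∈ B, ∫ ω, X a ω * Y a ω * X b ω * Y b ω ∂P ≤ q a b) :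
    ∫ ω, (∑ a ∈ B, X a ω * Y a ω) ^ 2 ∂P ≤ ∑ a ∈ B, ∑ b ∈ B, q a b := by
  have i4 : ∀ a ∈ B, ∀ b ∈ B, Integrable (fun ω => X a ω * Y a ω * X b ω * Y b ω) P :=
    fun a ha b hb => integrable_mul_four (hX a ha) (hY a ha) (hX b hb) (hY b hb)
  have e : ∀ ω, (∑ a ∈ B, X a ω * Y a ω) ^ 2 =
      ∑ a ∈ B, ∑ b ∈ B, X a ω * Y a ω * X b ω * Y b ω := by
    intro ω
    rw [sq, Finset.sum_mul_sum]
    exact Finset.sum_congr rfl fun _ _ => Finset.sum_congr rfl fun _ _ => by ring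
  simp_rw [e]
  rw [integral_finsetSum _ fun a ha => integrable_finsetSum _ fun b hb => i4 a ha b hb]
  refine Finset.sum_le_sum fun a ha => ?_
  rw [integral_finsetSum _ fun b hb => i4 a ha b hb]
  exact Finset.sum_le_sum fun b hb => h4 a ha b hb

end FourthMoments

section IndependentDraws

variable {S : Type*} [MeasurableSpace S] {Q : Measure S}
  {ι : Type*} [DecidableEq ι] {v : ι → S → ℝ}

/-- The centered factor at `a` is independent of the product of the others. The indices `b`, `c`,
`d` may coincide, so independence is used between the blocks `{a}` and `{b, c, d}`. -/
lemma integral_mul_three_eq_zero (hm : ∀ i, Measurable (v i)) (hind : iIndepFun v Q)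
    (h0 : ∀ i, ∫ s, v i s ∂Q = 0) {a b c d : ι} (hb : a ≠ b) (hc : a ≠ c) (hd : a ≠ d) :
    ∫ s, v a s * v b s * v c s * v d s ∂Q = 0 := by
  have hdisj : Disjoint ({a} : Finset ι) {b, c, d} := by simp [hb, hc, hd]
  have hφ : Measurable fun f : ({a} : Finset ι) → ℝ => f ⟨a, by simp⟩ := measurable_pi_apply _
  have hpi : ∀ i, Measurable fun f : ({b, c, d} : Finset ι) → ℝ => f i := measurable_pi_apply
  have hψ : Measurable fun f : ({b, c, d} : Finset ι) → ℝ =>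
      f ⟨b, by simp⟩ * f ⟨c, by simp⟩ * f ⟨d, by simp⟩ := ((hpi _).mul (hpi _)).mul (hpi _)
  have h := (hind.indepFun_finset {a} {b, c, d} hdisj hm).comp hφ hψ
  have h1 := h.integral_fun_mul_eq_mul_integral (by have := hm a; fun_prop)
    (by have := hm b; have := hm c; have := hm d; fun_prop)
  simp only [Function.comp_def, h0, zero_mul] at h1
  rw [← h1]
  exact integral_congr_ae (ae_of_all _ fun s => by simp only; ring)

/-- The mixed fourth moments of independent centered variables with unit variance. -/
lemma integral_mul_four_of_iIndepFun [IsProbabilityMeasure Q] (hm : ∀ i, Measurable (v i)) (hind : iIndepFun v Q)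
    (h0 : ∀ i, ∫ s, v i s ∂Q = 0) (h2 : ∀ i, ∫ s, v i s ^ 2 ∂Q = 1) (a b c d : ι) :
    ∫ s, v a s * v b s * v c s * v d s ∂Q =
      (if a = b then if c = d then 1 else 0 else 0) +
      (if a = c then if b = d then 1 else 0 else 0) +
      (if a = d then if b = c then 1 else 0 else 0) +
      (if a = b then if a = c then if a = d then ∫ s, v a s ^ 4 ∂Q - 3 else 0 else 0 else 0) := by
  have hpair : ∀ i j, i ≠ j → ∫ s, v i s * v i s * v j s * v j s ∂Q = 1 := by
    intro i j hij
    have h := (hind.indepFun hij).comp (φ := fun x => x ^ 2) (ψ := fun x => x ^ 2)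
      (by fun_prop) (by fun_prop)
    have h1 := h.integral_fun_mul_eq_mul_integral (by have := hm i; fun_prop)
      (by have := hm j; fun_prop)
    simp only [Function.comp_def, h2, mul_one] at h1
    rw [← h1]
    exact integral_congr_ae (ae_of_all _ fun s => by simp only; ring)
  have hz := fun i j k l (hj : i ≠ j) (hk : i ≠ k) (hl : i ≠ l) =>
    integral_mul_three_eq_zero (a := i) (b := j) (c := k) (d := l) hm hind h0 hj hk hl
  -- Either the four indices match in pairs or one of them occurs exactly once. When all four
  -- coincide the three pairings all count, which is what the `- 3` in the last term corrects.
  by_cases hab : a = b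
  · subst hab
    by_cases hcd : c = d
    · subst hcd
      by_cases hac : a = c
      · subst hac
        simp only [if_true]
        rw [show (1 : ℝ) + 1 + 1 + (∫ s, v a s ^ 4 ∂Q - 3) = ∫ s, v a s ^ 4 ∂Q by ring]
        exact integral_congr_ae (ae_of_all _ fun s => by simp only; ring)
      · simp [hac, hpair a c hac]
    · by_cases had : a = d
      · subst had
        have := hz c a a a hcd hcd hcd
        simp only [Ne.symm hcd, hcd, if_true, if_false]
        rw [← integral_congr_ae (ae_of_all _ fun s => show v c s * v a s * v a s * v a s =
          v a s * v a s * v c s * v a s by ring), this]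
        simp
      · have := hz d a a c (Ne.symm had) (Ne.symm had) (Ne.symm hcd)
        rw [← integral_congr_ae (ae_of_all _ fun s => show v d s * v a s * v a s * v c s =
          v a s * v a s * v c s * v d s by ring), this]
        simp [hcd, had]
  · by_cases hac : a = c
    · subst hac
      by_cases hbd : b = d
      · subst hbd
        rw [← integral_congr_ae (ae_of_all _ fun s => show v a s * v a s * v b s * v b s =
          v a s * v b s * v a s * v b s by ring), hpair a b hab]
        simp [hab]
      · have := hz b a a d (Ne.symm hab) (Ne.symm hab) hbd
        rw [← integral_congr_ae (ae_of_all _ fun s => show v b s * v a s * v a s * v d s =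
          v a s * v b s * v a s * v d s by ring), this]
        simp [hab, hbd, Ne.symm hab]
    · by_cases had : a = d
      · subst had
        by_cases hbc : b = c
        · subst hbc
          rw [← integral_congr_ae (ae_of_all _ fun s => show v a s * v a s * v b s * v b s =
            v a s * v b s * v b s * v a s by ring), hpair a b hab]
          simp [hab]
        · have := hz b a a c (Ne.symm hab) (Ne.symm hab) hbc
          rw [← integral_congr_ae (ae_of_all _ fun s => show v b s * v a s * v a s * v c s =
            v a s * v b s * v c s * v a s by ring), this]
          simp [hab, hac, hbc]
      · rw [hz a b c d hab hac had]
        simp [hab, hac, had]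

lemma integral_mul_two_of_iIndepFun (hm : ∀ i, Measurable (v i)) (hind : iIndepFun v Q)
    (h0 : ∀ i, ∫ s, v i s ∂Q = 0) (h2 : ∀ i, ∫ s, v i s ^ 2 ∂Q = 1) (a b : ι) :
    ∫ s, v a s * v b s ∂Q = if a = b then 1 else 0 := by
  split_ifs with h
  · subst h
    simpa only [sq] using h2 a
  · rw [(hind.indepFun h).integral_fun_mul_eq_mul_integral (by have := hm a; fun_prop)
      (by have := hm b; fun_prop), h0, zero_mul]

/-- Mean squared error of a quadratic form in independent draws. -/
lemma integral_quadForm_sub_sq_le [IsProbabilityMeasure Q] (hm : ∀ i, Measurable (v i)) (hind : iIndepFun v Q)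
    (h0 : ∀ i, ∫ s, v i s ∂Q = 0) (h2 : ∀ i, ∫ s, v i s ^ 2 ∂Q = 1)
    (hL : ∀ i, MemLp (v i) 4 Q) {C : ℝ} (h4 : ∀ i, ∫ s, v i s ^ 4 ∂Q ≤ C) (hC : 0 ≤ C)
    (I : Finset ι) (H : ι → ι → ℝ) (hH : ∀ i j, H i j = H j i) (L : ℝ) :
    Integrable (fun s => (∑ i ∈ I, ∑ j ∈ I, H i j * (v i s * v j s) - L) ^ 2) Q ∧
    ∫ s, (∑ i ∈ I, ∑ j ∈ I, H i j * (v i s * v j s) - L) ^ 2 ∂Q ≤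
      (∑ i ∈ I, H i i - L) ^ 2 + (2 + C) * ∑ i ∈ I, ∑ j ∈ I, H i j ^ 2 := by
  have i2 : ∀ i j, Integrable (fun s => H i j * (v i s * v j s)) Q := fun i j =>
    (integrable_mul_of_memLp_four (hL i) (hL j)).const_mul _
  have i4 : ∀ i j k l, Integrable (fun s => H i j * H k l * (v i s * v j s * v k s * v l s)) Q :=
    fun i j k l => (integrable_mul_four (hL i) (hL j) (hL k) (hL l)).const_mul _
  have I2 : Integrable (fun s => ∑ i ∈ I, ∑ j ∈ I, H i j * (v i s * v j s)) Q :=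
    integrable_finsetSum _ fun i _ => integrable_finsetSum _ fun j _ => i2 i j
  have I4 : Integrable (fun s => ∑ i ∈ I, ∑ j ∈ I, ∑ k ∈ I, ∑ l ∈ I,
      H i j * H k l * (v i s * v j s * v k s * v l s)) Q :=
    integrable_finsetSum _ fun i _ => integrable_finsetSum _ fun j _ =>
      integrable_finsetSum _ fun k _ => integrable_finsetSum _ fun l _ => i4 i j k l
  have e : ∀ s, (∑ i ∈ I, ∑ j ∈ I, H i j * (v i s * v j s) - L) ^ 2 =
      (∑ i ∈ I, ∑ j ∈ I, ∑ k ∈ I, ∑ l ∈ I, H i j * H k l * (v i s * v j s * v k s * v l s) +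
        (-2 * L) * ∑ i ∈ I, ∑ j ∈ I, H i j * (v i s * v j s)) + L ^ 2 := by
    intro s
    have h1 : ∑ i ∈ I, ∑ j ∈ I, ∑ k ∈ I, ∑ l ∈ I,
        H i j * H k l * (v i s * v j s * v k s * v l s) =
        (∑ i ∈ I, ∑ j ∈ I, H i j * (v i s * v j s)) ^ 2 := by
      rw [sq, Finset.sum_mul]
      refine Finset.sum_congr rfl fun i _ => ?_
      rw [Finset.sum_mul]
      refine Finset.sum_congr rfl fun j _ => ?_
      rw [Finset.mul_sum]
      refine Finset.sum_congr rfl fun k _ => ?_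
      rw [Finset.mul_sum]
      exact Finset.sum_congr rfl fun l _ => by ring
    rw [h1]
    ring
  have I42 : Integrable (fun s => ∑ i ∈ I, ∑ j ∈ I, ∑ k ∈ I, ∑ l ∈ I,
      H i j * H k l * (v i s * v j s * v k s * v l s) +
        (-2 * L) * ∑ i ∈ I, ∑ j ∈ I, H i j * (v i s * v j s)) Q := I4.add (I2.const_mul _)
  simp_rw [e]
  refine ⟨I42.add (integrable_const _), ?_⟩
  rw [integral_add I42 (integrable_const _), integral_add I4 (I2.const_mul _),
    integral_const_mul]
  have e2 : ∫ s, ∑ i ∈ I, ∑ j ∈ I, H i j * (v i s * v j s) ∂Q = ∑ i ∈ I, H i i := by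
    rw [integral_finsetSum _ fun i _ => integrable_finsetSum _ fun j _ => i2 i j]
    refine Finset.sum_congr rfl fun i hi => ?_
    rw [integral_finsetSum _ fun j _ => i2 i j]
    simp_rw [integral_const_mul, integral_mul_two_of_iIndepFun hm hind h0 h2]
    simp [hi]
  -- The first pairing gives the squared trace. The other two each give the squared Hilbert–Schmidt
  -- norm, the last by symmetry of `H`. The excess kurtosis contributes only on the diagonal.
  have e4 : ∫ s, ∑ i ∈ I, ∑ j ∈ I, ∑ k ∈ I, ∑ l ∈ I,
      H i j * H k l * (v i s * v j s * v k s * v l s) ∂Q =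
      (∑ i ∈ I, H i i) ^ 2 + 2 * ∑ i ∈ I, ∑ j ∈ I, H i j ^ 2 +
        ∑ i ∈ I, H i i ^ 2 * (∫ s, v i s ^ 4 ∂Q - 3) := by
    have e5 : ∀ i j k l, ∫ s, H i j * H k l * (v i s * v j s * v k s * v l s) ∂Q =
        (if i = j then if k = l then H i j * H k l else 0 else 0) +
        (if i = k then if j = l then H i j * H k l else 0 else 0) +
        (if i = l then if j = k then H i j * H k l else 0 else 0) +
        (if i = j then if i = k then if i = l then
          H i j * H k l * (∫ s, v i s ^ 4 ∂Q - 3) else 0 else 0 else 0) := by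
      intro i j k l
      rw [integral_const_mul, integral_mul_four_of_iIndepFun hm hind h0 h2]
      simp only [mul_add, mul_ite, mul_one, mul_zero]
    rw [integral_finsetSum _ fun i _ => integrable_finsetSum _ fun j _ =>
      integrable_finsetSum _ fun k _ => integrable_finsetSum _ fun l _ => i4 i j k l]
    simp_rw [integral_finsetSum I fun j _ => integrable_finsetSum I fun k _ =>
      integrable_finsetSum I fun l _ => i4 _ j k l, integral_finsetSum I fun k _ =>
      integrable_finsetSum I fun l _ => i4 _ _ k l, integral_finsetSum I fun l _ => i4 _ _ _ l, e5,
      Finset.sum_add_distrib]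
    congr 1
    · rw [two_mul, ← add_assoc]
      congr 1
      · congr 1
        · rw [sq, Finset.sum_mul_sum]
          refine Finset.sum_congr rfl fun i hi => ?_
          rw [Finset.sum_comm]
          refine Finset.sum_congr rfl fun k hk => ?_
          simp [hi, hk]
        · refine Finset.sum_congr rfl fun i hi => Finset.sum_congr rfl fun j hj => ?_
          simp [hi, hj, sq]
      · refine Finset.sum_congr rfl fun i hi => Finset.sum_congr rfl fun j hj => ?_
        rw [Finset.sum_comm]
        simp [hi, hj, sq, hH j i]
    · refine Finset.sum_congr rfl fun i hi => ?_
      simp [hi, sq]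
  have e6 : ∑ i ∈ I, H i i ^ 2 * (∫ s, v i s ^ 4 ∂Q - 3) ≤ C * ∑ i ∈ I, ∑ j ∈ I, H i j ^ 2 := by
    rw [Finset.mul_sum]
    refine Finset.sum_le_sum fun i hi => ?_
    calc _ ≤ H i i ^ 2 * C := by
          have := h4 i
          gcongr
          linarith
      _ ≤ (∑ j ∈ I, H i j ^ 2) * C := by
          gcongr
          exact Finset.single_le_sum (f := fun j => H i j ^ 2) (fun j _ => sq_nonneg _) hi
      _ = _ := mul_comm _ _
  rw [e2, e4]
  simp only [integral_const, probReal_univ, smul_eq_mul, one_mul]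
  nlinarith

end IndependentDraws

end SHARWB

/-! ### Second and fourth moments of weighted sums of a stationary process -/

namespace SHARWB

/-- The normalized weighted sum `T^{-1/2} ∑_{t=1}^T f t * u_t`. -/
noncomputable def linStat {Ω : Type*} (T : ℕ) (f : ℕ → ℝ) (u : ℤ → Ω → ℝ) (ω : Ω) : ℝ :=
  (1 / √(T : ℝ)) * ∑ t ∈ Finset.Icc 1 T, f t * u (t : ℤ) ω

/-- The covariance of two normalized weighted sums of a stationary process with autocovariance
function `γ`. -/
noncomputable def covForm (T : ℕ) (γ : ℤ → ℝ) (f g : ℕ → ℝ) : ℝ :=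
  (∑ s ∈ Finset.Icc 1 T, ∑ t ∈ Finset.Icc 1 T, f s * g t * γ ((t : ℤ) - s)) / T

section Moments

variable {Ω : Type*} [MeasurableSpace Ω] {P : Measure Ω} {u : ℤ → Ω → ℝ}

lemma FourthOrderStationary.integral_mul (h : FourthOrderStationary P u) (s t : ℤ) :
    ∫ ω, u s ω * u t ω ∂P = autocov P u (t - s) := by
  have := h.shift 2 (by norm_num) ![0, t - s] s
  simpa [Fin.prod_univ_two, autocov] using this

lemma WeaklyDependent.covariance_eq [IsProbabilityMeasure P] (h : WeaklyDependent P u) (s t : ℤ) :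
    cov[u s, u t; P] = autocov P u (t - s) := by
  rw [← h.stationary.integral_mul]
  simp [covariance, h.mean_zero]

/-- Stationarity shifts the first index to zero, where the definition of the cumulant applies. -/
lemma WeaklyDependent.integral_mul_four [IsProbabilityMeasure P] (h : WeaklyDependent P u)
    (a b c d : ℤ) :
    ∫ ω, u a ω * u b ω * u c ω * u d ω ∂P = cumulant4 P u (b - a) (c - a) (d - a) +
      (autocov P u (b - a) * autocov P u (d - c) + autocov P u (c - a) * autocov P u (d - b) +
        autocov P u (d - a) * autocov P u (c - b)) := by
  have h4 := h.stationary.shift 4 le_rfl ![0, b - a, c - a, d - a] a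
  simp only [Fin.prod_univ_four] at h4
  simp only [Matrix.cons_val, zero_add, sub_add_cancel] at h4
  rw [h4]
  simp only [cumulant4, h.mean_zero, sub_zero, h.covariance_eq]
  simp only [sub_sub_sub_cancel_right]
  ring

lemma memLp_linStat (h : FourthOrderStationary P u) (T : ℕ) (f : ℕ → ℝ) :
    MemLp (linStat T f u) 4 P := by
  have h1 : MemLp (fun ω => ∑ t ∈ Finset.Icc 1 T, f t * u (t : ℤ) ω) 4 P :=
    memLp_finsetSum _ fun t _ => (h.memLp t).const_mul (f t)
  exact h1.const_mul (1 / √(T : ℝ))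

lemma integral_linStat_mul [IsFiniteMeasure P] (h : FourthOrderStationary P u) (T : ℕ)
    (f g : ℕ → ℝ) :
    ∫ ω, linStat T f u ω * linStat T g u ω ∂P = covForm T (autocov P u) f g := by
  have i2 : ∀ s t : ℕ, Integrable (fun ω => f s * g t * (u s ω * u t ω)) P := fun s t =>
    (integrable_mul_of_memLp_four (h.memLp s) (h.memLp t)).const_mul _
  have e : ∀ ω, linStat T f u ω * linStat T g u ω =
      (1 / T : ℝ) * ∑ s ∈ Finset.Icc 1 T, ∑ t ∈ Finset.Icc 1 T,
        f s * g t * (u s ω * u t ω) := by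
    intro ω
    have hT : (1 / T : ℝ) = (1 / √(T : ℝ)) * (1 / √(T : ℝ)) := by
      rw [div_mul_div_comm, Real.mul_self_sqrt (Nat.cast_nonneg T), one_mul]
    rw [linStat, linStat, mul_mul_mul_comm, Finset.sum_mul_sum, hT]
    congr 1
    exact Finset.sum_congr rfl fun _ _ => Finset.sum_congr rfl fun _ _ => by ring
  simp_rw [e]
  rw [integral_const_mul, integral_finsetSum _ fun s _ => integrable_finsetSum _ fun t _ => i2 s t,
    covForm, one_div_mul_eq_div]
  congr 1
  refine Finset.sum_congr rfl fun s _ => ?_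
  rw [integral_finsetSum _ fun t _ => i2 s t]
  refine Finset.sum_congr rfl fun t _ => ?_
  rw [integral_const_mul, h.integral_mul]

/-- Translation by `a` embeds the triples of sample times in `ℤ³`. The bound is uniform in `a`, so
the remaining sum over `a` costs a factor `T` against the normalization `T⁻²`. -/
lemma sum_abs_cumulant4_le (h : WeaklyDependent P u) (T : ℕ) (a : ℤ) :
    ∑ b ∈ Finset.Icc 1 T, ∑ c ∈ Finset.Icc 1 T, ∑ d ∈ Finset.Icc 1 T,
      |cumulant4 P u ((b : ℤ) - a) ((c : ℤ) - a) ((d : ℤ) - a)| ≤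
    ∑' p : ℤ × ℤ × ℤ, |cumulant4 P u p.1 p.2.1 p.2.2| := by
  classical
  set F : ℤ × ℤ × ℤ → ℝ := fun p => |cumulant4 P u p.1 p.2.1 p.2.2| with hF
  set e : ℕ × ℕ × ℕ → ℤ × ℤ × ℤ := fun p => ((p.1 : ℤ) - a, (p.2.1 : ℤ) - a, (p.2.2 : ℤ) - a)
  have he : Function.Injective e := by
    rintro ⟨x, y, z⟩ ⟨x', y', z'⟩ hxy
    simp only [e, Prod.mk.injEq, sub_left_inj, Nat.cast_inj] at hxy
    simp [hxy]
  have h1 : ∑ b ∈ Finset.Icc 1 T, ∑ c ∈ Finset.Icc 1 T, ∑ d ∈ Finset.Icc 1 T,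
      |cumulant4 P u ((b : ℤ) - a) ((c : ℤ) - a) ((d : ℤ) - a)| =
      ∑ p ∈ Finset.Icc 1 T ×ˢ (Finset.Icc 1 T ×ˢ Finset.Icc 1 T), F (e p) := by
    rw [Finset.sum_product]
    refine Finset.sum_congr rfl fun b _ => ?_
    rw [Finset.sum_product]
  rw [h1, ← Finset.sum_image (f := F) (s := Finset.Icc 1 T ×ˢ (Finset.Icc 1 T ×ˢ Finset.Icc 1 T))
    (g := e) he.injOn]
  exact h.cumulant_summable.sum_le_tsum _ fun _ _ => abs_nonneg _

/-- The fourth mixed moments of weighted sums are Gaussian-like up to `O(1/T)`. -/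
lemma abs_integral_linStat_mul_four_sub_le [IsProbabilityMeasure P] (h : WeaklyDependent P u)
    {T : ℕ} (hT : 0 < T) {B : ℝ} {f g k l : ℕ → ℝ} (hf : ∀ t, |f t| ≤ B) (hg : ∀ t, |g t| ≤ B)
    (hk : ∀ t, |k t| ≤ B) (hl : ∀ t, |l t| ≤ B) :
    |∫ ω, linStat T f u ω * linStat T g u ω * linStat T k u ω * linStat T l u ω ∂P -
      (covForm T (autocov P u) f g * covForm T (autocov P u) k l +
        covForm T (autocov P u) f k * covForm T (autocov P u) g l +
        covForm T (autocov P u) f l * covForm T (autocov P u) g k)| ≤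
      B ^ 4 * (∑' p : ℤ × ℤ × ℤ, |cumulant4 P u p.1 p.2.1 p.2.2|) / T := by
  have hT' : (0 : ℝ) < T := Nat.cast_pos.2 hT
  set γ := autocov P u
  set N := Finset.Icc 1 T
  have hB : 0 ≤ B := (abs_nonneg _).trans (hf 0)
  have i4 : ∀ a b c d : ℕ, Integrable (fun ω => f a * g b * k c * l d *
      (u a ω * u b ω * u c ω * u d ω)) P := fun a b c d =>
    (integrable_mul_four (h.stationary.memLp a) (h.stationary.memLp b) (h.stationary.memLp c)
      (h.stationary.memLp d)).const_mul _
  have hprod : ∀ (x : ℕ → ℕ → ℝ) (y : ℕ → ℕ → ℝ),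
      (∑ a ∈ N, ∑ b ∈ N, x a b) * (∑ c ∈ N, ∑ d ∈ N, y c d) =
      ∑ a ∈ N, ∑ b ∈ N, ∑ c ∈ N, ∑ d ∈ N, x a b * y c d := by
    intro x y
    rw [Finset.sum_mul]
    refine Finset.sum_congr rfl fun a _ => ?_
    rw [Finset.sum_mul]
    refine Finset.sum_congr rfl fun b _ => ?_
    rw [Finset.mul_sum]
    exact Finset.sum_congr rfl fun c _ => Finset.mul_sum _ _ _
  have e : ∀ ω, linStat T f u ω * linStat T g u ω * linStat T k u ω * linStat T l u ω =
      (1 / (T : ℝ) ^ 2) * ∑ a ∈ N, ∑ b ∈ N, ∑ c ∈ N, ∑ d ∈ N,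
        f a * g b * k c * l d * (u a ω * u b ω * u c ω * u d ω) := by
    intro ω
    have hr : (1 / (T : ℝ) ^ 2) = (1 / √(T : ℝ)) ^ 4 := by
      rw [div_pow, one_pow, show √(T : ℝ) ^ 4 = (√(T : ℝ) ^ 2) ^ 2 by ring,
        Real.sq_sqrt (Nat.cast_nonneg T)]
    have hs : ∑ a ∈ N, ∑ b ∈ N, ∑ c ∈ N, ∑ d ∈ N,
        f a * g b * k c * l d * (u a ω * u b ω * u c ω * u d ω) =
        (∑ a ∈ N, f a * u a ω) * (∑ a ∈ N, g a * u a ω) * (∑ a ∈ N, k a * u a ω) *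
          (∑ a ∈ N, l a * u a ω) := by
      rw [mul_assoc, Finset.sum_mul_sum, Finset.sum_mul_sum, hprod]
      exact Finset.sum_congr rfl fun _ _ => Finset.sum_congr rfl fun _ _ =>
        Finset.sum_congr rfl fun _ _ => Finset.sum_congr rfl fun _ _ => by ring
    rw [hs, hr]
    simp only [linStat, N]
    ring
  have e1 : covForm T γ f g * covForm T γ k l = (1 / (T : ℝ) ^ 2) *
      ∑ a ∈ N, ∑ b ∈ N, ∑ c ∈ N, ∑ d ∈ N,
        f a * g b * k c * l d * (γ ((b : ℤ) - a) * γ ((d : ℤ) - c)) := by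
    rw [covForm, covForm, div_mul_div_comm, hprod, ← sq, div_eq_inv_mul, one_div]
    congr 1
    exact Finset.sum_congr rfl fun _ _ => Finset.sum_congr rfl fun _ _ =>
      Finset.sum_congr rfl fun _ _ => Finset.sum_congr rfl fun _ _ => by ring
  -- In this pairing and in the next the summation variables come out in a different order and have
  -- to be exchanged to match the common fourfold sum.
  have e2 : covForm T γ f k * covForm T γ g l = (1 / (T : ℝ) ^ 2) *
      ∑ a ∈ N, ∑ b ∈ N, ∑ c ∈ N, ∑ d ∈ N,
        f a * g b * k c * l d * (γ ((c : ℤ) - a) * γ ((d : ℤ) - b)) := by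
    rw [covForm, covForm, div_mul_div_comm, hprod, ← sq, div_eq_inv_mul, one_div]
    congr 1
    refine Finset.sum_congr rfl fun _ _ => ?_
    rw [Finset.sum_comm]
    exact Finset.sum_congr rfl fun _ _ =>
      Finset.sum_congr rfl fun _ _ => Finset.sum_congr rfl fun _ _ => by ring
  have e3 : covForm T γ f l * covForm T γ g k = (1 / (T : ℝ) ^ 2) *
      ∑ a ∈ N, ∑ b ∈ N, ∑ c ∈ N, ∑ d ∈ N,
        f a * g b * k c * l d * (γ ((d : ℤ) - a) * γ ((c : ℤ) - b)) := by
    rw [covForm, covForm, div_mul_div_comm, hprod, ← sq, div_eq_inv_mul, one_div]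
    congr 1
    refine Finset.sum_congr rfl fun _ _ => ?_
    rw [Finset.sum_comm]
    refine Finset.sum_congr rfl fun _ _ => ?_
    rw [Finset.sum_comm]
    exact Finset.sum_congr rfl fun _ _ => Finset.sum_congr rfl fun _ _ => by ring
  have e0 : ∫ ω, linStat T f u ω * linStat T g u ω * linStat T k u ω * linStat T l u ω ∂P =
      (1 / (T : ℝ) ^ 2) * ∑ a ∈ N, ∑ b ∈ N, ∑ c ∈ N, ∑ d ∈ N, f a * g b * k c * l d *
        (∫ ω, u a ω * u b ω * u c ω * u d ω ∂P) := by
    simp_rw [e]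
    rw [integral_const_mul, integral_finsetSum _ fun a _ => integrable_finsetSum _ fun b _ =>
      integrable_finsetSum _ fun c _ => integrable_finsetSum _ fun d _ => i4 a b c d]
    simp_rw [integral_finsetSum N fun b _ => integrable_finsetSum N fun c _ =>
      integrable_finsetSum N fun d _ => i4 _ b c d, integral_finsetSum N fun c _ =>
      integrable_finsetSum N fun d _ => i4 _ _ c d, integral_finsetSum N fun d _ => i4 _ _ _ d,
      integral_const_mul]
  -- The three Gaussian pairings cancel exactly, leaving only the cumulants.
  have ediff : ∫ ω, linStat T f u ω * linStat T g u ω * linStat T k u ω * linStat T l u ω ∂P -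
      (covForm T γ f g * covForm T γ k l + covForm T γ f k * covForm T γ g l +
        covForm T γ f l * covForm T γ g k) = (1 / (T : ℝ) ^ 2) *
      ∑ a ∈ N, ∑ b ∈ N, ∑ c ∈ N, ∑ d ∈ N,
        f a * g b * k c * l d * cumulant4 P u ((b : ℤ) - a) ((c : ℤ) - a) ((d : ℤ) - a) := by
    rw [e0, e1, e2, e3, ← mul_add, ← mul_add, ← mul_sub]
    congr 1
    simp only [← Finset.sum_add_distrib, ← Finset.sum_sub_distrib]
    refine Finset.sum_congr rfl fun a _ => Finset.sum_congr rfl fun b _ =>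
      Finset.sum_congr rfl fun c _ => Finset.sum_congr rfl fun d _ => ?_
    rw [h.integral_mul_four]
    ring
  rw [ediff, abs_mul, abs_of_nonneg (by positivity), one_div, ← div_eq_inv_mul,
    div_le_div_iff₀ (by positivity) hT']
  have hsum : |∑ a ∈ N, ∑ b ∈ N, ∑ c ∈ N, ∑ d ∈ N,
      f a * g b * k c * l d * cumulant4 P u ((b : ℤ) - a) ((c : ℤ) - a) ((d : ℤ) - a)| ≤
      ∑ a ∈ N, B ^ 4 * ∑' p : ℤ × ℤ × ℤ, |cumulant4 P u p.1 p.2.1 p.2.2| := by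
    refine (Finset.abs_sum_le_sum_abs _ _).trans (Finset.sum_le_sum fun a _ => ?_)
    refine le_trans ?_ (mul_le_mul_of_nonneg_left (sum_abs_cumulant4_le h T a) (by positivity))
    simp only [Finset.mul_sum]
    refine (Finset.abs_sum_le_sum_abs _ _).trans (Finset.sum_le_sum fun b _ => ?_)
    refine (Finset.abs_sum_le_sum_abs _ _).trans (Finset.sum_le_sum fun c _ => ?_)
    refine (Finset.abs_sum_le_sum_abs _ _).trans (Finset.sum_le_sum fun d _ => ?_)
    rw [abs_mul]
    gcongr
    rw [abs_mul, abs_mul, abs_mul, show B ^ 4 = B * B * B * B by ring]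
    gcongr
    exacts [hf a, hg b, hk c, hl d]
  calc _ ≤ (∑ a ∈ N, B ^ 4 * ∑' p : ℤ × ℤ × ℤ, |cumulant4 P u p.1 p.2.1 p.2.2|) * T := by gcongr
    _ = _ := by
      rw [Finset.sum_const, Nat.card_Icc, nsmul_eq_mul]
      simp
      ring

end Moments

/-! ### Covariances of smoothly weighted sums -/

section Covariance

lemma sum_abs_mul_le_tsum {γ : ℤ → ℝ} (h1 : Summable fun h : ℤ => |(h : ℝ)| * |γ h|) (T : ℕ)
    (t : ℤ) : ∑ s ∈ Finset.Icc 1 T, |((((s : ℤ) - t : ℤ)) : ℝ)| * |γ ((s : ℤ) - t)| ≤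
      ∑' h : ℤ, |(h : ℝ)| * |γ h| := by
  classical
  rw [← Finset.sum_image (f := fun h : ℤ => |(h : ℝ)| * |γ h|) (s := Finset.Icc 1 T)
    (g := fun s : ℕ => (s : ℤ) - t) (by intro x _ y _ hxy; simpa using hxy)]
  exact h1.sum_le_tsum _ fun _ _ => by positivity

/-- The total mass of the autocovariances that fall outside the sample window. -/
lemma sum_abs_tsum_sub_sum_le {γ : ℤ → ℝ} (h0 : Summable fun h : ℤ => |γ h|)
    (h1 : Summable fun h : ℤ => |(h : ℝ)| * |γ h|) (T : ℕ) :
    ∑ s ∈ Finset.Icc 1 T, |∑' h, γ h - ∑ t ∈ Finset.Icc 1 T, γ ((t : ℤ) - s)| ≤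
      ∑' h : ℤ, |(h : ℝ)| * |γ h| := by
  classical
  have hγ : Summable γ := h0.of_abs
  set W : ℕ → Finset ℤ := fun s => (Finset.Icc 1 T).image fun t : ℕ => (t : ℤ) - s with hW
  have hsum : ∀ s : ℕ, ∑ t ∈ Finset.Icc 1 T, γ ((t : ℤ) - s) = ∑ h ∈ W s, γ h := fun s => by
    rw [hW, Finset.sum_image (by intro x _ y _ hxy; simpa using hxy)]
  have hind : ∀ s : ℕ, Summable fun h : ℤ => if h ∈ W s then 0 else |γ h| := fun s =>
    h0.of_nonneg_of_le (fun h => by split_ifs <;> positivity) fun h => by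
      split_ifs
      · positivity
      · exact le_rfl
  have hbd : ∀ s : ℕ, |∑' h, γ h - ∑ t ∈ Finset.Icc 1 T, γ ((t : ℤ) - s)| ≤
      ∑' h : ℤ, if h ∈ W s then 0 else |γ h| := by
    intro s
    have hfin : ∑ h ∈ W s, γ h = ∑' h, if h ∈ W s then γ h else 0 := by
      rw [tsum_eq_sum (s := W s) fun b hb => by simp [hb]]
      exact Finset.sum_congr rfl fun h hh => by simp [hh]
    rw [hsum, hfin]
    have hs : Summable fun h => if h ∈ W s then γ h else 0 :=
      summable_of_ne_finset_zero (s := W s) fun b hb => by simp [hb]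
    rw [← hγ.tsum_sub hs]
    have habs : ∀ h, ‖γ h - if h ∈ W s then γ h else 0‖ = if h ∈ W s then 0 else |γ h| := by
      intro h
      split_ifs <;> simp
    have hn : Summable fun h => ‖γ h - if h ∈ W s then γ h else 0‖ :=
      (hind s).congr fun h => (habs h).symm
    exact (norm_tsum_le_tsum_norm hn).trans_eq (tsum_congr habs)
  refine (Finset.sum_le_sum fun s _ => hbd s).trans ?_
  rw [← Summable.tsum_finsetSum fun s _ => hind s]
  refine Summable.tsum_le_tsum (fun h => ?_) (summable_sum fun s _ => hind s) h1
  have e : ∀ s, (if h ∈ W s then 0 else |γ h|) = (if h ∉ W s then 1 else 0) * |γ h| := fun s => by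
    split_ifs <;> simp_all
  simp_rw [e]
  rw [← Finset.sum_mul, ← Finset.sum_filter, Finset.sum_const, nsmul_eq_mul, mul_one]
  gcongr
  -- After exchanging the sums, lag `h` counts once for every time `s` with `s + h` outside the
  -- sample: the last `|h|` times if `h ≥ 0`, the first `|h|` if `h < 0`. The truncated subtraction
  -- covers `|h| > T`.
  have hcard : ((Finset.Icc 1 T).filter fun s => h ∉ W s).card ≤ h.natAbs := by
    have hsub : ((Finset.Icc 1 T).filter fun s => h ∉ W s) ⊆
        if 0 ≤ h then Finset.Ioc (T - h.natAbs) T else Finset.Icc 1 h.natAbs := by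
      intro s hs
      simp only [Finset.mem_filter, Finset.mem_Icc, hW, Finset.mem_image, not_exists, not_and] at hs
      obtain ⟨⟨hs1, hs2⟩, hs3⟩ := hs
      have h4 := hs3 (h + s).toNat
      split_ifs with hh
      · rw [Finset.mem_Ioc]
        by_contra hcon
        exact h4 (by omega) (by omega)
      · rw [Finset.mem_Icc]
        by_contra hcon
        exact h4 (by omega) (by omega)
    refine (Finset.card_le_card hsub).trans ?_
    split_ifs
    · rw [Nat.card_Ioc]; omega
    · rw [Nat.card_Icc]; omega
  calc _ ≤ ((h.natAbs : ℕ) : ℝ) := by exact_mod_cast hcard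
    _ = |(h : ℝ)| := by rw [Nat.cast_natAbs, Int.cast_abs]

/-- The covariance of weighted sums with smooth weights is that of white noise with the long-run
variance, up to `O(1/T)`. -/
lemma abs_covForm_sub_le {γ : ℤ → ℝ} (h0 : Summable fun h : ℤ => |γ h|)
    (h1 : Summable fun h : ℤ => |(h : ℝ)| * |γ h|) {T : ℕ} (hT : 0 < T) {B D : ℝ} (hB : 0 ≤ B)
    {f g : ℕ → ℝ} (hf : ∀ t, |f t| ≤ B) (hg : ∀ t, |g t| ≤ B)
    (hgD : ∀ s t, |g s - g t| ≤ D / T * |(s : ℝ) - t|) :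
    |covForm T γ f g - (∑' h, γ h) * gridInner T f g| ≤
      B * (B + D) / T * ∑' h : ℤ, |(h : ℝ)| * |γ h| := by
  have hT' : (0 : ℝ) < T := Nat.cast_pos.2 hT
  set N := Finset.Icc 1 T
  set L := ∑' h, γ h
  set M := ∑' h : ℤ, |(h : ℝ)| * |γ h|
  have hD : 0 ≤ D := by
    have := (abs_nonneg _).trans (hgD 1 0)
    rw [Nat.cast_one, Nat.cast_zero, sub_zero, abs_one, mul_one] at this
    exact (div_nonneg_iff.1 this).elim (fun h => h.1) fun h => absurd h.2 (not_le.2 hT')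
  -- Freeze the second weight at time `s`. The first sum is the freezing error, controlled by the
  -- Lipschitz bound; the second is the edge effect of the finite window.
  have e : covForm T γ f g - L * gridInner T f g =
      (∑ s ∈ N, (f s * ∑ t ∈ N, (g t - g s) * γ ((t : ℤ) - s)) -
        ∑ s ∈ N, f s * g s * (L - ∑ t ∈ N, γ ((t : ℤ) - s))) / T := by
    rw [covForm, gridInner, mul_div_assoc', ← sub_div]
    congr 1
    rw [Finset.mul_sum, ← Finset.sum_sub_distrib, ← Finset.sum_sub_distrib]
    refine Finset.sum_congr rfl fun s _ => ?_
    simp only [sub_mul, Finset.sum_sub_distrib, ← Finset.mul_sum, mul_assoc]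
    ring
  have b1 : |∑ s ∈ N, (f s * ∑ t ∈ N, (g t - g s) * γ ((t : ℤ) - s))| ≤ B * D * M := by
    have : ∀ s ∈ N, |f s * ∑ t ∈ N, (g t - g s) * γ ((t : ℤ) - s)| ≤ B * (D / T * M) := by
      intro s _
      rw [abs_mul]
      refine mul_le_mul (hf s) ?_ (abs_nonneg _) hB
      refine (Finset.abs_sum_le_sum_abs _ _).trans ?_
      refine le_trans ?_ (mul_le_mul_of_nonneg_left (sum_abs_mul_le_tsum h1 T s) (by positivity))
      rw [Finset.mul_sum]
      refine Finset.sum_le_sum fun t _ => ?_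
      rw [abs_mul, ← mul_assoc]
      gcongr
      simpa using hgD t s
    refine (Finset.abs_sum_le_sum_abs _ _).trans ((Finset.sum_le_sum this).trans_eq ?_)
    rw [Finset.sum_const, Nat.card_Icc, nsmul_eq_mul, Nat.add_sub_cancel]
    field_simp
  have b2 : |∑ s ∈ N, f s * g s * (L - ∑ t ∈ N, γ ((t : ℤ) - s))| ≤ B * B * M := by
    refine le_trans ?_ (mul_le_mul_of_nonneg_left (sum_abs_tsum_sub_sum_le h0 h1 T)
      (by positivity))
    rw [Finset.mul_sum]
    refine (Finset.abs_sum_le_sum_abs _ _).trans (Finset.sum_le_sum fun s _ => ?_)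
    rw [abs_mul, abs_mul]
    gcongr
    exacts [hf s, hg s]
  rw [e, abs_div, abs_of_pos hT', div_le_iff₀ hT']
  refine (abs_sub _ _).trans ((add_le_add b1 b2).trans_eq ?_)
  field_simp
  ring

end Covariance

end SHARWB

/-! ### The design: basis functions times regressors -/

namespace SHARWB

/-- A basis whose elements are, up to the factor `√2`, distinct trigonometric regressors with
frequency at most the index. -/
structure IsTrigBasis (φ : ℕ → ℝ → ℝ) (r : ℕ → Fin 2) (m : ℕ → ℕ) : Prop where
  pos : ∀ l, 1 ≤ l → 0 < m l
  le : ∀ l, m l ≤ l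
  inj : ∀ l l', 1 ≤ l → 1 ≤ l' → r l = r l' → m l = m l' → l = l'
  eq : ∀ l T t : ℕ, φ l ((t : ℝ) / T) = √2 * trig T (r l) (m l) t

lemma isTrigBasis_alternatingBasis :
    IsTrigBasis alternatingBasis (fun l => if Odd l then 0 else 1) id where
  pos l hl := hl
  le _ := le_rfl
  inj _ _ _ _ _ h := h
  eq l T t := by
    unfold alternatingBasis trig
    by_cases h : Odd l <;> simp [h]

lemma isTrigBasis_pairedBasis :
    IsTrigBasis pairedBasis (fun l => if Odd l then 0 else 1)
      (fun l => if Odd l then (l + 1) / 2 else l / 2) where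
  pos l hl := by
    split_ifs with h
    · omega
    · rw [Nat.not_odd_iff_even] at h
      obtain ⟨k, rfl⟩ := h
      omega
  le l := by
    split_ifs with h
    · obtain ⟨k, rfl⟩ := h
      omega
    · omega
  inj l l' hl hl' h1 h2 := by
    by_cases h : Odd l <;> by_cases h' : Odd l' <;> simp only [h, h', if_true, if_false] at h1 h2
    · obtain ⟨k, rfl⟩ := h
      obtain ⟨k', rfl⟩ := h'
      omega
    · simp at h1
    · simp at h1
    · rw [Nat.not_odd_iff_even] at h h'
      obtain ⟨k, rfl⟩ := h
      obtain ⟨k', rfl⟩ := h'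
      omega
  eq l T t := by
    unfold pairedBasis trig
    by_cases h : Odd l <;> simp [h]

lemma exists_isTrigBasis {φ : ℕ → ℝ → ℝ} (hφ : φ = alternatingBasis ∨ φ = pairedBasis) :
    ∃ r m, IsTrigBasis φ r m := by
  rcases hφ with rfl | rfl
  exacts [⟨_, _, isTrigBasis_alternatingBasis⟩, ⟨_, _, isTrigBasis_pairedBasis⟩]

/-- The indices of the trigonometric regressors with frequency at most `k`. -/
def trigIndex (k : ℕ) : Finset (Fin 2 × ℕ) := Finset.univ ×ˢ Finset.Icc 1 k

lemma card_trigIndex (k : ℕ) : (trigIndex k).card = 2 * k := by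
  simp [trigIndex]

lemma sum_trigIndex (k : ℕ) (F : Fin 2 × ℕ → ℝ) :
    ∑ i ∈ trigIndex k, F i = ∑ l ∈ Finset.Icc 1 k, (F (0, l) + F (1, l)) := by
  rw [trigIndex, Finset.sum_product, Fin.sum_univ_two, ← Finset.sum_add_distrib]

/-- The values of a basis function on the grid. -/
noncomputable def gridBasis (φ : ℕ → ℝ → ℝ) (T l t : ℕ) : ℝ := φ l ((t : ℝ) / T)

/-- The product of a basis function and a trigonometric regressor, centered on the grid. -/
noncomputable def prodWeight (φ : ℕ → ℝ → ℝ) (T : ℕ) (a : ℕ × Fin 2 × ℕ) (t : ℕ) : ℝ :=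
  gridBasis φ T a.1 t * trig T a.2.1 a.2.2 t -
    gridInner T (gridBasis φ T a.1) (trig T a.2.1 a.2.2)

section Design

variable {φ : ℕ → ℝ → ℝ} {r : ℕ → Fin 2} {m : ℕ → ℕ} {T K Ks : ℕ}

lemma gridInner_trigIndex (hKs : 2 * Ks < T) {i j : Fin 2 × ℕ} (hi : i ∈ trigIndex Ks)
    (hj : j ∈ trigIndex Ks) :
    gridInner T (trig T i.1 i.2) (trig T j.1 j.2) = if i = j then 1 / 2 else 0 := by
  simp only [trigIndex, Finset.mem_product, Finset.mem_univ, true_and, Finset.mem_Icc] at hi hj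
  rw [gridInner_trig _ _ (by omega) (by omega) (by omega)]
  simp only [Prod.ext_iff]

lemma sum_gridInner_trig_sq_le (hKs : 2 * Ks < T) (g : ℕ → ℝ) :
    ∑ i ∈ trigIndex Ks, gridInner T g (trig T i.1 i.2) ^ 2 ≤ gridInner T g g / 2 :=
  sum_gridInner_sq_le _ _ (fun _ hi _ hj => gridInner_trigIndex hKs hi hj) g

lemma gridBasis_eq (hb : IsTrigBasis φ r m) (T l : ℕ) :
    gridBasis φ T l = fun t => √2 * trig T (r l) (m l) t :=
  funext fun t => hb.eq l T t

lemma gridInner_gridBasis_right (hb : IsTrigBasis φ r m) (g : ℕ → ℝ) (l : ℕ) :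
    gridInner T g (gridBasis φ T l) = √2 * gridInner T g (trig T (r l) (m l)) := by
  rw [gridBasis_eq hb, gridInner, gridInner, mul_div_assoc', Finset.mul_sum]
  congr 1
  exact Finset.sum_congr rfl fun _ _ => by ring

lemma gridInner_trig_of_isTrigBasis (hb : IsTrigBasis φ r m) (hK : 2 * K < T) {l l' : ℕ}
    (hl : l ∈ Finset.Icc 1 K) (hl' : l' ∈ Finset.Icc 1 K) :
    gridInner T (trig T (r l) (m l)) (trig T (r l') (m l')) = if l = l' then 1 / 2 else 0 := by
  rw [Finset.mem_Icc] at hl hl'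
  have h1 := hb.le l
  have h2 := hb.le l'
  rw [gridInner_trig _ _ (hb.pos l hl.1) (hb.pos l' hl'.1) (by omega)]
  refine if_congr ⟨fun h => hb.inj l l' hl.1 hl'.1 h.1 h.2, ?_⟩ rfl rfl
  rintro rfl
  exact ⟨rfl, rfl⟩

lemma gridInner_gridBasis (hb : IsTrigBasis φ r m) (hK : 2 * K < T) {l l' : ℕ}
    (hl : l ∈ Finset.Icc 1 K) (hl' : l' ∈ Finset.Icc 1 K) :
    gridInner T (gridBasis φ T l) (gridBasis φ T l') = if l = l' then 1 else 0 := by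
  rw [gridInner_gridBasis_right hb, gridInner_comm, gridInner_gridBasis_right hb, ← mul_assoc,
    Real.mul_self_sqrt (by norm_num), gridInner_trig_of_isTrigBasis hb hK hl' hl]
  by_cases h : l = l' <;> simp [h, Ne.symm]

lemma sum_gridInner_gridBasis_sq_le (hb : IsTrigBasis φ r m) (hK : 2 * K < T) (g : ℕ → ℝ) :
    ∑ l ∈ Finset.Icc 1 K, gridInner T g (gridBasis φ T l) ^ 2 ≤ gridInner T g g := by
  have h := sum_gridInner_sq_le (Finset.Icc 1 K) (fun l => trig T (r l) (m l))
    (fun _ hl _ hl' => gridInner_trig_of_isTrigBasis hb hK hl hl') g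
  have e : ∀ l, gridInner T g (gridBasis φ T l) ^ 2 =
      2 * gridInner T g (trig T (r l) (m l)) ^ 2 := fun l => by
    rw [gridInner_gridBasis_right hb, mul_pow, Real.sq_sqrt (by norm_num)]
  simp_rw [e, ← Finset.mul_sum]
  linarith

lemma sum_gridBasis (hb : IsTrigBasis φ r m) (hK : 2 * K < T) {l : ℕ}
    (hl : l ∈ Finset.Icc 1 K) : ∑ t ∈ Finset.Icc 1 T, gridBasis φ T l t = 0 := by
  rw [Finset.mem_Icc] at hl
  have := hb.le l
  simp_rw [gridBasis_eq hb, ← Finset.mul_sum]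
  rw [sum_trig _ (hb.pos l hl.1) (by omega), mul_zero]

lemma abs_gridBasis_le (hb : IsTrigBasis φ r m) (T l t : ℕ) : |gridBasis φ T l t| ≤ 3 / 2 := by
  have h2 : √2 ≤ 3 / 2 := by rw [Real.sqrt_le_left (by norm_num)]; norm_num
  rw [gridBasis_eq hb, abs_mul, abs_of_nonneg (Real.sqrt_nonneg 2)]
  nlinarith [abs_trig_le T (r l) (m l) t, abs_nonneg (trig T (r l) (m l) t)]

/-- The constant `11` rounds up `7 * 3 / 2`, with `3 / 2` standing for `√2`. -/
lemma abs_gridBasis_sub_le (hb : IsTrigBasis φ r m) {l : ℕ} (hl : l ∈ Finset.Icc 1 K)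
    (s t : ℕ) : |gridBasis φ T l s - gridBasis φ T l t| ≤ 11 * K / T * |(s : ℝ) - t| := by
  rw [Finset.mem_Icc] at hl
  have h2 : √2 ≤ 3 / 2 := by rw [Real.sqrt_le_left (by norm_num)]; norm_num
  have hm : (m l : ℝ) ≤ K := by exact_mod_cast (hb.le l).trans hl.2
  rw [gridBasis_eq hb, ← mul_sub, abs_mul, abs_of_nonneg (Real.sqrt_nonneg 2)]
  calc _ ≤ 3 / 2 * (7 * m l / T * |(s : ℝ) - t|) :=
        mul_le_mul h2 (abs_trig_sub_le _ _ _ _ _) (abs_nonneg _) (by norm_num)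
    _ = (3 / 2 * 7 * m l) / T * |(s : ℝ) - t| := by ring
    _ ≤ _ := by
        gcongr
        norm_num

lemma abs_trigIndex_sub_le {i : Fin 2 × ℕ} (hi : i ∈ trigIndex Ks) (s t : ℕ) :
    |trig T i.1 i.2 s - trig T i.1 i.2 t| ≤ 7 * Ks / T * |(s : ℝ) - t| := by
  simp only [trigIndex, Finset.mem_product, Finset.mem_univ, true_and, Finset.mem_Icc] at hi
  have : (i.2 : ℝ) ≤ Ks := by exact_mod_cast hi.2
  refine (abs_trig_sub_le _ _ _ _ _).trans ?_
  gcongr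

lemma abs_prodWeight_le (hb : IsTrigBasis φ r m) (T : ℕ) (a : ℕ × Fin 2 × ℕ) (t : ℕ) :
    |prodWeight φ T a t| ≤ 3 := by
  have h1 : |gridBasis φ T a.1 t * trig T a.2.1 a.2.2 t| ≤ 3 / 2 := by
    rw [abs_mul]
    nlinarith [abs_gridBasis_le hb T a.1 t, abs_trig_le T a.2.1 a.2.2 t,
      abs_nonneg (gridBasis φ T a.1 t), abs_nonneg (trig T a.2.1 a.2.2 t)]
  have h2 := abs_gridInner_le (T := T) (A := 3 / 2) (B := 1) (by norm_num) (by norm_num)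
    (abs_gridBasis_le hb T a.1) (abs_trig_le T a.2.1 a.2.2)
  exact (abs_sub _ _).trans (by linarith)

lemma abs_prodWeight_sub_le (hb : IsTrigBasis φ r m) {a : ℕ × Fin 2 × ℕ}
    (ha : a ∈ Finset.Icc 1 K ×ˢ trigIndex Ks) (s t : ℕ) :
    |prodWeight φ T a s - prodWeight φ T a t| ≤ 11 * (K + Ks) / T * |(s : ℝ) - t| := by
  rw [Finset.mem_product] at ha
  have h1 := abs_gridBasis_sub_le (T := T) hb ha.1 s t
  have h2 := abs_trigIndex_sub_le (T := T) ha.2 s t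
  have e : prodWeight φ T a s - prodWeight φ T a t =
      (gridBasis φ T a.1 s - gridBasis φ T a.1 t) * trig T a.2.1 a.2.2 s +
        gridBasis φ T a.1 t * (trig T a.2.1 a.2.2 s - trig T a.2.1 a.2.2 t) := by
    simp only [prodWeight]; ring
  rw [e]
  refine (abs_add_le _ _).trans ?_
  rw [abs_mul, abs_mul]
  calc _ ≤ (11 * K / T * |(s : ℝ) - t|) * 1 + 3 / 2 * (7 * Ks / T * |(s : ℝ) - t|) := by
        gcongr
        · exact abs_trig_le _ _ _ _
        · exact abs_gridBasis_le hb _ _ _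
    _ = (11 * K + 3 / 2 * 7 * Ks) / T * |(s : ℝ) - t| := by ring
    _ ≤ _ := by
        gcongr
        have : (0 : ℝ) ≤ Ks := Nat.cast_nonneg _
        linarith

lemma sum_prodWeight (hT : 0 < T) (a : ℕ × Fin 2 × ℕ) :
    ∑ t ∈ Finset.Icc 1 T, prodWeight φ T a t = 0 := by
  have hT' : (T : ℝ) ≠ 0 := by positivity
  simp only [prodWeight, Finset.sum_sub_distrib, Finset.sum_const, Nat.card_Icc, nsmul_eq_mul,
    Nat.add_sub_cancel]
  rw [gridInner]
  field_simp
  simp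

/-- Since the first weight already sums to zero, centering the second is superfluous. The second
weight becomes a plain product, either factor of which can be moved to the other side before
Bessel's inequality is applied. -/
lemma gridInner_prodWeight (hT : 0 < T) (a b : ℕ × Fin 2 × ℕ) :
    gridInner T (prodWeight φ T a) (prodWeight φ T b) =
      (∑ t ∈ Finset.Icc 1 T,
        prodWeight φ T a t * (gridBasis φ T b.1 t * trig T b.2.1 b.2.2 t)) / T := by
  rw [gridInner]
  congr 1
  conv_lhs =>
    enter [2, t]
    rw [prodWeight.eq_def φ T b, mul_sub]
  rw [Finset.sum_sub_distrib, ← Finset.sum_mul, sum_prodWeight hT, zero_mul, sub_zero]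

lemma gridInner_prodWeight_trig (hT : 0 < T) (a b : ℕ × Fin 2 × ℕ) :
    gridInner T (prodWeight φ T a) (prodWeight φ T b) =
      gridInner T (fun t => prodWeight φ T a t * gridBasis φ T b.1 t)
        (trig T b.2.1 b.2.2) := by
  rw [gridInner_prodWeight hT, gridInner]
  congr 1
  exact Finset.sum_congr rfl fun _ _ => by ring

lemma gridInner_prodWeight_gridBasis (hT : 0 < T) (a b : ℕ × Fin 2 × ℕ) :
    gridInner T (prodWeight φ T a) (prodWeight φ T b) =
      gridInner T (fun t => prodWeight φ T a t * trig T b.2.1 b.2.2 t)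
        (gridBasis φ T b.1) := by
  rw [gridInner_prodWeight hT, gridInner]
  congr 1
  exact Finset.sum_congr rfl fun _ _ => by ring

/-- Bessel's inequality over the regressors, with the basis function absorbed into the tested
function. That function is bounded by `9 / 2`, and `(9 / 2)² / 2 ≤ 11`. The bound does not grow with
`Ks`. -/
lemma sum_gridInner_prodWeight_sq_le_trig (hb : IsTrigBasis φ r m) (hKs : 2 * Ks < T)
    (a : ℕ × Fin 2 × ℕ) (l : ℕ) :
    ∑ i ∈ trigIndex Ks, gridInner T (prodWeight φ T a) (prodWeight φ T (l, i)) ^ 2 ≤ 11 := by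
  simp_rw [gridInner_prodWeight_trig (φ := φ) (T := T) (by omega) a]
  refine (sum_gridInner_trig_sq_le hKs _).trans ?_
  have h : ∀ t, |prodWeight φ T a t * gridBasis φ T l t| ≤ 9 / 2 := fun t => by
    rw [abs_mul]
    nlinarith [abs_gridBasis_le hb T l t, abs_prodWeight_le hb T a t,
      abs_nonneg (gridBasis φ T l t), abs_nonneg (prodWeight φ T a t)]
  have := (abs_le.1 (abs_gridInner_le (T := T) (by norm_num) (by norm_num) h h)).2
  linarith

/-- The same with the roles exchanged: Bessel over the orthonormal basis functions, the regressor
being absorbed, and `3² = 9`. -/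
lemma sum_gridInner_prodWeight_sq_le_basis (hb : IsTrigBasis φ r m) (hK : 2 * K < T)
    (a : ℕ × Fin 2 × ℕ) (i : Fin 2 × ℕ) :
    ∑ l ∈ Finset.Icc 1 K, gridInner T (prodWeight φ T a) (prodWeight φ T (l, i)) ^ 2 ≤ 9 := by
  simp_rw [gridInner_prodWeight_gridBasis (φ := φ) (T := T) (by omega) a]
  refine (sum_gridInner_gridBasis_sq_le hb hK _).trans ?_
  have h : ∀ t, |prodWeight φ T a t * trig T i.1 i.2 t| ≤ 3 := fun t => by
    rw [abs_mul]
    nlinarith [abs_trig_le T i.1 i.2 t, abs_prodWeight_le hb T a t,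
      abs_nonneg (trig T i.1 i.2 t), abs_nonneg (prodWeight φ T a t)]
  have := (abs_le.1 (abs_gridInner_le (T := T) (by norm_num) (by norm_num) h h)).2
  linarith

lemma gridInner_prodWeight_self (hT : 0 < T) (a : ℕ × Fin 2 × ℕ) :
    gridInner T (prodWeight φ T a) (prodWeight φ T a) =
      (∑ t ∈ Finset.Icc 1 T, gridBasis φ T a.1 t ^ 2 * trig T a.2.1 a.2.2 t ^ 2) / T -
        gridInner T (gridBasis φ T a.1) (trig T a.2.1 a.2.2) ^ 2 := by
  have hT' : (T : ℝ) ≠ 0 := by positivity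
  rw [gridInner_prodWeight hT]
  have e : ∀ t, prodWeight φ T a t * (gridBasis φ T a.1 t * trig T a.2.1 a.2.2 t) =
      gridBasis φ T a.1 t ^ 2 * trig T a.2.1 a.2.2 t ^ 2 -
        gridInner T (gridBasis φ T a.1) (trig T a.2.1 a.2.2) *
          (gridBasis φ T a.1 t * trig T a.2.1 a.2.2 t) := fun t => by
    simp only [prodWeight]; ring
  simp_rw [e]
  rw [Finset.sum_sub_distrib, ← Finset.mul_sum, sub_div, mul_div_assoc]
  congr 1
  rw [sq]
  rfl

/-- For each basis function, `cos² + sin² = 1` makes the uncentered squared norms sum to exactly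
`Ks`. By Bessel the centering removes at most `1 / 2` in total, so the error is at most one per
basis function. -/
lemma abs_sum_gridInner_prodWeight_self_sub_le (hb : IsTrigBasis φ r m) (hK : 2 * K < T)
    (hKs : 2 * Ks < T) :
    |∑ a ∈ Finset.Icc 1 K ×ˢ trigIndex Ks, gridInner T (prodWeight φ T a) (prodWeight φ T a) -
      K * Ks| ≤ K := by
  have hT : 0 < T := by omega
  have h1 : ∀ l ∈ Finset.Icc 1 K, |∑ i ∈ trigIndex Ks,
      gridInner T (prodWeight φ T (l, i)) (prodWeight φ T (l, i)) - Ks| ≤ 1 := by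
    intro l hl
    have e1 : ∑ i ∈ trigIndex Ks, (∑ t ∈ Finset.Icc 1 T,
        gridBasis φ T l t ^ 2 * trig T i.1 i.2 t ^ 2) / T = Ks := by
      have : ∀ k, (∑ t ∈ Finset.Icc 1 T, gridBasis φ T l t ^ 2 * trig T 0 k t ^ 2) / T +
          (∑ t ∈ Finset.Icc 1 T, gridBasis φ T l t ^ 2 * trig T 1 k t ^ 2) / T = 1 := by
        intro k
        have h2 := gridInner_gridBasis hb hK hl hl
        rw [if_pos rfl, gridInner] at h2
        rw [← add_div, ← Finset.sum_add_distrib, ← h2]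
        congr 1
        refine Finset.sum_congr rfl fun t _ => ?_
        rw [← mul_add, trig_sq_add_sq]
        ring
      rw [sum_trigIndex]
      simp only [this]
      simp
    simp_rw [gridInner_prodWeight_self hT, Finset.sum_sub_distrib, e1]
    have h3 := sum_gridInner_trig_sq_le hKs (gridBasis φ T l)
    rw [gridInner_gridBasis hb hK hl hl, if_pos rfl] at h3
    have h4 : 0 ≤ ∑ i ∈ trigIndex Ks, gridInner T (gridBasis φ T l) (trig T i.1 i.2) ^ 2 :=
      Finset.sum_nonneg fun _ _ => sq_nonneg _
    rw [abs_le]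
    constructor <;> linarith
  rw [Finset.sum_product]
  have e : ∑ l ∈ Finset.Icc 1 K, ∑ i ∈ trigIndex Ks,
      gridInner T (prodWeight φ T (l, i)) (prodWeight φ T (l, i)) - K * Ks =
      ∑ l ∈ Finset.Icc 1 K, (∑ i ∈ trigIndex Ks,
        gridInner T (prodWeight φ T (l, i)) (prodWeight φ T (l, i)) - Ks) := by
    rw [Finset.sum_sub_distrib]
    simp
  rw [e]
  refine (Finset.abs_sum_le_sum_abs _ _).trans ((Finset.sum_le_sum h1).trans_eq ?_)
  simp

end Design

end SHARWB

/-! ### Mean squared errors for families of smooth weights -/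

namespace SHARWB

variable {Ω : Type*} [MeasurableSpace Ω] {P : Measure Ω} {u : ℤ → Ω → ℝ}

/-- The long-run variance as the sum of the autocovariances. -/
noncomputable def autocovSum (P : Measure Ω) (u : ℤ → Ω → ℝ) : ℝ := ∑' h, autocov P u h

/-- The bound on the covariance approximation for weights bounded by `3` with Lipschitz constant
`D / T`. -/
noncomputable def covError (P : Measure Ω) (u : ℤ → Ω → ℝ) (T : ℕ) (D : ℝ) : ℝ :=
  3 * (3 + D) / T * ∑' h : ℤ, |(h : ℝ)| * |autocov P u h|

/-- The bound on the cumulant contribution for weights bounded by `3`. -/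
noncomputable def cumError (P : Measure Ω) (u : ℤ → Ω → ℝ) (T : ℕ) : ℝ :=
  3 ^ 4 * (∑' p : ℤ × ℤ × ℤ, |cumulant4 P u p.1 p.2.1 p.2.2|) / T

lemma cumError_nonneg (T : ℕ) : 0 ≤ cumError P u T :=
  div_nonneg (mul_nonneg (by norm_num) (tsum_nonneg fun _ => abs_nonneg _)) (Nat.cast_nonneg _)

lemma covError_nonneg (T : ℕ) {D : ℝ} (hD : 0 ≤ D) : 0 ≤ covError P u T D :=
  mul_nonneg (by positivity) (tsum_nonneg fun _ => by positivity)

lemma WeaklyDependent.summable_mul_autocov (h : WeaklyDependent P u) :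
    Summable fun k : ℤ => |(k : ℝ)| * |autocov P u k| := by
  refine h.autocov_summable.of_nonneg_of_le (fun k => by positivity) fun k => ?_
  gcongr
  rcases eq_or_ne k 0 with rfl | hk
  · simp
  · refine le_self_pow₀ ?_ (by norm_num)
    rw [← Int.cast_abs]
    exact_mod_cast Int.one_le_abs hk

/-- Lag zero is added by hand, since the factor `|k|` vanishes there. -/
lemma WeaklyDependent.summable_autocov (h : WeaklyDependent P u) :
    Summable fun k : ℤ => |autocov P u k| := by
  have hs := (summable_of_ne_finset_zero (s := {(0 : ℤ)})
    (f := fun k => if k = 0 then |autocov P u k| else 0)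
    fun b hb => by simpa using fun h => absurd h (by simpa using hb)).add h.summable_mul_autocov
  refine hs.of_nonneg_of_le (fun k => by positivity) fun k => ?_
  rcases eq_or_ne k 0 with rfl | hk
  · simp
  · simp only [hk, if_false, zero_add]
    refine le_mul_of_one_le_left (abs_nonneg _) ?_
    rw [← Int.cast_abs]
    exact_mod_cast Int.one_le_abs hk

/-- Bounded weights whose increments over the grid are small. -/
structure SmoothWeight (T : ℕ) (D : ℝ) (f : ℕ → ℝ) : Prop where
  bound : ∀ t, |f t| ≤ 3
  lip : ∀ s t, |f s - f t| ≤ D / T * |(s : ℝ) - t|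

variable {T : ℕ} {D : ℝ}

lemma abs_covForm_sub_le_covError (h : WeaklyDependent P u) (hT : 0 < T) {f g : ℕ → ℝ}
    (hf : SmoothWeight T D f) (hg : SmoothWeight T D g) :
    |covForm T (autocov P u) f g - autocovSum P u * gridInner T f g| ≤ covError P u T D :=
  abs_covForm_sub_le h.summable_autocov h.summable_mul_autocov hT (by norm_num) hf.bound hg.bound
    hg.lip

lemma covForm_sq_le (h : WeaklyDependent P u) (hT : 0 < T) {f g : ℕ → ℝ}
    (hf : SmoothWeight T D f) (hg : SmoothWeight T D g) :
    covForm T (autocov P u) f g ^ 2 ≤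
      2 * autocovSum P u ^ 2 * gridInner T f g ^ 2 + 2 * covError P u T D ^ 2 := by
  have h1 := sq_le_sq' (abs_le.1 (abs_covForm_sub_le_covError h hT hf hg)).1
    (abs_le.1 (abs_covForm_sub_le_covError h hT hf hg)).2
  set c := covForm T (autocov P u) f g
  set s := autocovSum P u * gridInner T f g with hs
  have : 2 * autocovSum P u ^ 2 * gridInner T f g ^ 2 = 2 * s ^ 2 := by rw [hs]; ring
  rw [this]
  -- The inequality `c² ≤ 2s² + 2(c - s)²` is the nonnegativity of `(c - 2s)²`.
  nlinarith [sq_nonneg (c - 2 * s)]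

lemma integral_linStat_mul_four_le [IsProbabilityMeasure P] (h : WeaklyDependent P u) (hT : 0 < T)
    {f g k l : ℕ → ℝ} (hf : SmoothWeight T D f) (hg : SmoothWeight T D g)
    (hk : SmoothWeight T D k) (hl : SmoothWeight T D l) :
    ∫ ω, linStat T f u ω * linStat T g u ω * linStat T k u ω * linStat T l u ω ∂P ≤
      covForm T (autocov P u) f g * covForm T (autocov P u) k l +
        covForm T (autocov P u) f k * covForm T (autocov P u) g l +
        covForm T (autocov P u) f l * covForm T (autocov P u) g k + cumError P u T := by
  have := (abs_le.1 (abs_integral_linStat_mul_four_sub_le h hT hf.bound hg.bound hk.bound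
    hl.bound)).2
  simp only [cumError]
  linarith

/-- Mean squared error of an average of squared weighted sums as an estimator of the long-run
variance. -/
lemma integral_average_linStat_sq_sub_sq_le [IsProbabilityMeasure P] (h : WeaklyDependent P u)
    (hT : 0 < T) {ι : Type*} {A : Finset ι} {f : ι → ℕ → ℝ}
    (hf : ∀ a ∈ A, SmoothWeight T D (f a)) {N τ σ : ℝ} (hN : 0 < N) (hA : (A.card : ℝ) ≤ 2 * N)
    (hD : 0 ≤ D) (hτ : |1 / N * ∑ a ∈ A, gridInner T (f a) (f a) - 1| ≤ τ)
    (hσ : ∑ a ∈ A, ∑ b ∈ A, gridInner T (f a) (f b) ^ 2 ≤ σ * N ^ 2) :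
    ∫ ω, (1 / N * ∑ a ∈ A, linStat T (f a) u ω ^ 2 - autocovSum P u) ^ 2 ∂P ≤
      (|autocovSum P u| * τ + 2 * covError P u T D) ^ 2 + 4 * autocovSum P u ^ 2 * σ +
        16 * covError P u T D ^ 2 + 4 * cumError P u T := by
  set L := autocovSum P u
  set ε := covError P u T D
  set ρ := cumError P u T
  set c : ι → ι → ℝ := fun a b => covForm T (autocov P u) (f a) (f b)
  have hε : 0 ≤ ε := covError_nonneg T hD
  have hρ : 0 ≤ ρ := cumError_nonneg T
  have h1 := integral_sum_sq_sub_sq_le (A := A) (Z := fun a => linStat T (f a) u) (c := c) (ρ := ρ)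
    (fun a _ => memLp_linStat h.stationary T (f a))
    (fun a _ b _ => integral_linStat_mul h.stationary T (f a) (f b))
    (fun a ha b hb => (integral_linStat_mul_four_le h hT (hf a ha) (hf a ha) (hf b hb)
      (hf b hb)).trans_eq (by simp only [c, ρ]; ring)) (1 / N) L
  refine h1.trans ?_
  have hbias : |1 / N * ∑ a ∈ A, c a a - L| ≤ |L| * τ + 2 * ε := by
    have e : 1 / N * ∑ a ∈ A, c a a - L = L * (1 / N * ∑ a ∈ A, gridInner T (f a) (f a) - 1) +
        1 / N * ∑ a ∈ A, (c a a - L * gridInner T (f a) (f a)) := by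
      rw [Finset.sum_sub_distrib, ← Finset.mul_sum]; ring
    rw [e]
    refine (abs_add_le _ _).trans ?_
    rw [abs_mul, abs_mul, abs_of_pos (by positivity : 0 < 1 / N)]
    refine add_le_add (mul_le_mul_of_nonneg_left hτ (abs_nonneg _)) ?_
    rw [one_div_mul_eq_div, div_le_iff₀ hN]
    refine (Finset.abs_sum_le_sum_abs _ _).trans ((Finset.sum_le_sum fun a ha =>
      abs_covForm_sub_le_covError h hT (hf a ha) (hf a ha)).trans ?_)
    rw [Finset.sum_const, nsmul_eq_mul]
    nlinarith
  -- The main part is the sum of squared inner products. The errors are paid once per pair, and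
  -- `A.card ≤ 2 * N` yields the factors `16` and `4` after division by `N ^ 2`.
  have hvar : ∑ a ∈ A, ∑ b ∈ A, (2 * c a b ^ 2 + ρ) ≤
      4 * L ^ 2 * (σ * N ^ 2) + (4 * ε ^ 2 + ρ) * (2 * N) ^ 2 := by
    calc _ ≤ ∑ a ∈ A, ∑ b ∈ A, (4 * L ^ 2 * gridInner T (f a) (f b) ^ 2 + (4 * ε ^ 2 + ρ)) := by
          refine Finset.sum_le_sum fun a ha => Finset.sum_le_sum fun b hb => ?_
          have := covForm_sq_le h hT (hf a ha) (hf b hb)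
          simp only [c]
          linarith
      _ = 4 * L ^ 2 * ∑ a ∈ A, ∑ b ∈ A, gridInner T (f a) (f b) ^ 2 +
          (4 * ε ^ 2 + ρ) * (A.card : ℝ) ^ 2 := by
          simp only [Finset.sum_add_distrib, Finset.mul_sum, Finset.sum_const, nsmul_eq_mul]
          ring
      _ ≤ _ := by gcongr
  have hb2 := sq_le_sq' (abs_le.1 hbias).1 (abs_le.1 hbias).2
  have hN2 : (1 / N) ^ 2 * (4 * L ^ 2 * (σ * N ^ 2) + (4 * ε ^ 2 + ρ) * (2 * N) ^ 2) =
      4 * L ^ 2 * σ + 16 * ε ^ 2 + 4 * ρ := by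
    field_simp
    ring
  have := mul_le_mul_of_nonneg_left hvar (sq_nonneg (1 / N))
  rw [hN2] at this
  linarith

/-- Integral of the squared entries of a Gram matrix of weighted sums. -/
lemma sum_integral_gram_sq_le [IsProbabilityMeasure P] (h : WeaklyDependent P u) (hT : 0 < T)
    {ι κ : Type*} {B : Finset κ} {I : Finset ι} {f : κ → ι → ℕ → ℝ}
    (hf : ∀ l ∈ B, ∀ i ∈ I, SmoothWeight T D (f l i)) {s : ℝ}
    (hsI : ∀ l ∈ B, ∀ i ∈ I, ∀ l' ∈ B, ∑ j ∈ I, gridInner T (f l i) (f l' j) ^ 2 ≤ s)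
    (hsB : ∀ l ∈ B, ∀ i ∈ I, ∑ l' ∈ B, gridInner T (f l i) (f l' i) ^ 2 ≤ s) :
    ∑ i ∈ I, ∑ j ∈ I, ∫ ω, (∑ l ∈ B, linStat T (f l i) u ω * linStat T (f l j) u ω) ^ 2 ∂P ≤
      2 * autocovSum P u ^ 2 * s *
        (2 * ((B.card : ℝ) ^ 2 * I.card) + (B.card : ℝ) * (I.card : ℝ) ^ 2) +
      (6 * covError P u T D ^ 2 + cumError P u T) * ((B.card : ℝ) ^ 2 * (I.card : ℝ) ^ 2) := by
  set L := autocovSum P u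
  set ε := covError P u T D
  set ρ := cumError P u T
  set b : ℝ := (B.card : ℝ)
  set k : ℝ := (I.card : ℝ)
  set c : κ → ι → κ → ι → ℝ := fun l i l' j => covForm T (autocov P u) (f l i) (f l' j) with hc
  set g : κ → ι → κ → ι → ℝ := fun l i l' j => gridInner T (f l i) (f l' j) ^ 2 with hg
  have hcg : ∀ l ∈ B, ∀ i ∈ I, ∀ l' ∈ B, ∀ j ∈ I,
      c l i l' j ^ 2 ≤ 2 * L ^ 2 * g l i l' j + 2 * ε ^ 2 := fun l hl i hi l' hl' j hj =>
    covForm_sq_le h hT (hf l hl i hi) (hf l' hl' j hj)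
  have hxy : ∀ x y : ℝ, x * y ≤ (x ^ 2 + y ^ 2) / 2 := fun x y => by
    nlinarith [sq_nonneg (x - y)]
  -- The three Gaussian pairings of the four sums, each product of covariances being split into
  -- squares by the arithmetic–geometric mean inequality.
  have h1 : ∀ i ∈ I, ∀ j ∈ I,
      ∫ ω, (∑ l ∈ B, linStat T (f l i) u ω * linStat T (f l j) u ω) ^ 2 ∂P ≤
      ∑ l ∈ B, ∑ l' ∈ B, (L ^ 2 * (g l i l j + g l' i l' j + g l i l' i + g l j l' j +
        g l i l' j + g l j l' i) + (6 * ε ^ 2 + ρ)) := by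
    intro i hi j hj
    refine integral_sum_mul_sq_le (B := B) (X := fun l => linStat T (f l i) u)
      (Y := fun l => linStat T (f l j) u) (fun l _ => memLp_linStat h.stationary T _)
      (fun l _ => memLp_linStat h.stationary T _) fun l hl l' hl' => ?_
    refine (integral_linStat_mul_four_le h hT (hf l hl i hi) (hf l hl j hj) (hf l' hl' i hi)
      (hf l' hl' j hj)).trans ?_
    have a1 := hxy (c l i l j) (c l' i l' j)
    have a2 := hxy (c l i l' i) (c l j l' j)
    have a3 := hxy (c l i l' j) (c l j l' i)
    have b1 := hcg l hl i hi l hl j hj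
    have b2 := hcg l' hl' i hi l' hl' j hj
    have b3 := hcg l hl i hi l' hl' i hi
    have b4 := hcg l hl j hj l' hl' j hj
    have b5 := hcg l hl i hi l' hl' j hj
    have b6 := hcg l hl j hj l' hl' i hi
    simp only [hc] at a1 a2 a3 b1 b2 b3 b4 b5 b6
    simp only [ρ]
    linarith
  have hcardI : ∀ (F : ι → ℝ) (x : ℝ), (∀ i ∈ I, F i ≤ x) → ∑ i ∈ I, F i ≤ k * x := by
    intro F x hF
    refine (Finset.sum_le_sum hF).trans_eq ?_
    rw [Finset.sum_const, nsmul_eq_mul]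
  have hcardB : ∀ (F : κ → ℝ) (x : ℝ), (∀ i ∈ B, F i ≤ x) → ∑ i ∈ B, F i ≤ b * x := by
    intro F x hF
    refine (Finset.sum_le_sum hF).trans_eq ?_
    rw [Finset.sum_const, nsmul_eq_mul]
  -- In every sum one of the four indices is removed by a Bessel bound. When the paired weights have
  -- the regressor indices `i` and `j`, summing over one of these costs only `s`; when they share
  -- the regressor index (`s3`, `s4`), the saving comes from the sum over `l'`.
  have s1 : ∑ i ∈ I, ∑ j ∈ I, ∑ l ∈ B, ∑ l' ∈ B, g l i l j ≤ k * (b * (b * s)) := by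
    refine hcardI _ _ fun i hi => ?_
    rw [Finset.sum_comm]
    refine hcardB _ _ fun l hl => ?_
    rw [Finset.sum_comm]
    exact hcardB _ _ fun l' _ => hsI l hl i hi l hl
  have s2 : ∑ i ∈ I, ∑ j ∈ I, ∑ l ∈ B, ∑ l' ∈ B, g l' i l' j ≤ k * (b * (b * s)) := by
    refine hcardI _ _ fun i hi => ?_
    rw [Finset.sum_comm]
    refine hcardB _ _ fun l hl => ?_
    rw [Finset.sum_comm]
    exact hcardB _ _ fun l' hl' => hsI l' hl' i hi l' hl'
  have s3 : ∑ i ∈ I, ∑ j ∈ I, ∑ l ∈ B, ∑ l' ∈ B, g l i l' i ≤ k * (k * (b * s)) :=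
    hcardI _ _ fun i hi => hcardI _ _ fun j _ => hcardB _ _ fun l hl => hsB l hl i hi
  have s4 : ∑ i ∈ I, ∑ j ∈ I, ∑ l ∈ B, ∑ l' ∈ B, g l j l' j ≤ k * (k * (b * s)) :=
    hcardI _ _ fun i _ => hcardI _ _ fun j hj => hcardB _ _ fun l hl => hsB l hl j hj
  have s5 : ∑ i ∈ I, ∑ j ∈ I, ∑ l ∈ B, ∑ l' ∈ B, g l i l' j ≤ k * (b * (b * s)) := by
    refine hcardI _ _ fun i hi => ?_
    rw [Finset.sum_comm]
    refine hcardB _ _ fun l hl => ?_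
    rw [Finset.sum_comm]
    exact hcardB _ _ fun l' hl' => hsI l hl i hi l' hl'
  have s6 : ∑ i ∈ I, ∑ j ∈ I, ∑ l ∈ B, ∑ l' ∈ B, g l j l' i ≤ k * (b * (b * s)) := by
    rw [Finset.sum_comm]
    refine hcardI _ _ fun j hj => ?_
    rw [Finset.sum_comm]
    refine hcardB _ _ fun l hl => ?_
    rw [Finset.sum_comm]
    exact hcardB _ _ fun l' hl' => hsI l hl j hj l' hl'
  refine (Finset.sum_le_sum fun i hi => Finset.sum_le_sum fun j hj => h1 i hi j hj).trans ?_
  have hconst : ∀ x : ℝ, ∑ _i ∈ I, ∑ _j ∈ I, ∑ _l ∈ B, ∑ _l' ∈ B, x = x * (b ^ 2 * k ^ 2) := by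
    intro x
    simp only [Finset.sum_const, nsmul_eq_mul, b, k]
    ring
  have := mul_le_mul_of_nonneg_left (add_le_add (add_le_add (add_le_add s1 s2) (add_le_add s3 s4))
    (add_le_add s5 s6)) (sq_nonneg L)
  have e := hconst (6 * ε ^ 2 + ρ)
  generalize 6 * ε ^ 2 + ρ = x at e ⊢
  simp only [Finset.sum_add_distrib, ← Finset.mul_sum]
  rw [e]
  linarith

/-- The Gaussian fourth moment is three times the squared variance, whence the factor `6` after
`covForm_sq_le`. This feeds the Lyapunov ratio. -/
lemma sum_integral_linStat_pow_four_le [IsProbabilityMeasure P] (h : WeaklyDependent P u)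
    (hT : 0 < T) {ι : Type*} {A : Finset ι} {f : ι → ℕ → ℝ}
    (hf : ∀ a ∈ A, SmoothWeight T D (f a)) {s : ℝ}
    (hs : ∀ a ∈ A, gridInner T (f a) (f a) ^ 2 ≤ s) :
    ∑ a ∈ A, ∫ ω, linStat T (f a) u ω ^ 4 ∂P ≤
      A.card * (6 * autocovSum P u ^ 2 * s + 6 * covError P u T D ^ 2 + cumError P u T) := by
  rw [← nsmul_eq_mul, ← Finset.sum_const]
  refine Finset.sum_le_sum fun a ha => ?_
  have h1 := integral_linStat_mul_four_le h hT (hf a ha) (hf a ha) (hf a ha) (hf a ha)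
  have h2 := covForm_sq_le h hT (hf a ha) (hf a ha)
  have h3 := mul_le_mul_of_nonneg_left (hs a ha) (sq_nonneg (autocovSum P u))
  have e : ∫ ω, linStat T (f a) u ω ^ 4 ∂P = ∫ ω, linStat T (f a) u ω * linStat T (f a) u ω *
      linStat T (f a) u ω * linStat T (f a) u ω ∂P :=
    integral_congr_ae (ae_of_all _ fun ω => by simp only; ring)
  rw [e]
  nlinarith

end SHARWB

/-! ### The random quantities that govern the bootstrap -/

namespace SHARWB

section Markov

variable {Ω : Type*} [MeasurableSpace Ω] {P : Measure Ω}

lemma tendsto_measureReal_le_of_integral_tendsto_zero {X : ℕ → Ω → ℝ} (h0 : ∀ n ω, 0 ≤ X n ω)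
    (hi : ∀ n, Integrable (X n) P) {b : ℕ → ℝ} (hb : ∀ᶠ n in atTop, ∫ ω, X n ω ∂P ≤ b n)
    (hb0 : Tendsto b atTop (𝓝 0)) {δ : ℝ} (hδ : 0 < δ) :
    Tendsto (fun n => P.real {ω | δ ≤ X n ω}) atTop (𝓝 0) := by
  refine tendsto_of_tendsto_of_tendsto_of_le_of_le' tendsto_const_nhds
    (by simpa using hb0.div_const δ) (Eventually.of_forall fun _ => measureReal_nonneg) ?_
  filter_upwards [hb] with n hn
  rw [le_div_iff₀ hδ, mul_comm]
  exact (mul_meas_ge_le_integral_of_nonneg (ae_of_all _ (h0 n)) (hi n) δ).trans hn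

lemma tendsto_measureReal_le_abs_sub_of_integral_sq [IsFiniteMeasure P] {X : ℕ → Ω → ℝ} {x : ℝ}
    (hX : ∀ n, MemLp (X n) 2 P) {b : ℕ → ℝ}
    (hb : ∀ᶠ n in atTop, ∫ ω, (X n ω - x) ^ 2 ∂P ≤ b n)
    (hb0 : Tendsto b atTop (𝓝 0)) {δ : ℝ} (hδ : 0 < δ) :
    Tendsto (fun n => P.real {ω | δ ≤ |X n ω - x|}) atTop (𝓝 0) := by
  have h := tendsto_measureReal_le_of_integral_tendsto_zero (P := P)
    (X := fun n ω => (X n ω - x) ^ 2) (fun _ _ => sq_nonneg _)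
    (fun n => ((hX n).sub (memLp_const x)).integrable_sq) hb hb0 (show 0 < δ ^ 2 by positivity)
  refine h.congr fun n => ?_
  congr 1
  ext ω
  simp only [Set.mem_ofPred_eq]
  rw [← sq_abs (X n ω - x), pow_le_pow_iff_left₀ hδ.le (abs_nonneg _) (by norm_num)]

end Markov

section Statistics

variable {Ω : Type*}

/-- The average of the squared projections on the first `K` basis functions. -/
noncomputable def projMean (φ : ℕ → ℝ → ℝ) (T K : ℕ) (u : ℤ → Ω → ℝ) (ω : Ω) : ℝ :=
  1 / (K : ℝ) * ∑ l ∈ Finset.Icc 1 K, linStat T (gridBasis φ T l) u ω ^ 2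

/-- The average of the squared projections on the trigonometric regressors; the variance of the
bootstrap mean. -/
noncomputable def trigMean (T Ks : ℕ) (u : ℤ → Ω → ℝ) (ω : Ω) : ℝ :=
  1 / (Ks : ℝ) * ∑ i ∈ trigIndex Ks, linStat T (trig T i.1 i.2) u ω ^ 2

/-- The Lyapunov ratio of the bootstrap mean. -/
noncomputable def trigFourth (T Ks : ℕ) (u : ℤ → Ω → ℝ) (ω : Ω) : ℝ :=
  1 / (Ks : ℝ) ^ 2 * ∑ i ∈ trigIndex Ks, linStat T (trig T i.1 i.2) u ω ^ 4

/-- The matrix of the bootstrap long-run variance estimator as a quadratic form in the external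
draws. -/
noncomputable def gram (φ : ℕ → ℝ → ℝ) (T K Ks : ℕ) (u : ℤ → Ω → ℝ) (i j : Fin 2 × ℕ) (ω : Ω) :
    ℝ :=
  1 / ((K : ℝ) * Ks) * ∑ l ∈ Finset.Icc 1 K,
    linStat T (prodWeight φ T (l, i)) u ω * linStat T (prodWeight φ T (l, j)) u ω

/-- The trace of the Gram matrix; the bootstrap mean of the long-run variance estimator. -/
noncomputable def gramTrace (φ : ℕ → ℝ → ℝ) (T K Ks : ℕ) (u : ℤ → Ω → ℝ) (ω : Ω) : ℝ :=
  ∑ i ∈ trigIndex Ks, gram φ T K Ks u i i ω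

/-- The squared Hilbert–Schmidt norm of the Gram matrix. -/
noncomputable def gramSq (φ : ℕ → ℝ → ℝ) (T K Ks : ℕ) (u : ℤ → Ω → ℝ) (ω : Ω) : ℝ :=
  ∑ i ∈ trigIndex Ks, ∑ j ∈ trigIndex Ks, gram φ T K Ks u i j ω ^ 2

lemma gramTrace_eq (φ : ℕ → ℝ → ℝ) (T K Ks : ℕ) (u : ℤ → Ω → ℝ) (ω : Ω) :
    gramTrace φ T K Ks u ω = 1 / ((K : ℝ) * Ks) *
      ∑ a ∈ Finset.Icc 1 K ×ˢ trigIndex Ks, linStat T (prodWeight φ T a) u ω ^ 2 := by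
  simp only [gramTrace, gram, ← Finset.mul_sum]
  rw [Finset.sum_product, Finset.sum_comm]
  simp only [sq]

variable [MeasurableSpace Ω] {P : Measure Ω}

/-- The common bound on the mean squared errors. -/
noncomputable def mseBound (P : Measure Ω) (u : ℤ → Ω → ℝ) (T K Ks : ℕ) : ℝ :=
  (|autocovSum P u| * (1 / K + 1 / Ks) + 2 * covError P u T (11 * (K + Ks))) ^ 2 +
    88 * autocovSum P u ^ 2 * (1 / K + 1 / Ks) + 24 * covError P u T (11 * (K + Ks)) ^ 2 +
    4 * cumError P u T

variable {u : ℤ → Ω → ℝ} {φ : ℕ → ℝ → ℝ} {r : ℕ → Fin 2} {m : ℕ → ℕ} {T K Ks : ℕ}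

/-- All three families of weights get the same constant `11 * (K + Ks)`, although this one would do
with less, so that a single error sequence serves throughout. -/
lemma smoothWeight_gridBasis (hb : IsTrigBasis φ r m) {l : ℕ} (hl : l ∈ Finset.Icc 1 K) :
    SmoothWeight T (11 * (K + Ks)) (gridBasis φ T l) where
  bound t := (abs_gridBasis_le hb T l t).trans (by norm_num)
  lip s t := (abs_gridBasis_sub_le hb hl s t).trans (by
    gcongr
    have : (0 : ℝ) ≤ Ks := Nat.cast_nonneg _
    linarith)

lemma smoothWeight_trig {i : Fin 2 × ℕ} (hi : i ∈ trigIndex Ks) :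
    SmoothWeight T (11 * (K + Ks)) (trig T i.1 i.2) where
  bound t := (abs_trig_le T _ _ t).trans (by norm_num)
  lip s t := (abs_trigIndex_sub_le hi s t).trans (by
    have h1 : (0 : ℝ) ≤ Ks := Nat.cast_nonneg _
    have h2 : (0 : ℝ) ≤ K := Nat.cast_nonneg _
    have h3 : 7 * (Ks : ℝ) ≤ 11 * (K + Ks) := by linarith
    gcongr)

lemma smoothWeight_prodWeight (hb : IsTrigBasis φ r m) {a : ℕ × Fin 2 × ℕ}
    (ha : a ∈ Finset.Icc 1 K ×ˢ trigIndex Ks) :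
    SmoothWeight T (11 * (K + Ks)) (prodWeight φ T a) where
  bound t := abs_prodWeight_le hb T a t
  lip s t := abs_prodWeight_sub_le hb ha s t

/-- The bound is sized for its worst cases: `88 = 4 * 22` accommodates the trace, and `24` is what
the Hilbert–Schmidt norm needs. -/
lemma le_mseBound {x τ σ : ℝ} (hτ0 : 0 ≤ τ) (hτ : τ ≤ 1 / K + 1 / Ks)
    (hσ : σ ≤ 22 * (1 / K + 1 / Ks))
    (hx : x ≤ (|autocovSum P u| * τ + 2 * covError P u T (11 * (K + Ks))) ^ 2 +
      4 * autocovSum P u ^ 2 * σ + 16 * covError P u T (11 * (K + Ks)) ^ 2 +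
      4 * cumError P u T) : x ≤ mseBound P u T K Ks := by
  refine hx.trans ?_
  have hε := covError_nonneg (P := P) (u := u) T (D := 11 * (K + Ks)) (by positivity)
  have h1 : (|autocovSum P u| * τ + 2 * covError P u T (11 * (K + Ks))) ^ 2 ≤
      (|autocovSum P u| * (1 / K + 1 / Ks) + 2 * covError P u T (11 * (K + Ks))) ^ 2 := by
    gcongr
  have h2 := mul_le_mul_of_nonneg_left hσ (sq_nonneg (autocovSum P u))
  have h3 := sq_nonneg (covError P u T (11 * (K + Ks)))
  unfold mseBound
  nlinarith

lemma memLp_gram (h : WeaklyDependent P u) (φ : ℕ → ℝ → ℝ) (T K Ks : ℕ) (i j : Fin 2 × ℕ) :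
    MemLp (gram φ T K Ks u i j) 2 P := by
  have h1 : MemLp (fun ω => ∑ l ∈ Finset.Icc 1 K,
      linStat T (prodWeight φ T (l, i)) u ω * linStat T (prodWeight φ T (l, j)) u ω) 2 P :=
    memLp_finsetSum _ fun l _ =>
      memLp_two_mul (memLp_linStat h.stationary _ _) (memLp_linStat h.stationary _ _)
  exact h1.const_mul _

variable [IsProbabilityMeasure P]

lemma integral_projMean_sub_sq_le (h : WeaklyDependent P u) (hb : IsTrigBasis φ r m)
    (hK0 : 0 < K) (hK : 2 * K < T) :
    ∫ ω, (projMean φ T K u ω - autocovSum P u) ^ 2 ∂P ≤ mseBound P u T K Ks := by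
  have hK0' : (0 : ℝ) < K := Nat.cast_pos.2 hK0
  have hself : ∑ l ∈ Finset.Icc 1 K, gridInner T (gridBasis φ T l) (gridBasis φ T l) = K := by
    rw [Finset.sum_congr rfl fun l hl => (gridInner_gridBasis hb hK hl hl).trans (if_pos rfl)]
    simp
  have hsq : ∑ l ∈ Finset.Icc 1 K, ∑ l' ∈ Finset.Icc 1 K,
      gridInner T (gridBasis φ T l) (gridBasis φ T l') ^ 2 ≤ 1 / (K : ℝ) * (K : ℝ) ^ 2 := by
    rw [show 1 / (K : ℝ) * (K : ℝ) ^ 2 = K by field_simp]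
    exact (Finset.sum_le_sum fun l _ => sum_gridInner_gridBasis_sq_le hb hK _).trans_eq hself
  refine le_mseBound (τ := 0) (σ := 1 / K) le_rfl (by positivity) ?_
    (integral_average_linStat_sq_sub_sq_le h (by omega)
      (fun l hl => smoothWeight_gridBasis hb hl) hK0' ?_ (by positivity) ?_ hsq)
  · have h1 : 0 ≤ 1 / (K : ℝ) := by positivity
    have h2 : 0 ≤ 1 / (Ks : ℝ) := by positivity
    linarith
  · simp; linarith
  · rw [hself, one_div_mul_cancel hK0'.ne']
    simp

/-- There are `2 * Ks` regressors of squared norm `1 / 2`, so the normalization by `Ks` makes the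
average unbiased to leading order. -/
lemma integral_trigMean_sub_sq_le (h : WeaklyDependent P u) (hKs0 : 0 < Ks) (hKs : 2 * Ks < T) :
    ∫ ω, (trigMean T Ks u ω - autocovSum P u) ^ 2 ∂P ≤ mseBound P u T K Ks := by
  have hK0' : (0 : ℝ) < Ks := Nat.cast_pos.2 hKs0
  have hself : ∑ i ∈ trigIndex Ks, gridInner T (trig T i.1 i.2) (trig T i.1 i.2) = Ks := by
    rw [Finset.sum_congr rfl fun i hi => (gridInner_trigIndex hKs hi hi).trans (if_pos rfl)]
    simp [card_trigIndex]
    ring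
  have hsq : ∑ i ∈ trigIndex Ks, ∑ j ∈ trigIndex Ks,
      gridInner T (trig T i.1 i.2) (trig T j.1 j.2) ^ 2 ≤ 1 / (Ks : ℝ) * (Ks : ℝ) ^ 2 := by
    rw [show 1 / (Ks : ℝ) * (Ks : ℝ) ^ 2 = Ks by field_simp]
    refine (Finset.sum_le_sum fun i _ => ?_).trans_eq hself
    refine (sum_gridInner_trig_sq_le hKs _).trans ?_
    have := gridInner_self_nonneg T (trig T i.1 i.2)
    linarith
  refine le_mseBound (τ := 0) (σ := 1 / Ks) le_rfl (by positivity) ?_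
    (integral_average_linStat_sq_sub_sq_le h (by omega)
      (fun i hi => smoothWeight_trig hi) hK0' ?_ (by positivity) ?_ hsq)
  · have h1 : 0 ≤ 1 / (K : ℝ) := by positivity
    have h2 : 0 ≤ 1 / (Ks : ℝ) := by positivity
    linarith
  · simp [card_trigIndex]
  · rw [hself, one_div_mul_cancel hK0'.ne']
    simp

/-- Each of the `2 * K * Ks` weights has squared inner products with all of them summing to at most
`11 * K`. Relative to `(K * Ks) ^ 2` this is `22 / Ks`. -/
lemma integral_gramTrace_sub_sq_le (h : WeaklyDependent P u) (hb : IsTrigBasis φ r m)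
    (hK0 : 0 < K) (hK : 2 * K < T) (hKs0 : 0 < Ks) (hKs : 2 * Ks < T) :
    ∫ ω, (gramTrace φ T K Ks u ω - autocovSum P u) ^ 2 ∂P ≤ mseBound P u T K Ks := by
  have hK0' : (0 : ℝ) < K := Nat.cast_pos.2 hK0
  have hKs0' : (0 : ℝ) < Ks := Nat.cast_pos.2 hKs0
  have hcard : ((Finset.Icc 1 K ×ˢ trigIndex Ks).card : ℝ) = 2 * (K * Ks) := by
    rw [Finset.card_product, card_trigIndex]
    push_cast [Nat.card_Icc, Nat.add_sub_cancel]
    ring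
  have hself : |1 / ((K : ℝ) * Ks) * ∑ a ∈ Finset.Icc 1 K ×ˢ trigIndex Ks,
      gridInner T (prodWeight φ T a) (prodWeight φ T a) - 1| ≤ 1 / Ks := by
    have h1 := abs_sum_gridInner_prodWeight_self_sub_le hb hK hKs
    set s := ∑ a ∈ Finset.Icc 1 K ×ˢ trigIndex Ks,
      gridInner T (prodWeight φ T a) (prodWeight φ T a)
    rw [show 1 / ((K : ℝ) * Ks) * s - 1 = (s - K * Ks) / (K * Ks) by field_simp, abs_div,
      abs_of_pos (show 0 < (K : ℝ) * Ks by positivity), div_le_div_iff₀ (by positivity) hKs0']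
    nlinarith
  have hsq : ∑ a ∈ Finset.Icc 1 K ×ˢ trigIndex Ks, ∑ b ∈ Finset.Icc 1 K ×ˢ trigIndex Ks,
      gridInner T (prodWeight φ T a) (prodWeight φ T b) ^ 2 ≤
      22 / (Ks : ℝ) * ((K : ℝ) * Ks) ^ 2 := by
    have h1 : ∀ a ∈ Finset.Icc 1 K ×ˢ trigIndex Ks, ∑ b ∈ Finset.Icc 1 K ×ˢ trigIndex Ks,
        gridInner T (prodWeight φ T a) (prodWeight φ T b) ^ 2 ≤ K * 11 := by
      intro a _
      rw [Finset.sum_product]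
      refine (Finset.sum_le_sum fun l _ =>
        sum_gridInner_prodWeight_sq_le_trig hb hKs a l).trans_eq ?_
      simp
    refine (Finset.sum_le_sum h1).trans_eq ?_
    rw [Finset.sum_const, nsmul_eq_mul, hcard]
    field_simp
    ring
  have hmain := integral_average_linStat_sq_sub_sq_le h (show 0 < T by omega)
      (fun a ha => smoothWeight_prodWeight (T := T) hb ha)
      (show 0 < (K : ℝ) * Ks by positivity) hcard.le (by positivity) hself hsq
  simp_rw [gramTrace_eq]
  refine le_mseBound (by positivity) ?_ ?_ hmain
  · have h1 : 0 ≤ 1 / (K : ℝ) := by positivity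
    linarith
  · have h1 : 0 ≤ 1 / (K : ℝ) := by positivity
    rw [show (22 : ℝ) / Ks = 22 * (1 / Ks) by ring]
    linarith

/-- After division by `(K * Ks) ^ 2` the pairings saved by the regressors give order `1 / Ks` and
those saved by the basis functions order `1 / K`. This is where both numbers must tend to infinity.
-/
lemma integral_gramSq_le (h : WeaklyDependent P u) (hb : IsTrigBasis φ r m)
    (hK0 : 0 < K) (hK : 2 * K < T) (hKs0 : 0 < Ks) (hKs : 2 * Ks < T) :
    ∫ ω, gramSq φ T K Ks u ω ∂P ≤ mseBound P u T K Ks := by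
  have hK0' : (0 : ℝ) < K := Nat.cast_pos.2 hK0
  have hKs0' : (0 : ℝ) < Ks := Nat.cast_pos.2 hKs0
  have h1 := sum_integral_gram_sq_le (D := 11 * (K + Ks)) h (show 0 < T by omega)
    (B := Finset.Icc 1 K) (I := trigIndex Ks) (f := fun l i => prodWeight φ T (l, i))
    (fun l hl i hi => smoothWeight_prodWeight hb (Finset.mk_mem_product hl hi)) (s := 11)
    (fun l _ i _ l' _ => sum_gridInner_prodWeight_sq_le_trig hb hKs _ _)
    (fun l _ i _ => (sum_gridInner_prodWeight_sq_le_basis hb hK _ _).trans (by norm_num))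
  have e : ∫ ω, gramSq φ T K Ks u ω ∂P = (1 / ((K : ℝ) * Ks)) ^ 2 *
      ∑ i ∈ trigIndex Ks, ∑ j ∈ trigIndex Ks, ∫ ω, (∑ l ∈ Finset.Icc 1 K,
        linStat T (prodWeight φ T (l, i)) u ω * linStat T (prodWeight φ T (l, j)) u ω) ^ 2 ∂P := by
    unfold gramSq
    rw [integral_finsetSum _ fun i _ => integrable_finsetSum _ fun j _ =>
      (memLp_gram h φ T K Ks i j).integrable_sq, Finset.mul_sum]
    refine Finset.sum_congr rfl fun i _ => ?_
    rw [integral_finsetSum _ fun j _ => (memLp_gram h φ T K Ks i j).integrable_sq, Finset.mul_sum]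
    refine Finset.sum_congr rfl fun j _ => ?_
    simp only [gram, mul_pow]
    rw [integral_const_mul]
  have hcK : ((Finset.Icc 1 K).card : ℝ) = K := by simp
  have hcI : ((trigIndex Ks).card : ℝ) = 2 * Ks := by rw [card_trigIndex]; push_cast; ring
  rw [hcK, hcI] at h1
  rw [e]
  refine (mul_le_mul_of_nonneg_left h1 (sq_nonneg _)).trans ?_
  have e2 : (1 / ((K : ℝ) * Ks)) ^ 2 * (2 * autocovSum P u ^ 2 * 11 *
      (2 * ((K : ℝ) ^ 2 * (2 * Ks)) + (K : ℝ) * (2 * (Ks : ℝ)) ^ 2) +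
      (6 * covError P u T (11 * (K + Ks)) ^ 2 + cumError P u T) *
        ((K : ℝ) ^ 2 * (2 * (Ks : ℝ)) ^ 2)) =
      88 * autocovSum P u ^ 2 * (1 / K + 1 / Ks) + 24 * covError P u T (11 * (K + Ks)) ^ 2 +
    4 * cumError P u T := by
    field_simp
    ring
  rw [e2]
  unfold mseBound
  have := sq_nonneg (|autocovSum P u| * (1 / (K : ℝ) + 1 / Ks) +
    2 * covError P u T (11 * (K + Ks)))
  linarith

lemma integral_trigFourth_le (h : WeaklyDependent P u) (hKs0 : 0 < Ks) (hKs : 2 * Ks < T) :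
    ∫ ω, trigFourth T Ks u ω ∂P ≤ 2 / Ks * (6 * autocovSum P u ^ 2 +
      6 * covError P u T (11 * (K + Ks)) ^ 2 + cumError P u T) := by
  have hKs0' : (0 : ℝ) < Ks := Nat.cast_pos.2 hKs0
  have h1 := sum_integral_linStat_pow_four_le (D := 11 * (K + Ks)) h (show 0 < T by omega)
    (A := trigIndex Ks) (f := fun i => trig T i.1 i.2) (fun i hi => smoothWeight_trig hi) (s := 1)
    (fun i hi => by rw [gridInner_trigIndex hKs hi hi, if_pos rfl]; norm_num)
  have hcI : ((trigIndex Ks).card : ℝ) = 2 * Ks := by rw [card_trigIndex]; push_cast; ring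
  unfold trigFourth
  rw [integral_const_mul, integral_finsetSum]
  · refine (mul_le_mul_of_nonneg_left h1 (by positivity)).trans_eq ?_
    rw [hcI]
    field_simp
  · intro i _
    have := memLp_linStat h.stationary T (trig T i.1 i.2)
    exact (integrable_mul_four this this this this).congr (ae_of_all _ fun ω => by simp only; ring)

end Statistics

/-! ### Convergence in probability of these quantities -/

section Limits

variable {Ω : Type*} [MeasurableSpace Ω] {P : Measure Ω} {u : ℤ → Ω → ℝ}

/-- The growth conditions on the sample size and the numbers of basis functions. -/
structure GrowthCondition (T K Ks : ℕ → ℕ) : Prop where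
  sample : Tendsto T atTop atTop
  basis : Tendsto K atTop atTop
  draws : Tendsto Ks atTop atTop
  basis_div : Tendsto (fun n => (K n : ℝ) / T n) atTop (𝓝 0)
  draws_div : Tendsto (fun n => (Ks n : ℝ) / T n) atTop (𝓝 0)

variable {T K Ks : ℕ → ℕ}

lemma eventually_two_mul_lt (hT : Tendsto T atTop atTop)
    (h : Tendsto (fun n => (K n : ℝ) / T n) atTop (𝓝 0)) : ∀ᶠ n in atTop, 2 * K n < T n := by
  filter_upwards [h.eventually (gt_mem_nhds (show (0 : ℝ) < 1 / 2 by norm_num)),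
    hT.eventually_gt_atTop 0] with n h1 h2
  rw [div_lt_iff₀ (Nat.cast_pos.2 h2)] at h1
  have : (2 * K n : ℝ) < T n := by linarith
  exact_mod_cast this

lemma tendsto_cumError (hT : Tendsto T atTop atTop) :
    Tendsto (fun n => cumError P u (T n)) atTop (𝓝 0) :=
  tendsto_const_nhds.div_atTop (tendsto_natCast_atTop_atTop.comp hT)

lemma tendsto_covError (hT : Tendsto T atTop atTop) {D : ℕ → ℝ}
    (hD : Tendsto (fun n => D n / T n) atTop (𝓝 0)) :
    Tendsto (fun n => covError P u (T n) (D n)) atTop (𝓝 0) := by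
  have h1 : Tendsto (fun n => 9 / (T n : ℝ)) atTop (𝓝 0) :=
    tendsto_const_nhds.div_atTop (tendsto_natCast_atTop_atTop.comp hT)
  have h2 := ((h1.add (hD.const_mul 3)).mul_const (∑' h : ℤ, |(h : ℝ)| * |autocov P u h|))
  simp only [mul_zero, add_zero, zero_mul] at h2
  refine h2.congr fun n => ?_
  unfold covError
  ring

lemma GrowthCondition.tendsto_covError (h : GrowthCondition T K Ks) :
    Tendsto (fun n => covError P u (T n) (11 * (K n + Ks n))) atTop (𝓝 0) := by
  refine SHARWB.tendsto_covError h.sample ?_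
  have := (h.basis_div.add h.draws_div).const_mul 11
  simp only [add_zero, mul_zero] at this
  refine this.congr fun n => ?_
  ring

lemma GrowthCondition.tendsto_mseBound (h : GrowthCondition T K Ks) :
    Tendsto (fun n => mseBound P u (T n) (K n) (Ks n)) atTop (𝓝 0) := by
  have h1 : Tendsto (fun n => 1 / (K n : ℝ)) atTop (𝓝 0) :=
    tendsto_const_nhds.div_atTop (tendsto_natCast_atTop_atTop.comp h.basis)
  have h2 : Tendsto (fun n => 1 / (Ks n : ℝ)) atTop (𝓝 0) :=
    tendsto_const_nhds.div_atTop (tendsto_natCast_atTop_atTop.comp h.draws)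
  have h3 := h.tendsto_covError (P := P) (u := u)
  have h4 := tendsto_cumError (P := P) (u := u) h.sample
  have := ((((((h1.add h2).const_mul |autocovSum P u|).add (h3.const_mul 2)).pow 2).add
    ((h1.add h2).const_mul (88 * autocovSum P u ^ 2))).add ((h3.pow 2).const_mul 24)).add
    (h4.const_mul 4)
  simpa [mseBound] using this

lemma GrowthCondition.eventually (h : GrowthCondition T K Ks) :
    ∀ᶠ n in atTop, 0 < K n ∧ 2 * K n < T n ∧ 0 < Ks n ∧ 2 * Ks n < T n := by
  filter_upwards [h.basis.eventually_gt_atTop 0, h.draws.eventually_gt_atTop 0,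
    eventually_two_mul_lt h.sample h.basis_div, eventually_two_mul_lt h.sample h.draws_div] with
    n h1 h2 h3 h4 using ⟨h1, h3, h2, h4⟩

lemma memLp_two_linStat_sq (h : WeaklyDependent P u) (T : ℕ) (f : ℕ → ℝ) :
    MemLp (fun ω => linStat T f u ω ^ 2) 2 P := by
  simpa only [sq] using memLp_two_mul (memLp_linStat h.stationary T f)
    (memLp_linStat h.stationary T f)

variable [IsProbabilityMeasure P] {φ : ℕ → ℝ → ℝ} {r : ℕ → Fin 2} {m : ℕ → ℕ}

lemma tendsto_projMean (h : WeaklyDependent P u) (hb : IsTrigBasis φ r m)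
    (hg : GrowthCondition T K Ks) {δ : ℝ} (hδ : 0 < δ) :
    Tendsto (fun n => P.real {ω | δ ≤ |projMean φ (T n) (K n) u ω - autocovSum P u|})
      atTop (𝓝 0) := by
  refine tendsto_measureReal_le_abs_sub_of_integral_sq (fun n => ?_) ?_
    (hg.tendsto_mseBound (P := P) (u := u)) hδ
  · exact (memLp_finsetSum _ fun l _ => memLp_two_linStat_sq h _ _).const_mul _
  · filter_upwards [hg.eventually] with n hn
    exact integral_projMean_sub_sq_le h hb hn.1 hn.2.1

lemma tendsto_trigMean (h : WeaklyDependent P u) (hg : GrowthCondition T K Ks) {δ : ℝ}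
    (hδ : 0 < δ) :
    Tendsto (fun n => P.real {ω | δ ≤ |trigMean (T n) (Ks n) u ω - autocovSum P u|})
      atTop (𝓝 0) := by
  refine tendsto_measureReal_le_abs_sub_of_integral_sq (fun n => ?_) ?_
    (hg.tendsto_mseBound (P := P) (u := u)) hδ
  · exact (memLp_finsetSum _ fun l _ => memLp_two_linStat_sq h _ _).const_mul _
  · filter_upwards [hg.eventually] with n hn
    exact integral_trigMean_sub_sq_le h hn.2.2.1 hn.2.2.2

lemma tendsto_gramTrace (h : WeaklyDependent P u) (hb : IsTrigBasis φ r m)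
    (hg : GrowthCondition T K Ks) {δ : ℝ} (hδ : 0 < δ) :
    Tendsto (fun n => P.real {ω | δ ≤ |gramTrace φ (T n) (K n) (Ks n) u ω - autocovSum P u|})
      atTop (𝓝 0) := by
  refine tendsto_measureReal_le_abs_sub_of_integral_sq (fun n => ?_) ?_
    (hg.tendsto_mseBound (P := P) (u := u)) hδ
  · exact memLp_finsetSum _ fun i _ => memLp_gram h φ _ _ _ i i
  · filter_upwards [hg.eventually] with n hn
    exact integral_gramTrace_sub_sq_le h hb hn.1 hn.2.1 hn.2.2.1 hn.2.2.2

lemma tendsto_gramSq (h : WeaklyDependent P u) (hb : IsTrigBasis φ r m)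
    (hg : GrowthCondition T K Ks) {δ : ℝ} (hδ : 0 < δ) :
    Tendsto (fun n => P.real {ω | δ ≤ gramSq φ (T n) (K n) (Ks n) u ω}) atTop (𝓝 0) := by
  refine tendsto_measureReal_le_of_integral_tendsto_zero
    (fun n ω => Finset.sum_nonneg fun _ _ => Finset.sum_nonneg fun _ _ => sq_nonneg _)
    (fun n => ?_) ?_ (hg.tendsto_mseBound (P := P) (u := u)) hδ
  · exact integrable_finsetSum _ fun i _ => integrable_finsetSum _ fun j _ =>
      (memLp_gram h φ _ _ _ i j).integrable_sq
  · filter_upwards [hg.eventually] with n hn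
    exact integral_gramSq_le h hb hn.1 hn.2.1 hn.2.2.1 hn.2.2.2

lemma tendsto_trigFourth (h : WeaklyDependent P u) (hg : GrowthCondition T K Ks) {δ : ℝ}
    (hδ : 0 < δ) :
    Tendsto (fun n => P.real {ω | δ ≤ trigFourth (T n) (Ks n) u ω}) atTop (𝓝 0) := by
  have hlim : Tendsto (fun n => 2 / (Ks n : ℝ) * (6 * autocovSum P u ^ 2 +
      6 * covError P u (T n) (11 * (K n + Ks n)) ^ 2 + cumError P u (T n))) atTop (𝓝 0) := by
    have h2 : Tendsto (fun n => 2 / (Ks n : ℝ)) atTop (𝓝 0) :=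
      tendsto_const_nhds.div_atTop (tendsto_natCast_atTop_atTop.comp hg.draws)
    have := h2.mul (((tendsto_const_nhds (x := 6 * autocovSum P u ^ 2)).add
      (((hg.tendsto_covError (P := P) (u := u)).pow 2).const_mul 6)).add
        (tendsto_cumError (P := P) (u := u) hg.sample))
    simpa using this
  refine tendsto_measureReal_le_of_integral_tendsto_zero (fun n ω => ?_) (fun n => ?_) ?_ hlim hδ
  · exact mul_nonneg (by positivity) (Finset.sum_nonneg fun _ _ => by positivity)
  · refine (integrable_finsetSum _ fun i _ => ?_).const_mul _
    have := memLp_linStat h.stationary (T n) (trig (T n) i.1 i.2)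
    exact (integrable_mul_four this this this this).congr (ae_of_all _ fun ω => by simp only; ring)
  · filter_upwards [hg.eventually] with n hn
    exact integral_trigFourth_le h hn.2.2.1 hn.2.2.2

lemma covForm_one_eq_variance (h : WeaklyDependent P u) (T : ℕ) :
    covForm T (autocov P u) (fun _ => 1) (fun _ => 1) =
      ∫ ω, linStat T (fun _ => 1) u ω ^ 2 ∂P := by
  rw [← integral_linStat_mul h.stationary]
  simp only [sq]

lemma integral_linStat (h : WeaklyDependent P u) (T : ℕ) (f : ℕ → ℝ) :
    ∫ ω, linStat T f u ω ∂P = 0 := by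
  unfold linStat
  rw [integral_const_mul, integral_finsetSum]
  · simp [integral_const_mul, h.mean_zero]
  · exact fun t _ => (((h.stationary.memLp t).integrable (by norm_num)).const_mul _)

/-- A constant weight has Lipschitz constant zero and unit norm, so the covariance approximation
identifies the limit; uniqueness of limits then equates the long-run variance with the sum of
autocovariances. -/
lemma tendsto_integral_linStat_one_sq (h : WeaklyDependent P u) :
    Tendsto (fun T => ∫ ω, linStat T (fun _ => 1) u ω ^ 2 ∂P) atTop (𝓝 (autocovSum P u)) := by
  have h0 := tendsto_covError (P := P) (u := u) (T := id) (D := fun _ => 0) tendsto_id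
    (by simp)
  rw [tendsto_iff_norm_sub_tendsto_zero]
  refine squeeze_zero' (Eventually.of_forall fun _ => norm_nonneg _) ?_ h0
  filter_upwards [eventually_gt_atTop 0] with n hn
  have hn' : (n : ℝ) ≠ 0 := by positivity
  have hw : SmoothWeight n 0 (fun _ => 1) := ⟨by simp, by simp⟩
  have := abs_covForm_sub_le_covError h hn hw hw
  rw [covForm_one_eq_variance h] at this
  have hone : gridInner n (fun _ => 1) (fun _ => 1) = 1 := by
    simp [gridInner, hn']
  rw [hone, mul_one] at this
  exact this

lemma IsLongRunVariance.autocovSum_eq {L : ℝ} (hL : IsLongRunVariance P u L)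
    (h : WeaklyDependent P u) : autocovSum P u = L := by
  refine tendsto_nhds_unique (tendsto_integral_linStat_one_sq h) (hL.congr fun T => ?_)
  have e : (fun ω => (1 / √(T : ℝ)) * ∑ t ∈ Finset.Icc 1 T, u (t : ℤ) ω) =
      linStat T (fun _ => 1) u := by
    ext ω; simp [linStat]
  rw [e, variance_of_integral_eq_zero (memLp_linStat h.stationary _ _).aemeasurable
    (integral_linStat h _ _)]

end Limits

end SHARWB

/-! ### Algebraic form of the statistic and of its bootstrap version -/

namespace SHARWB

section Identities

variable {φ : ℕ → ℝ → ℝ} {r : ℕ → Fin 2} {m : ℕ → ℕ} {T K Ks : ℕ}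

lemma sampleMean_const_add (hT : 0 < T) (c : ℝ) (x : ℕ → ℝ) :
    sampleMean T (fun t => c + x t) = c + sampleMean T x := by
  have hT' : (T : ℝ) ≠ 0 := by positivity
  simp only [sampleMean, Finset.sum_add_distrib, Finset.sum_const, Nat.card_Icc, nsmul_eq_mul,
    Nat.add_sub_cancel]
  field_simp

lemma resid_const_add (hT : 0 < T) (c : ℝ) (x : ℕ → ℝ) :
    resid T (fun t => c + x t) = resid T x := by
  ext t
  rw [resid, resid, sampleMean_const_add hT]
  ring

lemma sum_mul_resid_of_sum_eq_zero {f : ℕ → ℝ} (hf : ∑ t ∈ Finset.Icc 1 T, f t = 0)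
    (y : ℕ → ℝ) :
    ∑ t ∈ Finset.Icc 1 T, f t * resid T y t = ∑ t ∈ Finset.Icc 1 T, f t * y t := by
  simp only [resid, mul_sub, Finset.sum_sub_distrib, ← Finset.sum_mul, hf, zero_mul, sub_zero]

lemma projCoeff_eq (hb : IsTrigBasis φ r m) (hK : 2 * K < T) {l : ℕ} (hl : l ∈ Finset.Icc 1 K)
    (y : ℕ → ℝ) : projCoeff φ T y l =
      1 / √(T : ℝ) * ∑ t ∈ Finset.Icc 1 T, gridBasis φ T l t * y t := by
  rw [projCoeff, ← sum_mul_resid_of_sum_eq_zero (sum_gridBasis hb hK hl)]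
  rfl

/-- The basis functions sum to zero over the grid, which removes both the level and the centering at
the sample mean. -/
lemma seriesLRV_const_add (hb : IsTrigBasis φ r m) (hK : 2 * K < T) (c : ℝ) (x : ℕ → ℝ) :
    seriesLRV φ T K (fun t => c + x t) =
      1 / (K : ℝ) * ∑ l ∈ Finset.Icc 1 K,
        (1 / √(T : ℝ) * ∑ t ∈ Finset.Icc 1 T, gridBasis φ T l t * x t) ^ 2 := by
  rw [seriesLRV]
  congr 1
  refine Finset.sum_congr rfl fun l hl => ?_
  rw [projCoeff_eq hb hK hl]
  simp only [mul_add, Finset.sum_add_distrib, ← Finset.sum_mul, sum_gridBasis hb hK hl, zero_mul,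
    zero_add]

lemma eta_eq (T Ks : ℕ) (v : Fin 2 → ℕ → ℝ) (t : ℕ) :
    eta T Ks v t = 1 / √(Ks : ℝ) * ∑ i ∈ trigIndex Ks, trig T i.1 i.2 t * v i.1 i.2 := by
  rw [eta, sum_trigIndex]
  simp [trig]

lemma sum_mul_resid_mul_eta (f x : ℕ → ℝ) (v : Fin 2 → ℕ → ℝ) :
    ∑ t ∈ Finset.Icc 1 T, f t * (resid T x t * eta T Ks v t) =
      1 / √(Ks : ℝ) * ∑ i ∈ trigIndex Ks,
        v i.1 i.2 * ∑ t ∈ Finset.Icc 1 T, f t * trig T i.1 i.2 t * resid T x t := by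
  simp only [eta_eq, Finset.mul_sum]
  rw [Finset.sum_comm]
  exact Finset.sum_congr rfl fun i _ => Finset.sum_congr rfl fun t _ => by ring

lemma sum_trig_mul_resid (hKs : 2 * Ks < T) {i : Fin 2 × ℕ} (hi : i ∈ trigIndex Ks) (x : ℕ → ℝ) :
    ∑ t ∈ Finset.Icc 1 T, trig T i.1 i.2 t * resid T x t =
      ∑ t ∈ Finset.Icc 1 T, trig T i.1 i.2 t * x t := by
  simp only [trigIndex, Finset.mem_product, Finset.mem_univ, true_and, Finset.mem_Icc] at hi
  exact sum_mul_resid_of_sum_eq_zero (sum_trig _ (by omega) (by omega)) x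

/-- Centering is self-adjoint. A product of a basis function and a regressor need not sum to zero,
so here the centering does not vanish but passes from the data to the weight. -/
lemma sum_mul_trig_mul_resid (l : ℕ) (i : Fin 2 × ℕ) (x : ℕ → ℝ) :
    ∑ t ∈ Finset.Icc 1 T, gridBasis φ T l t * trig T i.1 i.2 t * resid T x t =
      ∑ t ∈ Finset.Icc 1 T, prodWeight φ T (l, i) t * x t := by
  simp only [resid, prodWeight, mul_sub, sub_mul, Finset.sum_sub_distrib, ← Finset.sum_mul,
    ← Finset.mul_sum]
  simp only [gridInner, sampleMean]
  ring

/-- The sample mean of the resampled residuals is a linear form in the external draws. -/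
lemma sampleMean_resid_mul_eta (hKs : 2 * Ks < T) (c : ℝ) (x : ℕ → ℝ) (v : Fin 2 → ℕ → ℝ) :
    sampleMean T (fun t => c + resid T x t * eta T Ks v t) =
      c + (1 / √(Ks : ℝ) * ∑ i ∈ trigIndex Ks, (1 / √(T : ℝ) *
        ∑ t ∈ Finset.Icc 1 T, trig T i.1 i.2 t * x t) * v i.1 i.2) / √(T : ℝ) := by
  have hT' : (0 : ℝ) < T := Nat.cast_pos.2 (by omega)
  rw [sampleMean_const_add (by omega), sampleMean]
  congr 1
  have h1 := sum_mul_resid_mul_eta (T := T) (Ks := Ks) (fun _ => 1) x v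
  simp only [one_mul] at h1
  rw [h1, Finset.sum_congr rfl fun i hi => by rw [sum_trig_mul_resid hKs hi]]
  have h2 : (T : ℝ) = √(T : ℝ) * √(T : ℝ) := (Real.mul_self_sqrt hT'.le).symm
  have h3 : √(T : ℝ) ≠ 0 := (Real.sqrt_pos.2 hT').ne'
  conv_lhs => rw [h2]
  rw [← div_div, mul_div_assoc, Finset.sum_div]
  congr 2
  refine Finset.sum_congr rfl fun i _ => ?_
  ring

/-- The long-run variance estimator of the resampled residuals is a quadratic form in the external
draws. -/
lemma seriesLRV_resid_mul_eta (hb : IsTrigBasis φ r m) (hK : 2 * K < T) (c : ℝ) (x : ℕ → ℝ)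
    (v : Fin 2 → ℕ → ℝ) :
    seriesLRV φ T K (fun t => c + resid T x t * eta T Ks v t) =
      ∑ i ∈ trigIndex Ks, ∑ j ∈ trigIndex Ks, (1 / ((K : ℝ) * Ks) * ∑ l ∈ Finset.Icc 1 K,
        (1 / √(T : ℝ) * ∑ t ∈ Finset.Icc 1 T, prodWeight φ T (l, i) t * x t) *
        (1 / √(T : ℝ) * ∑ t ∈ Finset.Icc 1 T, prodWeight φ T (l, j) t * x t)) *
          (v i.1 i.2 * v j.1 j.2) := by
  rw [seriesLRV_const_add hb hK]
  have h1 : ∀ l, (1 / √(T : ℝ) * ∑ t ∈ Finset.Icc 1 T,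
      gridBasis φ T l t * (resid T x t * eta T Ks v t)) ^ 2 =
      1 / (Ks : ℝ) * ∑ i ∈ trigIndex Ks, ∑ j ∈ trigIndex Ks,
        (1 / √(T : ℝ) * ∑ t ∈ Finset.Icc 1 T, prodWeight φ T (l, i) t * x t) *
        (1 / √(T : ℝ) * ∑ t ∈ Finset.Icc 1 T, prodWeight φ T (l, j) t * x t) *
          (v i.1 i.2 * v j.1 j.2) := by
    intro l
    have h2 : (1 / (Ks : ℝ)) = (1 / √(Ks : ℝ)) ^ 2 := by
      rw [div_pow, one_pow, Real.sq_sqrt (Nat.cast_nonneg _)]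
    have h3 : ∑ i ∈ trigIndex Ks, ∑ j ∈ trigIndex Ks,
        (1 / √(T : ℝ) * ∑ t ∈ Finset.Icc 1 T, prodWeight φ T (l, i) t * x t) *
        (1 / √(T : ℝ) * ∑ t ∈ Finset.Icc 1 T, prodWeight φ T (l, j) t * x t) *
          (v i.1 i.2 * v j.1 j.2) = (1 / √(T : ℝ) * ∑ i ∈ trigIndex Ks, v i.1 i.2 *
            ∑ t ∈ Finset.Icc 1 T, prodWeight φ T (l, i) t * x t) ^ 2 := by
      rw [Finset.mul_sum, sq, Finset.sum_mul_sum]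
      exact Finset.sum_congr rfl fun i _ => Finset.sum_congr rfl fun j _ => by ring
    rw [h3, sum_mul_resid_mul_eta, h2, Finset.sum_congr rfl fun i _ => by
      rw [sum_mul_trig_mul_resid]]
    ring
  simp_rw [h1]
  rw [← Finset.mul_sum, Finset.sum_comm, ← mul_assoc, one_div_mul_one_div, Finset.mul_sum]
  refine Finset.sum_congr rfl fun i _ => ?_
  rw [Finset.sum_comm, Finset.mul_sum]
  refine Finset.sum_congr rfl fun j _ => ?_
  rw [← Finset.sum_mul, mul_assoc]

end Identities

/-! ### Studentization with arbitrary relative sample sizes -/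

section Studentized

/-- The weight of the `j`-th sample in the studentized difference. -/
noncomputable def stdWeight (L : Fin 2 → ℝ) (T : Fin 2 → ℕ) (j : Fin 2) : ℝ :=
  1 / √(T j : ℝ) / √(L 0 / T 0 + L 1 / T 1)

variable {L : Fin 2 → ℝ} {T : Fin 2 → ℕ}

lemma stdWeight_sq (hL : ∀ j, 0 < L j) (j : Fin 2) :
    stdWeight L T j ^ 2 = 1 / T j / (L 0 / T 0 + L 1 / T 1) := by
  have h0 := (hL 0).le
  have h1 := (hL 1).le
  rw [stdWeight, div_pow, div_pow, one_pow, Real.sq_sqrt (Nat.cast_nonneg _),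
    Real.sq_sqrt (by positivity)]

lemma sum_stdWeight_sq (hL : ∀ j, 0 < L j) (hT : ∀ j, 0 < T j) :
    L 0 * stdWeight L T 0 ^ 2 + L 1 * stdWeight L T 1 ^ 2 = 1 := by
  have h0 : (0 : ℝ) < T 0 := Nat.cast_pos.2 (hT 0)
  have h1 : (0 : ℝ) < T 1 := Nat.cast_pos.2 (hT 1)
  have l0 := hL 0
  have l1 := hL 1
  rw [stdWeight_sq hL, stdWeight_sq hL]
  field_simp

lemma stdWeight_sq_le (hL : ∀ j, 0 < L j) (hT : ∀ j, 0 < T j) (j : Fin 2) :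
    stdWeight L T j ^ 2 ≤ 1 / L j := by
  rw [le_div_iff₀ (hL j), ← sum_stdWeight_sq hL hT]
  have h0 := mul_nonneg (hL 0).le (sq_nonneg (stdWeight L T 0))
  have h1 := mul_nonneg (hL 1).le (sq_nonneg (stdWeight L T 1))
  fin_cases j <;> simp only [Fin.zero_eta, Fin.mk_one] <;> nlinarith

/-- Numerator and denominator are divided by the standard deviation computed from the true long-run
variances. The new denominator is then close to one whenever `D` is close to `L`. -/
lemma studentized_eq (hL : ∀ j, 0 < L j) (hT : ∀ j, 0 < T j) (N D : Fin 2 → ℝ) :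
    (N 0 / √(T 0 : ℝ) - N 1 / √(T 1 : ℝ)) / √(D 0 / T 0 + D 1 / T 1) =
      (stdWeight L T 0 * N 0 - stdWeight L T 1 * N 1) /
        √(D 0 * stdWeight L T 0 ^ 2 + D 1 * stdWeight L T 1 ^ 2) := by
  have h0 : (0 : ℝ) < T 0 := Nat.cast_pos.2 (hT 0)
  have h1 : (0 : ℝ) < T 1 := Nat.cast_pos.2 (hT 1)
  have l0 := hL 0
  have l1 := hL 1
  set V := L 0 / T 0 + L 1 / T 1 with hV
  have hVp : 0 < V := by positivity
  have hs : 0 < √V := Real.sqrt_pos.2 hVp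
  rw [stdWeight_sq hL, stdWeight_sq hL, ← hV,
    show D 0 * (1 / (T 0 : ℝ) / V) + D 1 * (1 / (T 1 : ℝ) / V) = (D 0 / T 0 + D 1 / T 1) / V by ring,
    Real.sqrt_div' _ hVp.le, stdWeight, stdWeight, ← hV,
    show 1 / √(T 0 : ℝ) / √V * N 0 - 1 / √(T 1 : ℝ) / √V * N 1 =
      (N 0 / √(T 0 : ℝ) - N 1 / √(T 1 : ℝ)) / √V by ring, div_div_div_cancel_right₀ hs.ne']

variable {S : Type*} [MeasurableSpace S] {Q : Measure S} [IsProbabilityMeasure Q]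

/-- A two-sample statistic is asymptotically standard normal, uniformly over the real line, when its
numerator is asymptotically normal and the variance estimators are consistent. -/
lemma eventually_forall_abs_twoSample_sub_le {T : ℕ → Fin 2 → ℕ} (hL : ∀ j, 0 < L j)
    (hT : ∀ᶠ n in atTop, ∀ j, 0 < T n j) {N D : ℕ → Fin 2 → S → ℝ}
    (hN : ∀ n j, Measurable (N n j))
    (hclt : ∀ x, Tendsto (fun n => charFun (Q.map fun s =>
      stdWeight L (T n) 0 * N n 0 s - stdWeight L (T n) 1 * N n 1 s) x) atTop
      (𝓝 (charFun (gaussianReal 0 1) x)))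
    (hD : ∀ j, ∀ δ > 0, Tendsto (fun n => Q.real {s | δ ≤ |D n j s - L j|}) atTop (𝓝 0))
    {t : ℕ → S → ℝ}
    (ht : ∀ᶠ n in atTop, ∀ s, t n s = (N n 0 s / √(T n 0 : ℝ) - N n 1 s / √(T n 1 : ℝ)) /
      √(D n 0 s / T n 0 + D n 1 s / T n 1)) {ε : ℝ} (hε : 0 < ε) :
    ∀ᶠ n in atTop, ∀ x, |Q.real {s | t n s < x} - stdNormalCDF x| ≤ ε := by
  refine eventually_forall_abs_studentized_sub_le
    (U := fun n s => stdWeight L (T n) 0 * N n 0 s - stdWeight L (T n) 1 * N n 1 s)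
    (R := fun n s => D n 0 s * stdWeight L (T n) 0 ^ 2 + D n 1 s * stdWeight L (T n) 1 ^ 2)
    (fun n => ((hN n 0).const_mul _).sub ((hN n 1).const_mul _)) hclt (fun δ hδ => ?_) ?_ hε
  · have h0 := hD 0 (δ / 2 * L 0) (mul_pos (by positivity) (hL 0))
    have h1 := hD 1 (δ / 2 * L 1) (mul_pos (by positivity) (hL 1))
    have h01 := h0.add h1
    rw [add_zero] at h01
    refine squeeze_zero' (Eventually.of_forall fun _ => measureReal_nonneg) ?_ h01
    filter_upwards [hT] with n hn
    refine (measureReal_mono fun s hs => ?_).trans (measureReal_union_le _ _)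
    by_contra hcon
    simp only [Set.mem_union, Set.mem_ofPred_eq, not_or, not_le] at hcon hs
    refine absurd hs (not_lt.2 ?_)
    have e : D n 0 s * stdWeight L (T n) 0 ^ 2 + D n 1 s * stdWeight L (T n) 1 ^ 2 - 1 =
        (D n 0 s - L 0) * stdWeight L (T n) 0 ^ 2 + (D n 1 s - L 1) * stdWeight L (T n) 1 ^ 2 := by
      rw [← sum_stdWeight_sq hL hn]; ring
    have hj : ∀ j, |D n j s - L j| < δ / 2 * L j →
        |(D n j s - L j) * stdWeight L (T n) j ^ 2| ≤ δ / 2 := by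
      intro j h
      rw [abs_mul, abs_of_nonneg (sq_nonneg (stdWeight L (T n) j))]
      calc _ ≤ δ / 2 * L j * (1 / L j) := by
            have := (hL j).le
            gcongr
            exact stdWeight_sq_le hL hn j
        _ = δ / 2 := by have := (hL j).ne'; field_simp
    rw [e]
    refine (abs_add_le _ _).trans ?_
    linarith [hj 0 hcon.1, hj 1 hcon.2]
  · filter_upwards [hT, ht] with n hn h s
    rw [h s]
    exact studentized_eq hL hn (fun j => N n j s) (fun j => D n j s)

end Studentized

end SHARWB

/-! ### Asymptotic normality of the null statistic -/

namespace SHARWB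

section Sampling

variable {Ω : Type*} [MeasurableSpace Ω] {P : Measure Ω}

lemma measurable_linStat {u : ℤ → Ω → ℝ} (hu : ∀ t, Measurable (u t)) (T : ℕ) (f : ℕ → ℝ) :
    Measurable (linStat T f u) := by
  unfold linStat
  have := fun t : ℕ => hu t
  fun_prop

variable [IsProbabilityMeasure P]

/-- The functional limit theorem is stated for real test functionals, so real and imaginary parts
are treated separately. -/
lemma charFun_map_eq_cos_add_sin {X : Ω → ℝ} (hX : AEMeasurable X P) (x : ℝ) :
    charFun (P.map X) x =
      ((∫ ω, Real.cos (x * X ω) ∂P : ℝ) : ℂ) + ((∫ ω, Real.sin (x * X ω) ∂P : ℝ) : ℂ) *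
        Complex.I := by
  have hc : Integrable (fun ω => ((Real.cos (x * X ω) : ℝ) : ℂ)) P := by
    refine Integrable.of_bound (by fun_prop) 1 (ae_of_all _ fun ω => ?_)
    rw [Complex.norm_real]
    exact Real.abs_cos_le_one _
  have hs : Integrable (fun ω => ((Real.sin (x * X ω) : ℝ) : ℂ) * Complex.I) P := by
    refine Integrable.of_bound (by fun_prop) 1 (ae_of_all _ fun ω => ?_)
    rw [norm_mul, Complex.norm_I, mul_one, Complex.norm_real]
    exact Real.abs_sin_le_one _
  rw [charFun_apply_real, integral_map hX (by fun_prop), ← integral_complex_ofReal,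
    ← integral_complex_ofReal, ← integral_mul_const, ← integral_add hc hs]
  refine integral_congr_ae (ae_of_all _ fun ω => ?_)
  simp only
  rw [← Complex.ofReal_mul, Complex.exp_mul_I]
  simp

/-- The normalized sum over the whole sample is asymptotically normal. -/
lemma tendsto_charFun_linStat_of_functionalCLT {u : Fin 2 → ℤ → Ω → ℝ} {L : Fin 2 → ℝ}
    (hu : ∀ j t, Measurable (u j t)) (hL : ∀ j, 0 < L j) (h : FunctionalCLT P u L) (j : Fin 2)
    (x : ℝ) : Tendsto (fun T => charFun (P.map (linStat T (fun _ => 1) (u j))) x) atTop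
      (𝓝 (Complex.exp (-(L j * x ^ 2) / 2))) := by
  obtain ⟨S, _, Q, W, hQ, hW, -, hF⟩ := h
  have hpath : ∀ T ω, partialSumPath u T ω 1 j = linStat T (fun _ => 1) (u j) ω := by
    intro T ω
    simp [partialSumPath, linStat]
  -- Evaluation at time one is continuous for uniform convergence, so cosines and sines of the
  -- endpoint are admissible bounded test functionals.
  have heval : Continuous fun f : UniformFun unitInterval (Fin 2 → ℝ) =>
      UniformFun.toFun f 1 j :=
    (continuous_apply j).comp (UniformFun.uniformContinuous_eval (Fin 2 → ℝ) 1).continuous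
  have hc := hF (BoundedContinuousFunction.ofNormedAddCommGroup
    (fun f => Real.cos (x * UniformFun.toFun f 1 j)) (by fun_prop) 1
    fun f => Real.abs_cos_le_one _)
  have hs := hF (BoundedContinuousFunction.ofNormedAddCommGroup
    (fun f => Real.sin (x * UniformFun.toFun f 1 j)) (by fun_prop) 1
    fun f => Real.abs_sin_le_one _)
  simp only [BoundedContinuousFunction.coe_ofNormedAddCommGroup, UniformFun.toFun_ofFun,
    hpath] at hc hs
  have hlaw := (hW j).hasLaw_eval 1
  have hlim : charFun (Q.map fun s => √(L j) * W j 1 s) x = Complex.exp (-(L j * x ^ 2) / 2) := by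
    rw [charFun_map_mul_comp hlaw.aemeasurable, hlaw.map_eq, charFun_gaussianReal]
    congr 1
    have : ((√(L j) : ℝ) : ℂ) ^ 2 = (L j : ℂ) := by
      rw [← Complex.ofReal_pow, Real.sq_sqrt (hL j).le]
    push_cast
    rw [mul_pow, this]
    simp
    ring
  rw [← hlim, charFun_map_eq_cos_add_sin (hlaw.aemeasurable.const_mul _)]
  simp_rw [fun T => charFun_map_eq_cos_add_sin
    (measurable_linStat (hu j) T fun _ => 1).aemeasurable (P := P) x]
  have h1 : Real.toNNReal ((1 : unitInterval) : ℝ) = 1 := by simp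
  rw [h1] at hc hs
  exact ((Complex.continuous_ofReal.tendsto _).comp hc).add
    (((Complex.continuous_ofReal.tendsto _).comp hs).mul_const _)

/-- From `|exp(iθ) - 1| ≤ |θ|` and `|X| ≤ 1 + X²`. Bounded second moments thus make a family of
characteristic functions equi-Lipschitz. -/
lemma norm_charFun_map_sub_le {X : Ω → ℝ} (hX : Measurable X) (hX2 : MemLp X 2 P) (x y : ℝ) :
    ‖charFun (P.map X) x - charFun (P.map X) y‖ ≤ (1 + ∫ ω, X ω ^ 2 ∂P) * |x - y| := by
  have hi : ∀ z : ℝ, Integrable (fun ω => Complex.exp ((z * X ω : ℝ) * Complex.I)) P := by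
    intro z
    refine Integrable.of_bound (by fun_prop) 1 (ae_of_all _ fun s => ?_)
    rw [Complex.norm_exp_ofReal_mul_I]
  have hcf : ∀ z : ℝ, charFun (P.map X) z = ∫ ω, Complex.exp ((z * X ω : ℝ) * Complex.I) ∂P := by
    intro z
    rw [charFun_apply_real, integral_map hX.aemeasurable (by fun_prop)]
    simp
  have hb : Integrable (fun ω => (1 + X ω ^ 2) * |x - y|) P :=
    ((integrable_const _).add hX2.integrable_sq).mul_const _
  rw [hcf, hcf, ← integral_sub (hi x) (hi y)]
  refine (norm_integral_le_of_norm_le hb (ae_of_all _ fun ω => ?_)).trans_eq ?_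
  · have e : Complex.exp ((x * X ω : ℝ) * Complex.I) - Complex.exp ((y * X ω : ℝ) * Complex.I) =
        Complex.exp ((y * X ω : ℝ) * Complex.I) *
          (Complex.exp (Complex.I * (((x - y) * X ω : ℝ) : ℂ)) - 1) := by
      rw [mul_sub, ← Complex.exp_add, mul_one]
      congr 2
      push_cast
      ring
    rw [e, norm_mul, Complex.norm_exp_ofReal_mul_I, one_mul]
    refine Real.norm_exp_I_mul_ofReal_sub_one_le.trans ?_
    rw [Real.norm_eq_abs, abs_mul, mul_comm]
    gcongr
    nlinarith [sq_nonneg (|X ω| - 1), sq_abs (X ω)]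
  · rw [integral_mul_const, integral_add (integrable_const _) hX2.integrable_sq]
    simp

/-- Pointwise convergence of equi-Lipschitz functions is uniform along bounded sequences. -/
lemma tendsto_sub_of_lipschitz_of_bounded {f : ℕ → ℝ → ℂ} {g : ℝ → ℂ} (hg : Continuous g)
    (hf : ∀ x, Tendsto (fun n => f n x) atTop (𝓝 (g x))) {B : ℝ}
    (hB : ∀ n x y, ‖f n x - f n y‖ ≤ B * |x - y|) {x : ℕ → ℝ} {M : ℝ} (hx : ∀ n, |x n| ≤ M) :
    Tendsto (fun n => f n (x n) - g (x n)) atTop (𝓝 0) := by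
  refine tendsto_of_subseq_tendsto fun ns hns => ?_
  obtain ⟨a, -, ms, hms, ha⟩ := (isCompact_Icc (a := -M) (b := M)).tendsto_subseq
    (x := fun k => x (ns k)) fun k => abs_le.1 (hx (ns k))
  refine ⟨ms, ?_⟩
  have hsub : Tendsto (fun k => ns (ms k)) atTop atTop := hns.comp hms.tendsto_atTop
  have h1 : Tendsto (fun k => f (ns (ms k)) (x (ns (ms k))) - f (ns (ms k)) a) atTop (𝓝 0) := by
    have h0 : Tendsto (fun k => B * |x (ns (ms k)) - a|) atTop (𝓝 0) := by
      have := ((tendsto_iff_norm_sub_tendsto_zero.1 ha).const_mul B)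
      simpa using this
    exact squeeze_zero_norm (fun k => hB _ _ _) h0
  have h2 : Tendsto (fun k => f (ns (ms k)) a) atTop (𝓝 (g a)) := (hf a).comp hsub
  have h3 : Tendsto (fun k => g (x (ns (ms k)))) atTop (𝓝 (g a)) := (hg.tendsto a).comp ha
  have := (h1.add h2).sub h3
  simpa using this

/-- Unlike `stdWeight_sq_le` this allows empty samples, whose weight is zero by the convention for
division, and so gives a bound along the entire sequence. -/
lemma abs_stdWeight_le {L : Fin 2 → ℝ} {T : Fin 2 → ℕ} (hL : ∀ j, 0 < L j) (j : Fin 2) :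
    |stdWeight L T j| ≤ √(1 / L j) := by
  refine Real.abs_le_sqrt ?_
  have l0 := hL 0
  have l1 := hL 1
  rcases Nat.eq_zero_or_pos (T j) with h | h
  · rw [stdWeight, h]
    have := hL j
    simp
    positivity
  · have hj : (0 : ℝ) < T j := Nat.cast_pos.2 h
    have hle : L j / T j ≤ L 0 / T 0 + L 1 / T 1 := by
      fin_cases j
      · exact le_add_of_nonneg_right (by positivity)
      · exact le_add_of_nonneg_left (by positivity)
    have := hL j
    rw [stdWeight_sq hL, div_le_div_iff₀ (lt_of_lt_of_le (by positivity) hle) this]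
    calc 1 / (T j : ℝ) * L j = L j / T j := by ring
      _ ≤ 1 * _ := by rw [one_mul]; exact hle

/-- The difference of the sample means is asymptotically normal. -/
lemma tendsto_charFun_difference {u : Fin 2 → ℤ → Ω → ℝ} {L : Fin 2 → ℝ}
    (hu : ∀ j t, Measurable (u j t))
    (hu_indep : IndepFun (fun ω t => u 0 t ω) (fun ω t => u 1 t ω) P)
    (hL : ∀ j, 0 < L j) (hF : FunctionalCLT P u L) (hdep : ∀ j, WeaklyDependent P (u j))
    {T : ℕ → Fin 2 → ℕ} (hT : ∀ j, Tendsto (fun n => T n j) atTop atTop) (x : ℝ) :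
    Tendsto (fun n => charFun (P.map fun ω =>
      stdWeight L (T n) 0 * linStat (T n 0) (fun _ => 1) (u 0) ω -
        stdWeight L (T n) 1 * linStat (T n 1) (fun _ => 1) (u 1) ω) x) atTop
      (𝓝 (charFun (gaussianReal 0 1) x)) := by
  set N : ℕ → Fin 2 → Ω → ℝ := fun n j => linStat (T n j) (fun _ => 1) (u j) with hN
  have hNm : ∀ n j, Measurable (N n j) := fun n j => measurable_linStat (hu j) _ _
  have hN2 : ∀ n j, MemLp (N n j) 2 P := fun n j =>
    (memLp_linStat (hdep j).stationary _ _).mono_exponent (by norm_num)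
  set c : ℕ → Fin 2 → ℝ := fun n j => if j = 0 then stdWeight L (T n) 0 else -stdWeight L (T n) 1
    with hc
  have hsplit : ∀ n, charFun (P.map fun ω => stdWeight L (T n) 0 * N n 0 ω -
      stdWeight L (T n) 1 * N n 1 ω) x =
      charFun (P.map (N n 0)) (c n 0 * x) * charFun (P.map (N n 1)) (c n 1 * x) := by
    intro n
    have hsum : ∀ j, Measurable fun w : ℤ → ℝ => c n j * ((1 / √(T n j : ℝ)) *
        ∑ t ∈ Finset.Icc 1 (T n j), 1 * w (t : ℤ)) := fun j => by fun_prop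
    have hind : IndepFun (fun ω => c n 0 * N n 0 ω) (fun ω => c n 1 * N n 1 ω) P :=
      hu_indep.comp (hsum 0) (hsum 1)
    have e : (fun ω => stdWeight L (T n) 0 * N n 0 ω - stdWeight L (T n) 1 * N n 1 ω) =
        fun ω => c n 0 * N n 0 ω + c n 1 * N n 1 ω := by
      ext ω
      simp [hc]
      ring
    rw [e, hind.charFun_map_fun_add_eq_mul ((hNm n 0).const_mul _).aemeasurable
      ((hNm n 1).const_mul _).aemeasurable, Pi.mul_apply,
      charFun_map_mul_comp (hNm n 0).aemeasurable, charFun_map_mul_comp (hNm n 1).aemeasurable]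
  -- The weights stay bounded but need not converge, so each characteristic function is compared
  -- with the Gaussian one at a moving argument.
  have hj : ∀ j, Tendsto (fun n => charFun (P.map (N n j)) (c n j * x) -
      Complex.exp (-(L j * ((c n j * x : ℝ) : ℂ) ^ 2) / 2)) atTop (𝓝 0) := by
    intro j
    obtain ⟨B, hB⟩ := (tendsto_integral_linStat_one_sq (hdep j)).bddAbove_range
    refine tendsto_sub_of_lipschitz_of_bounded (f := fun n => charFun (P.map (N n j)))
      (g := fun y => Complex.exp (-(L j * (y : ℂ) ^ 2) / 2)) (B := 1 + B)
      (x := fun n => c n j * x) (M := √(1 / L j) * |x|) (by fun_prop)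
      (fun y => (tendsto_charFun_linStat_of_functionalCLT hu hL hF j y).comp (hT j))
      (fun n y z => ?_) (fun n => ?_)
    · refine (norm_charFun_map_sub_le (hNm n j) (hN2 n j) y z).trans ?_
      gcongr
      exact hB ⟨T n j, rfl⟩
    · rw [abs_mul]
      gcongr
      refine le_trans (le_of_eq ?_) (abs_stdWeight_le (T := T n) hL j)
      fin_cases j <;> simp [hc]
  -- The two moving Gaussian factors multiply to a fixed function because the scaled variances add
  -- up to one.
  have hexp : ∀ᶠ n in atTop, Complex.exp (-(L 0 * ((c n 0 * x : ℝ) : ℂ) ^ 2) / 2) *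
      Complex.exp (-(L 1 * ((c n 1 * x : ℝ) : ℂ) ^ 2) / 2) = charFun (gaussianReal 0 1) x := by
    filter_upwards [(hT 0).eventually_gt_atTop 0, (hT 1).eventually_gt_atTop 0] with n h0 h1
    have hs := sum_stdWeight_sq (T := T n) hL fun j => by fin_cases j; exacts [h0, h1]
    rw [← Complex.exp_add, charFun_gaussianReal]
    congr 1
    have hs' : (L 0 : ℂ) * (stdWeight L (T n) 0 : ℂ) ^ 2 +
        (L 1 : ℂ) * (stdWeight L (T n) 1 : ℂ) ^ 2 = 1 := by exact_mod_cast hs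
    simp only [hc, if_true, one_ne_zero, if_false, Complex.ofReal_mul, Complex.ofReal_neg]
    simp
    linear_combination (-(x : ℂ) ^ 2 / 2) * hs'
  have hn1 : ∀ n, ‖charFun (P.map (N n 1)) (c n 1 * x)‖ ≤ 1 := fun n => by
    have := Measure.isProbabilityMeasure_map (μ := P) (hNm n 1).aemeasurable
    exact norm_charFun_le_one _
  have hn0 : ∀ n, ‖Complex.exp (-(L 0 * ((c n 0 * x : ℝ) : ℂ) ^ 2) / 2)‖ ≤ 1 := fun n => by
    rw [show -(L 0 * ((c n 0 * x : ℝ) : ℂ) ^ 2) / 2 =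
      ((-(L 0 * (c n 0 * x) ^ 2) / 2 : ℝ) : ℂ) by push_cast; ring, Complex.norm_exp_ofReal,
      Real.exp_le_one_iff]
    have := mul_nonneg (hL 0).le (sq_nonneg (c n 0 * x))
    linarith
  have hlim : Tendsto (fun n => charFun (P.map (N n 0)) (c n 0 * x) *
      charFun (P.map (N n 1)) (c n 1 * x) -
      Complex.exp (-(L 0 * ((c n 0 * x : ℝ) : ℂ) ^ 2) / 2) *
      Complex.exp (-(L 1 * ((c n 1 * x : ℝ) : ℂ) ^ 2) / 2)) atTop (𝓝 0) := by
    have hsum := (hj 0).norm.add (hj 1).norm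
    rw [norm_zero, add_zero] at hsum
    refine squeeze_zero_norm (fun n => ?_) hsum
    have := hn1 n
    have := hn0 n
    set a := charFun (P.map (N n 0)) (c n 0 * x)
    set b := charFun (P.map (N n 1)) (c n 1 * x)
    set a' := Complex.exp (-(L 0 * ((c n 0 * x : ℝ) : ℂ) ^ 2) / 2)
    set b' := Complex.exp (-(L 1 * ((c n 1 * x : ℝ) : ℂ) ^ 2) / 2)
    calc ‖a * b - a' * b'‖ = ‖(a - a') * b + a' * (b - b')‖ := by congr 1; ring
      _ ≤ ‖a - a'‖ * ‖b‖ + ‖a'‖ * ‖b - b'‖ := by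
          refine (norm_add_le _ _).trans ?_
          rw [norm_mul, norm_mul]
      _ ≤ ‖a - a'‖ * 1 + 1 * ‖b - b'‖ := by gcongr
      _ = _ := by ring
  have := hlim.add (tendsto_const_nhds (x := charFun (gaussianReal 0 1) x))
  rw [zero_add] at this
  refine this.congr' ?_
  filter_upwards [hexp] with n hn
  refine Eq.trans ?_ (hsplit n).symm
  rw [← hn]
  ring

lemma tHAR_obs_eq {Ω : Type*} {u : Fin 2 → ℤ → Ω → ℝ} {φ : ℕ → ℝ → ℝ} {r : ℕ → Fin 2} {m : ℕ → ℕ}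
    (hb : IsTrigBasis φ r m) {T K : Fin 2 → ℕ} (hT : ∀ j, 2 * K j < T j) {μ : Fin 2 → ℝ}
    (hμ : μ 0 = μ 1) (ω : Ω) :
    tHAR φ T K (obs μ u ω) =
      (linStat (T 0) (fun _ => 1) (u 0) ω / √(T 0 : ℝ) -
        linStat (T 1) (fun _ => 1) (u 1) ω / √(T 1 : ℝ)) /
      √(projMean φ (T 0) (K 0) (u 0) ω / T 0 + projMean φ (T 1) (K 1) (u 1) ω / T 1) := by
  have hmean : ∀ j, sampleMean (T j) (obs μ u ω j) =
      μ j + linStat (T j) (fun _ => 1) (u j) ω / √(T j : ℝ) := by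
    intro j
    have hj : 0 < T j := by have := hT j; omega
    have h1 : obs μ u ω j = fun t => μ j + (fun t : ℕ => u j (t : ℤ) ω) t := rfl
    rw [h1, sampleMean_const_add hj, sampleMean, linStat]
    simp only [one_mul]
    congr 1
    rw [one_div_mul_eq_div, div_div, Real.mul_self_sqrt (Nat.cast_nonneg _)]
  have hlrv : ∀ j, seriesLRV φ (T j) (K j) (obs μ u ω j) =
      projMean φ (T j) (K j) (u j) ω := fun j =>
    seriesLRV_const_add hb (hT j) (μ j) fun t => u j (t : ℤ) ω
  rw [tHAR, hmean, hmean, hlrv, hlrv, hμ]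
  congr 1
  ring

/-- The null distribution of the statistic is asymptotically standard normal. -/
lemma eventually_forall_abs_tHAR_sub_le {u : Fin 2 → ℤ → Ω → ℝ} {L : Fin 2 → ℝ}
    (hu : ∀ j t, Measurable (u j t))
    (hu_indep : IndepFun (fun ω t => u 0 t ω) (fun ω t => u 1 t ω) P)
    (hL : ∀ j, 0 < L j) (hLs : ∀ j, autocovSum P (u j) = L j) (hF : FunctionalCLT P u L)
    (hdep : ∀ j, WeaklyDependent P (u j))
    {φ : ℕ → ℝ → ℝ} {r : ℕ → Fin 2} {m : ℕ → ℕ} (hb : IsTrigBasis φ r m)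
    {T K Ks : ℕ → Fin 2 → ℕ}
    (hg : ∀ j, GrowthCondition (fun n => T n j) (fun n => K n j) (fun n => Ks n j))
    {μ : Fin 2 → ℝ} (hμ : μ 0 = μ 1) {ε : ℝ} (hε : 0 < ε) :
    ∀ᶠ n in atTop, ∀ x,
      |P.real {ω | tHAR φ (T n) (K n) (obs μ u ω) < x} - stdNormalCDF x| ≤ ε := by
  have hev : ∀ᶠ n in atTop, ∀ j, 2 * K n j < T n j := by
    rw [eventually_all]
    exact fun j => (hg j).eventually.mono fun n h => h.2.1
  refine eventually_forall_abs_twoSample_sub_le (T := T) hL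
    (N := fun n j => linStat (T n j) (fun _ => 1) (u j))
    (D := fun n j => projMean φ (T n j) (K n j) (u j))
    (hev.mono fun n h j => by have := h j; omega) (fun n j => measurable_linStat (hu j) _ _)
    (tendsto_charFun_difference hu hu_indep hL hF hdep fun j => (hg j).sample)
    (fun j δ hδ => ?_) (hev.mono fun n h ω => tHAR_obs_eq hb h hμ ω) hε
  rw [← hLs j]
  exact tendsto_projMean (hdep j) hb (hg j) hδ

end Sampling

end SHARWB

/-! ### Conditional normality of the bootstrap statistic -/

namespace SHARWB

section Resampling

variable {Ω : Type*} {S : Type*}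

/-- The normalized mean of the resampled residuals, a linear form in the external draws. -/
noncomputable def bootLin (T Ks : ℕ) (u : ℤ → Ω → ℝ) (ω : Ω) (v : Fin 2 → ℕ → ℝ) : ℝ :=
  1 / √(Ks : ℝ) * ∑ i ∈ trigIndex Ks, linStat T (trig T i.1 i.2) u ω * v i.1 i.2

/-- The long-run variance estimator of the bootstrap sample, a quadratic form in the external
draws. -/
noncomputable def bootQuad (φ : ℕ → ℝ → ℝ) (T K Ks : ℕ) (u : ℤ → Ω → ℝ) (ω : Ω)
    (v : Fin 2 → ℕ → ℝ) : ℝ :=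
  ∑ i ∈ trigIndex Ks, ∑ j ∈ trigIndex Ks, gram φ T K Ks u i j ω * (v i.1 i.2 * v j.1 j.2)

/-- The pooled mean cancels between the samples, and the residuals do not see `μ`. The bootstrap
statistic is therefore the same for all means, so it imitates the null distribution even off the
null. -/
lemma tHARStar_obs_eq {u : Fin 2 → ℤ → Ω → ℝ} {φ : ℕ → ℝ → ℝ} {r : ℕ → Fin 2} {m : ℕ → ℕ}
    (hb : IsTrigBasis φ r m) {T K Ks : Fin 2 → ℕ} (hK : ∀ j, 2 * K j < T j)
    (hKs : ∀ j, 2 * Ks j < T j) (μ : Fin 2 → ℝ) (ω : Ω) (v : Fin 2 → Fin 2 → ℕ → ℝ) :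
    tHARStar φ T K Ks (obs μ u ω) v =
      (bootLin (T 0) (Ks 0) (u 0) ω (v 0) / √(T 0 : ℝ) -
        bootLin (T 1) (Ks 1) (u 1) ω (v 1) / √(T 1 : ℝ)) /
      √(bootQuad φ (T 0) (K 0) (Ks 0) (u 0) ω (v 0) / T 0 +
        bootQuad φ (T 1) (K 1) (Ks 1) (u 1) ω (v 1) / T 1) := by
  have hs : ∀ j, bootSample T Ks (obs μ u ω) v j = fun t => pooledMean T (obs μ u ω) +
      resid (T j) (fun t : ℕ => u j (t : ℤ) ω) t * eta (T j) (Ks j) (v j) t := by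
    intro j
    have h := resid_const_add (T := T j) (by have := hK j; omega) (μ j)
      fun t : ℕ => u j (t : ℤ) ω
    have h1 : obs μ u ω j = fun t => μ j + (fun t : ℕ => u j (t : ℤ) ω) t := rfl
    ext t
    rw [bootSample, h1, h]
  have hmean : ∀ j, sampleMean (T j) (bootSample T Ks (obs μ u ω) v j) =
      pooledMean T (obs μ u ω) + bootLin (T j) (Ks j) (u j) ω (v j) / √(T j : ℝ) := by
    intro j
    rw [hs, sampleMean_resid_mul_eta (hKs j)]
    rfl
  have hlrv : ∀ j, seriesLRV φ (T j) (K j) (bootSample T Ks (obs μ u ω) v j) =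
      bootQuad φ (T j) (K j) (Ks j) (u j) ω (v j) := by
    intro j
    rw [hs, seriesLRV_resid_mul_eta hb (hK j)]
    rfl
  rw [tHARStar, tHAR, hmean, hmean, hlrv, hlrv]
  congr 1
  ring

variable [MeasurableSpace S] {Q : Measure S} {v : ℕ → Fin 2 → Fin 2 → ℕ → S → ℝ} {C : ℝ}

lemma ExternalDraws.integral_sq {v : Fin 2 → Fin 2 → ℕ → S → ℝ} (h : ExternalDraws Q v C)
    (j r : Fin 2) (l : ℕ) : ∫ s, v j r l s ^ 2 ∂Q = 1 := by
  rw [← variance_of_integral_eq_zero (h.measurable j r l).aemeasurable (h.mean_zero j r l),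
    h.var_one]

lemma ExternalDraws.nonneg {v : Fin 2 → Fin 2 → ℕ → S → ℝ} (h : ExternalDraws Q v C) : 0 ≤ C :=
  (integral_nonneg fun s => by positivity).trans (h.fourth_lt 0 0 0).le

lemma measurable_bootLin {v : Fin 2 → Fin 2 → ℕ → S → ℝ} (h : ExternalDraws Q v C) (T Ks : ℕ)
    (u : ℤ → Ω → ℝ) (ω : Ω) (j : Fin 2) :
    Measurable fun s => bootLin T Ks u ω fun r l => v j r l s := by
  have := h.measurable j
  unfold bootLin
  fun_prop

variable [IsProbabilityMeasure Q] {T K Ks : ℕ → Fin 2 → ℕ} {u : Fin 2 → ℤ → Ω → ℝ}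
  {L : Fin 2 → ℝ}

/-- Conditionally on the data, the difference of the bootstrap means is asymptotically normal. -/
lemma tendsto_charFun_bootLin (hv : ∀ n, ExternalDraws Q (v n) C) (hL : ∀ j, 0 < L j)
    (hT : ∀ᶠ n in atTop, ∀ j, 0 < T n j) {ω : ℕ → Ω}
    (h2 : ∀ j, Tendsto (fun n => trigMean (T n j) (Ks n j) (u j) (ω n)) atTop (𝓝 (L j)))
    (h4 : ∀ j, Tendsto (fun n => trigFourth (T n j) (Ks n j) (u j) (ω n)) atTop (𝓝 0)) (x : ℝ) :
    Tendsto (fun n => charFun (Q.map fun s =>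
      stdWeight L (T n) 0 * bootLin (T n 0) (Ks n 0) (u 0) (ω n) (fun r l => v n 0 r l s) -
      stdWeight L (T n) 1 * bootLin (T n 1) (Ks n 1) (u 1) (ω n) (fun r l => v n 1 r l s)) x) atTop
      (𝓝 (charFun (gaussianReal 0 1) x)) := by
  -- The draws of both samples form one independent family, so the difference is a single weighted
  -- sum; the sign disappears in the even powers of the coefficients.
  set sgn : Fin 2 → ℝ := ![1, -1] with hsgn
  let c : ℕ → (Σ _ : Fin 2, Fin 2 × ℕ) → ℝ := fun n a =>
    sgn a.1 * stdWeight L (T n) a.1 * (1 / √(Ks n a.1 : ℝ)) *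
      linStat (T n a.1) (trig (T n a.1) a.2.1 a.2.2) (u a.1) (ω n)
  have hc2 : ∀ n, ∑ a ∈ Finset.univ.sigma fun j => trigIndex (Ks n j), c n a ^ 2 =
      ∑ j, stdWeight L (T n) j ^ 2 * trigMean (T n j) (Ks n j) (u j) (ω n) := by
    intro n
    rw [Finset.sum_sigma]
    refine Finset.sum_congr rfl fun j _ => ?_
    rw [trigMean, Finset.mul_sum, Finset.mul_sum]
    refine Finset.sum_congr rfl fun i _ => ?_
    have h1 : sgn j ^ 2 = 1 := by fin_cases j <;> simp [hsgn]
    simp only [c, mul_pow, h1, div_pow, one_pow, Real.sq_sqrt (Nat.cast_nonneg (Ks n j))]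
    ring
  have hc4 : ∀ n, ∑ a ∈ Finset.univ.sigma fun j => trigIndex (Ks n j), c n a ^ 4 =
      ∑ j, (stdWeight L (T n) j ^ 2) ^ 2 * trigFourth (T n j) (Ks n j) (u j) (ω n) := by
    intro n
    rw [Finset.sum_sigma]
    refine Finset.sum_congr rfl fun j _ => ?_
    rw [trigFourth, Finset.mul_sum, Finset.mul_sum]
    refine Finset.sum_congr rfl fun i _ => ?_
    have h1 : sgn j ^ 4 = 1 := by fin_cases j <;> norm_num [hsgn]
    have h2 : √(Ks n j : ℝ) ^ 4 = (Ks n j : ℝ) ^ 2 := by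
      rw [show 4 = 2 * 2 by norm_num, pow_mul, Real.sq_sqrt (Nat.cast_nonneg (Ks n j))]
    simp only [c, mul_pow, h1, div_pow, one_pow, h2]
    ring
  have key := tendsto_charFun_weighted_sum (Q := Q) (ι := Σ _ : Fin 2, Fin 2 × ℕ)
    (v := fun n a => v n a.1 a.2.1 a.2.2) (C := C)
    (fun n a => (hv n).measurable _ _ _)
    (fun n => (hv n).indep.precomp (g := Equiv.sigmaEquivProd (Fin 2) (Fin 2 × ℕ))
      (Equiv.injective _))
    (fun n a => (hv n).mean_zero _ _ _) (fun n a => (hv n).integral_sq _ _ _)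
    (fun n a => (hv n).memLp _ _ _) (fun n a => ((hv n).fourth_lt _ _ _).le)
    (fun n => Finset.univ.sigma fun j => trigIndex (Ks n j)) c ?_ ?_ x
  · refine key.congr fun n => ?_
    congr 2
    ext s
    rw [Finset.sum_sigma, Fin.sum_univ_two, bootLin, bootLin]
    simp only [c, hsgn, Matrix.cons_val_zero, Matrix.cons_val_one, Finset.mul_sum, one_mul]
    rw [sub_eq_add_neg, ← Finset.sum_neg_distrib]
    congr 1 <;> exact Finset.sum_congr rfl fun i _ => by ring
  · simp only [hc2]
    have hd : Tendsto (fun n => ∑ j, 1 / L j * |trigMean (T n j) (Ks n j) (u j) (ω n) - L j|)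
        atTop (𝓝 0) := by
      have := tendsto_finsetSum (Finset.univ : Finset (Fin 2)) fun j _ =>
        ((tendsto_iff_norm_sub_tendsto_zero.1 (h2 j)).const_mul (1 / L j))
      simpa using this
    refine tendsto_iff_norm_sub_tendsto_zero.2
      (squeeze_zero' (Eventually.of_forall fun _ => norm_nonneg _) ?_ hd)
    filter_upwards [hT] with n hn
    have e : ∑ j, stdWeight L (T n) j ^ 2 * trigMean (T n j) (Ks n j) (u j) (ω n) - 1 =
        ∑ j, stdWeight L (T n) j ^ 2 * (trigMean (T n j) (Ks n j) (u j) (ω n) - L j) := by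
      rw [← sum_stdWeight_sq hL hn, Fin.sum_univ_two, Fin.sum_univ_two]
      ring
    rw [e]
    refine (norm_sum_le _ _).trans (Finset.sum_le_sum fun j _ => ?_)
    rw [norm_mul, Real.norm_eq_abs, Real.norm_eq_abs, abs_of_nonneg (sq_nonneg _)]
    gcongr
    exact stdWeight_sq_le hL hn j
  · simp only [hc4]
    have hd : Tendsto (fun n => ∑ j, (1 / L j) ^ 2 * trigFourth (T n j) (Ks n j) (u j) (ω n))
        atTop (𝓝 0) := by
      have := tendsto_finsetSum (Finset.univ : Finset (Fin 2)) fun j _ =>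
        ((h4 j).const_mul ((1 / L j) ^ 2))
      simpa using this
    have h0 : ∀ n j, 0 ≤ trigFourth (T n j) (Ks n j) (u j) (ω n) := fun n j => by
      unfold trigFourth; positivity
    refine squeeze_zero' (Eventually.of_forall fun n => Finset.sum_nonneg fun j _ =>
      mul_nonneg (by positivity) (h0 n j)) ?_ hd
    filter_upwards [hT] with n hn
    refine Finset.sum_le_sum fun j _ => ?_
    have := h0 n j
    gcongr
    exact stdWeight_sq_le hL hn j

/-- Conditionally on the data, the bootstrap long-run variance estimator is consistent. -/
lemma tendsto_bootQuad (hv : ∀ n, ExternalDraws Q (v n) C) {φ : ℕ → ℝ → ℝ} (j : Fin 2)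
    {ω : ℕ → Ω}
    (h1 : Tendsto (fun n => gramTrace φ (T n j) (K n j) (Ks n j) (u j) (ω n)) atTop (𝓝 (L j)))
    (h2 : Tendsto (fun n => gramSq φ (T n j) (K n j) (Ks n j) (u j) (ω n)) atTop (𝓝 0))
    {δ : ℝ} (hδ : 0 < δ) :
    Tendsto (fun n => Q.real {s | δ ≤ |bootQuad φ (T n j) (K n j) (Ks n j) (u j) (ω n)
      (fun r l => v n j r l s) - L j|}) atTop (𝓝 0) := by
  have hlim : Tendsto (fun n => (gramTrace φ (T n j) (K n j) (Ks n j) (u j) (ω n) - L j) ^ 2 +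
      (2 + C) * gramSq φ (T n j) (K n j) (Ks n j) (u j) (ω n)) atTop (𝓝 0) := by
    have := ((h1.sub_const (L j)).pow 2).add (h2.const_mul (2 + C))
    simpa using this
  refine tendsto_measureReal_le_abs_sub_of_integral_sq (fun n => ?_)
    (Eventually.of_forall fun n => ?_) hlim hδ
  · exact memLp_finsetSum _ fun i _ => memLp_finsetSum _ fun i' _ =>
      (memLp_two_mul ((hv n).memLp _ _ _) ((hv n).memLp _ _ _)).const_mul _
  · exact (integral_quadForm_sub_sq_le (v := fun i : Fin 2 × ℕ => v n j i.1 i.2)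
      (fun i => (hv n).measurable _ _ _)
      ((hv n).indep.precomp (g := fun i : Fin 2 × ℕ => (j, i)) (Prod.mk_right_injective j))
      (fun i => (hv n).mean_zero _ _ _) (fun i => (hv n).integral_sq _ _ _)
      (fun i => (hv n).memLp _ _ _) (fun i => ((hv n).fourth_lt _ _ _).le) (hv n).nonneg
      (trigIndex (Ks n j)) (fun i i' => gram φ (T n j) (K n j) (Ks n j) (u j) i i' (ω n))
      (fun i i' => by simp only [gram, mul_comm]) (L j)).2

/-- The data lie in the set where the bootstrap moments are within `δ` of their limits. -/
structure BootRegular (φ : ℕ → ℝ → ℝ) (T K Ks : Fin 2 → ℕ) (u : Fin 2 → ℤ → Ω → ℝ)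
    (L : Fin 2 → ℝ) (δ : ℝ) (ω : Ω) : Prop where
  trigMean_lt : ∀ j, |trigMean (T j) (Ks j) (u j) ω - L j| < δ
  trigFourth_lt : ∀ j, trigFourth (T j) (Ks j) (u j) ω < δ
  gramTrace_lt : ∀ j, |gramTrace φ (T j) (K j) (Ks j) (u j) ω - L j| < δ
  gramSq_lt : ∀ j, gramSq φ (T j) (K j) (Ks j) (u j) ω < δ

variable {φ : ℕ → ℝ → ℝ} {r : ℕ → Fin 2} {m : ℕ → ℕ}

/-- The data points form an arbitrary deterministic sequence, so the only randomness is that of the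
draws. This sequential form is what the contradiction in `exists_forall_bootRegular` needs. -/
lemma eventually_forall_abs_tHARStar_sub_le (hv : ∀ n, ExternalDraws Q (v n) C)
    (hL : ∀ j, 0 < L j) (hb : IsTrigBasis φ r m)
    (hsize : ∀ᶠ n in atTop, ∀ j, 2 * K n j < T n j ∧ 2 * Ks n j < T n j) {ω : ℕ → Ω} {δ : ℕ → ℝ}
    (hδ : Tendsto δ atTop (𝓝 0))
    (hω : ∀ n, BootRegular φ (T n) (K n) (Ks n) u L (δ n) (ω n)) (μ : Fin 2 → ℝ) {ε : ℝ}
    (hε : 0 < ε) :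
    ∀ᶠ n in atTop, ∀ x, |Q.real {s | tHARStar φ (T n) (K n) (Ks n) (obs μ u (ω n))
      (fun j r l => v n j r l s) < x} - stdNormalCDF x| ≤ ε := by
  have hT : ∀ᶠ n in atTop, ∀ j, 0 < T n j :=
    hsize.mono fun n h j => by have := h j; omega
  have hlim : ∀ {a : ℕ → ℝ} {b : ℝ}, (∀ n, |a n - b| < δ n) → Tendsto a atTop (𝓝 b) :=
    fun h => tendsto_iff_norm_sub_tendsto_zero.2
      (squeeze_zero (fun _ => norm_nonneg _) (fun n => (h n).le) hδ)
  have hclt := tendsto_charFun_bootLin hv hL hT (fun j => hlim fun n => (hω n).trigMean_lt j)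
    fun j => squeeze_zero (fun n => by unfold trigFourth; positivity)
      (fun n => ((hω n).trigFourth_lt j).le) hδ
  have hD : ∀ j, ∀ ε > 0, Tendsto (fun n => Q.real {s | ε ≤ |bootQuad φ (T n j) (K n j) (Ks n j)
      (u j) (ω n) (fun r l => v n j r l s) - L j|}) atTop (𝓝 0) := fun j ε hε =>
    tendsto_bootQuad hv j (hlim fun n => (hω n).gramTrace_lt j)
      (squeeze_zero (fun n => Finset.sum_nonneg fun _ _ => Finset.sum_nonneg fun _ _ => sq_nonneg _)
        (fun n => ((hω n).gramSq_lt j).le) hδ) hε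
  have ht : ∀ᶠ n in atTop, ∀ s, _ = _ := hsize.mono fun n h s =>
    tHARStar_obs_eq (u := u) hb (fun j => (h j).1) (fun j => (h j).2) μ (ω n)
      fun j r l => v n j r l s
  exact eventually_forall_abs_twoSample_sub_le (T := T) hL hT
    (N := fun n j s => bootLin (T n j) (Ks n j) (u j) (ω n) fun r l => v n j r l s)
    (D := fun n j s => bootQuad φ (T n j) (K n j) (Ks n j) (u j) (ω n) fun r l => v n j r l s)
    (fun n j => measurable_bootLin (hv n) _ _ _ _ _) hclt hD ht hε

/-- The bootstrap distribution is uniformly close to the normal one whenever the data are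
regular. -/
lemma exists_forall_bootRegular (hv : ∀ n, ExternalDraws Q (v n) C)
    (hL : ∀ j, 0 < L j) (hb : IsTrigBasis φ r m)
    (hsize : ∀ᶠ n in atTop, ∀ j, 2 * K n j < T n j ∧ 2 * Ks n j < T n j) (μ : Fin 2 → ℝ) {ε : ℝ}
    (hε : 0 < ε) :
    ∃ δ > 0, ∀ᶠ n in atTop, ∀ ω, BootRegular φ (T n) (K n) (Ks n) u L δ ω →
      ∀ x, |Q.real {s | tHARStar φ (T n) (K n) (Ks n) (obs μ u ω)
        (fun j r l => v n j r l s) < x} - stdNormalCDF x| ≤ ε := by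
  by_contra! hcon
  -- If no tolerance works, the tolerances `1 / (k + 1)` yield increasingly regular data with
  -- indices `n ≥ k` at which the approximation fails. The sequential version along these indices
  -- contradicts this.
  have h : ∀ k : ℕ, ∃ n ≥ k, ∃ ω, BootRegular φ (T n) (K n) (Ks n) u L (1 / ((k : ℝ) + 1)) ω ∧
      ∃ x, ε < |Q.real {s | tHARStar φ (T n) (K n) (Ks n) (obs μ u ω)
        (fun j r l => v n j r l s) < x} - stdNormalCDF x| := fun k =>
    frequently_atTop.1 (hcon (1 / ((k : ℝ) + 1)) Nat.one_div_pos_of_nat) k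
  choose N hN ω hω x hx using h
  have hN' : Tendsto N atTop atTop := tendsto_atTop_mono hN tendsto_id
  obtain ⟨k, hk⟩ := (eventually_forall_abs_tHARStar_sub_le (v := fun k => v (N k))
    (T := fun k => T (N k)) (K := fun k => K (N k)) (Ks := fun k => Ks (N k))
    (fun k => hv (N k)) hL hb (hN'.eventually hsize) tendsto_one_div_add_atTop_nhds_zero_nat hω μ
    hε).exists
  exact (hx k).not_ge (hk (x k))

variable [MeasurableSpace Ω] {P : Measure Ω} [IsProbabilityMeasure P]

lemma tendsto_not_bootRegular (hLs : ∀ j, autocovSum P (u j) = L j)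
    (hdep : ∀ j, WeaklyDependent P (u j)) (hb : IsTrigBasis φ r m)
    (hg : ∀ j, GrowthCondition (fun n => T n j) (fun n => K n j) (fun n => Ks n j)) {δ : ℝ}
    (hδ : 0 < δ) :
    Tendsto (fun n => P.real {ω | ¬ BootRegular φ (T n) (K n) (Ks n) u L δ ω}) atTop (𝓝 0) := by
  have hlim := tendsto_finsetSum (Finset.univ : Finset (Fin 2)) fun j _ =>
    (((tendsto_trigMean (hdep j) (hg j) hδ).add (tendsto_trigFourth (hdep j) (hg j) hδ)).add
      (tendsto_gramTrace (hdep j) hb (hg j) hδ)).add (tendsto_gramSq (hdep j) hb (hg j) hδ)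
  simp only [add_zero, Finset.sum_const_zero, hLs] at hlim
  refine squeeze_zero (fun _ => measureReal_nonneg) (fun n => ?_) hlim
  refine (measureReal_mono (s₂ := ⋃ j ∈ (Finset.univ : Finset (Fin 2)),
    ((({ω | δ ≤ |trigMean (T n j) (Ks n j) (u j) ω - L j|} ∪
      {ω | δ ≤ trigFourth (T n j) (Ks n j) (u j) ω}) ∪
      {ω | δ ≤ |gramTrace φ (T n j) (K n j) (Ks n j) (u j) ω - L j|}) ∪
      {ω | δ ≤ gramSq φ (T n j) (K n j) (Ks n j) (u j) ω})) (fun ω hω => ?_) (measure_ne_top _ _)).trans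
    ((measureReal_biUnion_finset_le _ _).trans (Finset.sum_le_sum fun j _ => ?_))
  · by_contra hcon
    simp only [Finset.mem_univ, Set.iUnion_true, Set.mem_iUnion, Set.mem_union,
      Set.mem_ofPred_eq, not_exists, not_or, not_le] at hcon
    exact hω ⟨fun j => (hcon j).1.1.1, fun j => (hcon j).1.1.2, fun j => (hcon j).1.2,
      fun j => (hcon j).2⟩
  · refine (measureReal_union_le _ _).trans ?_
    gcongr
    refine (measureReal_union_le _ _).trans ?_
    gcongr
    exact measureReal_union_le _ _

/-- The bootstrap distribution is uniformly consistent for the null distribution. -/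
lemma tendstoInMeasure_bootDist (hu : ∀ j t, Measurable (u j t))
    (hu_indep : IndepFun (fun ω t => u 0 t ω) (fun ω t => u 1 t ω) P)
    (hL : ∀ j, 0 < L j) (hLs : ∀ j, autocovSum P (u j) = L j) (hF : FunctionalCLT P u L)
    (hdep : ∀ j, WeaklyDependent P (u j)) (hb : IsTrigBasis φ r m)
    (hg : ∀ j, GrowthCondition (fun n => T n j) (fun n => K n j) (fun n => Ks n j))
    (hv : ∀ n, ExternalDraws Q (v n) C) (μ : Fin 2 → ℝ) {μ₀ : Fin 2 → ℝ} (hμ₀ : μ₀ 0 = μ₀ 1) :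
    TendstoInMeasure P
      (fun n ω => bootDist P Q φ (T n) (K n) (Ks n) u (v n) μ₀ (obs μ u ω)) atTop
      (fun _ => 0) := by
  rw [tendstoInMeasure_iff_measureReal_norm]
  intro ε hε
  have hsize : ∀ᶠ n in atTop, ∀ j, 2 * K n j < T n j ∧ 2 * Ks n j < T n j :=
    eventually_all.2 fun j => (hg j).eventually.mono fun n h => ⟨h.2.1, h.2.2.2⟩
  obtain ⟨δ, hδ, hboot⟩ := exists_forall_bootRegular (u := u) hv hL hb hsize μ
    (show 0 < ε / 4 by positivity)
  refine squeeze_zero' (Eventually.of_forall fun _ => measureReal_nonneg) ?_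
    (tendsto_not_bootRegular hLs hdep hb hg hδ)
  filter_upwards [hboot, eventually_forall_abs_tHAR_sub_le hu hu_indep hL hLs hF hdep hb hg hμ₀
    (show 0 < ε / 4 by positivity)] with n h1 h2
  refine measureReal_mono fun ω hω hreg => ?_
  refine not_lt.2 (show ε ≤ _ from hω) ?_
  rw [sub_zero, Real.norm_eq_abs, bootDist, abs_of_nonneg (Real.iSup_nonneg fun x => abs_nonneg _)]
  -- On regular data the two normal approximations cost `ε / 4` each, uniformly in `x`, which leaves
  -- the supremum strictly below `ε`.
  refine lt_of_le_of_lt (Real.iSup_le (fun x => ?_) (show 0 ≤ ε / 2 by positivity))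
    (by linarith)
  have := abs_sub_le_iff.1 (h1 ω hreg x)
  have := abs_sub_le_iff.1 (h2 x)
  rw [abs_le]
  constructor <;> linarith

end Resampling

end SHARWB

/-! ### The theorem -/

theorem theorem4
    {Ω : Type*} [MeasurableSpace Ω] (P : Measure Ω) [IsProbabilityMeasure P]
    {S : Type*} [MeasurableSpace S] (Q : Measure S) [IsProbabilityMeasure Q]
    -- the error processes and their long-run variances
    (u : Fin 2 → ℤ → Ω → ℝ) (L : Fin 2 → ℝ)
    (hu_meas : ∀ j t, Measurable (u j t))
    (hu_indep : IndepFun (fun ω t => u 0 t ω) (fun ω t => u 1 t ω) P)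
    (hL : ∀ j, SHARWB.IsLongRunVariance P (u j) (L j))
    (hL_pos : ∀ j, 0 < L j)
    (hFCLT : SHARWB.FunctionalCLT P u L)
    (hdep : ∀ j, SHARWB.WeaklyDependent P (u j))
    -- the basis functions of the studentization
    (φ : ℕ → ℝ → ℝ) (hφ : φ = SHARWB.alternatingBasis ∨ φ = SHARWB.pairedBasis)
    -- the external draws of the bootstrap
    (v : ℕ → Fin 2 → Fin 2 → ℕ → S → ℝ) (C : ℝ)
    (hv : ∀ n, SHARWB.ExternalDraws Q (v n) C)
    -- sample sizes and numbers of basis functions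
    (T K Ks : ℕ → Fin 2 → ℕ)
    (hT : ∀ j, Tendsto (fun n => T n j) atTop atTop)
    (hK : ∀ j, Tendsto (fun n => K n j) atTop atTop)
    (hKs : ∀ j, Tendsto (fun n => Ks n j) atTop atTop)
    (hKT : ∀ j, Tendsto (fun n => (K n j : ℝ) / T n j) atTop (𝓝 0))
    (hKsT : ∀ j, Tendsto (fun n => (Ks n j : ℝ) / T n j) atTop (𝓝 0))
    -- the means of the two observed series
    (μ : Fin 2 → ℝ) :
    -- under the null, the bootstrap distribution is uniformly close to that of the statistic
    (μ 0 = μ 1 →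
      TendstoInMeasure P
        (fun n ω => SHARWB.bootDist P Q φ (T n) (K n) (Ks n) u (v n) μ (SHARWB.obs μ u ω))
        atTop (fun _ => 0)) ∧
    -- whether or not the null holds, it is uniformly close to the null distribution
    (∀ m : ℝ,
      TendstoInMeasure P
        (fun n ω => SHARWB.bootDist P Q φ (T n) (K n) (Ks n) u (v n) (fun _ => m)
          (SHARWB.obs μ u ω))
        atTop (fun _ => 0)) := by
  obtain ⟨r, m, hb⟩ := SHARWB.exists_isTrigBasis hφ
  have hLs : ∀ j, SHARWB.autocovSum P (u j) = L j := fun j => (hL j).autocovSum_eq (hdep j)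
  have hg : ∀ j, SHARWB.GrowthCondition (fun n => T n j) (fun n => K n j) (fun n => Ks n j) :=
    fun j => ⟨hT j, hK j, hKs j, hKT j, hKsT j⟩
  exact ⟨fun hμ => SHARWB.tendstoInMeasure_bootDist hu_meas hu_indep hL_pos hLs hFCLT hdep hb hg
      hv μ hμ,
    fun c => SHARWB.tendstoInMeasure_bootDist hu_meas hu_indep hL_pos hLs hFCLT hdep hb hg hv μ
      rfl⟩
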